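/- Consider a finite $n$-player extensive-form game with perfect recall and a player $i$. Write $\mathcal J$ for the information sets of player $i$, $A(j)$ for the actions at $j\in\mathcal J$, $\Sigma=\{(j,a):j\in\mathcal J,a\in A(j)\}\cup\{\varnothing\}$ for the sequences, $\Sigma_*=\Sigma\setminus\{\varnothing\}$, and $\sigma(j)$ for the last sequence of the player before $j$. Write $\sigma\succeq j$ if $\sigma=(j',a')$ with $j'=j$ or $j'$ a descendant of $j$, and let $\preceq$ also denote the precedence order of sequences. Let $Q\subseteq\mathbb R_{\ge0}^{\Sigma}$ be the sequence-form polytope ($q[\varnothing]=1$, $q[\sigma(j)]=\sum_{a}q[(j,a)]$ for all $j$), let $\Pi=Q\cap\{0,1\}^{\Sigma}$ be the deterministic strategies, and let $Q_j$, $\Pi_j$ be the corresponding sets for the part of the player's decision problem rooted at $j$ (with mass $1$ at $j$). For $\hat\sigma=(j,a)\in\Sigma_*$ and a vector $y$ indexed by the sequences $\sigma\succeq j$, let $\phi_{\hat\sigma\to y}$ be the linear map of $\mathbb R^{\Sigma}$ whose matrix has the entries $M[\sigma_r,\sigma_c]=1$ if $\sigma_c\not\succeq\hat\sigma$ and $\sigma_r=\sigma_c$;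 $M[\sigma_r,\sigma_c]=y[\sigma_r]$ if $\sigma_c=\hat\sigma$ and $\sigma_r\succeq j$; and $0$ otherwise. Let $\Phi=\{\phi_{\hat\sigma\to\hat\pi}:\hat\sigma=(j,a)\in\Sigma_*,\ \hat\pi\in\Pi_j\}$ be the set of canonical trigger deviation functions. Assume given, for each $j\in\mathcal J$, an oracle that returns a fixed point in the simplex of any stochastic $A(j)\times A(j)$ matrix, and takes $\mathrm{FP}(|A(j)|)$ steps per call. Consider the following algorithm. * NextElement: (1) regret matching on the simplex over $\Sigma_*$ gives weights $\lambda_{\hat\sigma}$; for each $\hat\sigma=(j,a)\in\Sigma_*$, a separate copy of counterfactual regret minimization (regret matching at each information set) gives $q_{\hat\sigma}\in Q_j$. (2) A fixed point $q^t\in Q$ of $\phi^t=\sum_{\hat\sigma}\lambda_{\hat\sigma}\phi_{\hat\sigma\to q_{\hat\sigma}}$ is computed top-down over the information sets: at $j$, with $\sigma_p=\sigma(j)$, put $q^t[(j,\cdot)]=0$ if $q^t[\sigma_p]=0$, and otherwise $q^t[(j,\cdot)]=q^t[\sigma_p]\,b$, where $b$ is the oracle's fixed point of the stochastic matrix $W/q^t[\sigma_p]$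 with $$W[a_r,a_c]=\sum_{(j',a'):\,j'\preceq\sigma_p}\lambda_{(j',a')}q_{(j',a')}[(j,a_r)]\,q^t[(j',a')]+\Big(\lambda_{(j,a_c)}q_{(j,a_c)}[(j,a_r)]+\big(1-\sum_{\hat\sigma\in\Sigma_*,\,\hat\sigma\preceq(j,a_c)}\lambda_{\hat\sigma}\big)\mathbf 1[a_r=a_c]\Big)q^t[\sigma_p].$$ (3) A deterministic strategy $\pi^t\in\Pi$ is sampled from $q^t$: top-down, at each information set $j$ that is reached, action $a$ is drawn with probability $q^t[(j,a)]/q^t[\sigma(j)]$, with fresh randomness. The output is $\pi^t$. * ObserveUtility($\ell^t$): the functional $L^t:\phi\mapsto\ell^t(\phi(q^t))$, stored as a matrix, is formed; each copy of counterfactual regret minimization observes $y\mapsto L^t(\phi_{\hat\sigma\to y})-L^t(\phi_{\hat\sigma\to 0})$, and regret matching over $\Sigma_*$ observes $\lambda\mapsto\sum_{\hat\sigma}\lambda_{\hat\sigma}L^t(\phi_{\hat\sigma\to q_{\hat\sigma}})$. Then the algorithm is a $\Phi$-regret minimizer for $\Pi$. Precisely: $q^t\in Q$ and $\pi^t\in\Pi$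 at all times $t$, and the sampling step is unbiased: for every $q\in Q$, the deterministic strategy sampled from $q$ has mean $q$. Suppose the environment supplies random linear utility functions $\ell^1,\ell^2,\dots$ on $\mathbb R^{\Sigma}$, where $\ell^t$ may depend on everything that happened before round $t$ and on the environment's own randomness, but is independent of the random numbers that the algorithm uses in round $t$ (formally, these random numbers are independent of the random numbers of earlier rounds and $\ell^1,\dots,\ell^t$ taken jointly), and let the oracles be measurable functions. Then the $\pi^t$ are random variables, and for all $T\in\mathbb N$, all constants $D$ with $\max_{q,q'\in Q}\{\ell^t(q)-\ell^t(q')\}\le D$ almost surely for $t=1,\dots,T$, and all $\delta\in(0,1)$, with probability at least $1-\delta$, $$R^T=\max_{\phi\in\Phi}\sum_{t=1}^T\big(\ell^t(\phi(\pi^t))-\ell^t(\pi^t)\big)\ \le\ 2D|\Sigma|\sqrt T+D\sqrt{8T\log(1/\delta)} .$$ Furthermore, counting steps on a unit-cost real-number machine with the description of the game stored in tables, ObserveUtility takes $O(|\Sigma|^2)$ steps and NextElement takes $O\big(|\Sigma|^2+\sum_{j\in\mathcal J}\mathrm{FP}(|A(j)|)\big)$ steps at every round, with absolute constants. -/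

import Mathlib

open MeasureTheory ProbabilityTheory

/-! ### Extensive-form games -/

/-- A finite rooted tree with labelled edges: a node is the list of the labels on the path from the
root to it, and the root is the empty list. -/
structure GameTree (Act : Type) [DecidableEq Act] where
  nodes : Finset (List Act)
  root_mem : [] ∈ nodes
  prefix_mem : ∀ (h : List Act) (a : Act), h ++ [a] ∈ nodes → h ∈ nodes

/-- The actions available at a node; terminal nodes are those where this set is empty. -/
def GameTree.acts {Act : Type} [DecidableEq Act] (G : GameTree Act) (h : List Act) : Finset Act :=
  (G.nodes.biUnion List.toFinset).filter fun a => h ++ [a] ∈ G.nodes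

theorem GameTree.mem_acts {Act : Type} [DecidableEq Act] (G : GameTree Act) (h : List Act)
    (a : Act) : a ∈ G.acts h ↔ h ++ [a] ∈ G.nodes := by
  simp only [GameTree.acts, Finset.mem_filter, Finset.mem_biUnion, List.mem_toFinset,
    and_iff_right_iff_imp]
  intro ha
  exact ⟨h ++ [a], ha, by simp⟩

/-- The nonterminal nodes of a tree at which player `i` acts. -/
def GameTree.decisionNodes {Act : Type} [DecidableEq Act] (G : GameTree Act) {n : ℕ}
    (turn : List Act → Option (Fin n)) (i : Fin n) : Finset (List Act) :=
  G.nodes.filter fun h => turn h = some i ∧ (G.acts h).Nonempty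

/-- A finite `n`-player extensive-form game. At a nonterminal node `h` player `i` acts if
`turn h = some i`, and chance acts if `turn h = none`. The decision nodes of each player are
partitioned into information sets, on each of which the available actions are constant. -/
structure Game (n : ℕ) (Act : Type) [DecidableEq Act] extends GameTree Act where
  turn : List Act → Option (Fin n)
  info : ∀ i : Fin n, Finpartition (toGameTree.decisionNodes turn i)
  acts_eq : ∀ i, ∀ j ∈ (info i).parts, ∀ h ∈ j, ∀ h' ∈ j, toGameTree.acts h = toGameTree.acts h'
  chance : List Act → Act → ℝ
  chance_pos : ∀ h ∈ nodes, turn h = none → ∀ a ∈ toGameTree.acts h, 0 < chance h a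
  chance_sum : ∀ h ∈ nodes, turn h = none → (toGameTree.acts h).Nonempty →
    ∑ a ∈ toGameTree.acts h, chance h a = 1
  payoff : Fin n → List Act → ℝ

namespace Game

variable {n : ℕ} {Act : Type} [DecidableEq Act] (G : Game n Act) (i : Fin n)

/-- The pairs (information set, action) of player `i` on the path from the root to `h`, in the
order in which they are met. -/
def hist (h : List Act) : List (Finset (List Act) × Act) :=
  (List.range h.length).filterMap fun k =>
    if h.take k ∈ G.toGameTree.decisionNodes G.turn i then
      (h[k]?).map fun a => ((G.info i).part (h.take k), a)
    else none

/-- Perfect recall: nodes in the same information set share the player's past. -/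
def PerfectRecall : Prop :=
  ∀ i, ∀ j ∈ (G.info i).parts, ∀ h ∈ j, ∀ h' ∈ j, G.hist i h = G.hist i h'

/-- The information sets of player `i`. -/
abbrev InfoSet : Type := {j : Finset (List Act) // j ∈ (G.info i).parts}

variable {G i}

/-- The actions available at an information set. -/
abbrev Action (j : G.InfoSet i) : Type := {a : Act // a ∈ j.1.biUnion G.toGameTree.acts}

variable (G i)

/-- The nonempty sequences of player `i`. -/
abbrev SeqStar : Type := Σ j : G.InfoSet i, Action j

/-- All sequences of player `i`; `none` is the empty sequence. -/
abbrev Seq : Type := Option (G.SeqStar i)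

variable {G i}

/-- The last sequence of the player before information set `j`. -/
noncomputable def parentSeq (j : G.InfoSet i) : G.Seq i :=
  open Classical in
  if H : ∃ σ : G.SeqStar i, ∃ h ∈ j.1, (G.hist i h).getLast? = some (σ.1.1, σ.2.1) then
    some H.choose
  else none

/-- `j ⪯ j'`: some path of the game tree to a node of `j'` passes through a node of `j`. -/
def infoLe (j j' : G.InfoSet i) : Prop := ∃ h ∈ j.1, ∃ h' ∈ j'.1, h <+: h'

/-- `j ⪯ σ`: the sequence `σ` ends at `j` or at a descendant of `j`. -/
def infoLeSeq (j : G.InfoSet i) (σ : G.Seq i) : Prop := ∃ τ : G.SeqStar i, σ = some τ ∧ infoLe j τ.1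

/-- `σ ⪯ σ'` for sequences of the same player. -/
def seqLe : G.Seq i → G.Seq i → Prop
  | none, _ => True
  | some _, none => False
  | some σ, some σ' => σ = σ' ∨ ∃ h ∈ σ'.1.1, (σ.1.1, σ.2.1) ∈ G.hist i h

/-! ### Strategies and deviations -/

variable (G i)

/-- The sequence-form polytope. -/
def Q : Set (G.Seq i → ℝ) :=
  {q | (∀ σ, 0 ≤ q σ) ∧ q none = 1 ∧ ∀ j, q (parentSeq j) = ∑ a : Action j, q (some ⟨j, a⟩)}

/-- Deterministic sequence-form strategies. -/
def Pure : Set (G.Seq i → ℝ) := {q | q ∈ G.Q i ∧ ∀ σ, q σ = 0 ∨ q σ = 1}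

variable {G i}

/-- Sequence-form strategies for the subtree at `j`; a vector indexed by the sequences `σ ⪰ j` is
stored as a vector indexed by all sequences, with value zero at the others. -/
def QSub (j : G.InfoSet i) : Set (G.Seq i → ℝ) :=
  {q | (∀ σ, 0 ≤ q σ) ∧ (∀ σ, ¬ infoLeSeq j σ → q σ = 0) ∧
    ∑ a : Action j, q (some ⟨j, a⟩) = 1 ∧
    ∀ j', infoLe j j' → j' ≠ j → q (parentSeq j') = ∑ a : Action j', q (some ⟨j', a⟩)}

/-- Deterministic sequence-form strategies for the subtree at `j`. -/
def PureSub (j : G.InfoSet i) : Set (G.Seq i → ℝ) := {q | q ∈ QSub j ∧ ∀ σ, q σ = 0 ∨ q σ = 1}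

/-- The matrix of the canonical deviation with trigger `τ` and continuation `y`. -/
noncomputable def devMatrix (τ : G.SeqStar i) (y : G.Seq i → ℝ) :
    Matrix (G.Seq i) (G.Seq i) ℝ :=
  open Classical in
  Matrix.of fun r c =>
    if ¬ seqLe (some τ) c ∧ r = c then 1
    else if c = some τ ∧ infoLeSeq τ.1 r then y r
    else 0

variable (G i)

/-- The set of all canonical trigger deviation functions of player `i`. -/
def Dev : Set ((G.Seq i → ℝ) →ₗ[ℝ] (G.Seq i → ℝ)) :=
  {φ | ∃ (τ : G.SeqStar i) (y : G.Seq i → ℝ), y ∈ PureSub τ.1 ∧ φ = (devMatrix τ y).mulVecLin}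

variable {G i}

/-- Cumulative regret relative to `Φ` of the points `x 0, …, x (T-1)` against the linear utilities
`z ↦ ℓ t ⬝ᵥ z`. -/
noncomputable def phiRegret {S : Type*} [Fintype S] (Φ : Set ((S → ℝ) →ₗ[ℝ] (S → ℝ)))
    (ℓ x : ℕ → S → ℝ) (T : ℕ) : ℝ :=
  sSup ((fun φ => ∑ t ∈ Finset.range T, (ℓ t ⬝ᵥ φ (x t) - ℓ t ⬝ᵥ x t)) '' Φ)

/-- An enumeration of the information sets in which ancestors come first. -/
structure IsTopDown (ord : List (G.InfoSet i)) : Prop where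
  nodup : ord.Nodup
  complete : ∀ j, j ∈ ord
  sorted : ord.Pairwise fun j j' => ¬ infoLe j' j

end Game

/-! ### Step counting

Unit-cost real-number machine: a computation has a result and a number of steps. Reading or writing
one array cell, one arithmetic operation, one comparison, one look-up in the stored description of
the game (parent of an information set, order of sequences), and the overhead of one round of a
loop cost one step each. -/

structure Timed (α : Type) where
  val : α
  cost : ℕ

namespace Timed

instance : Monad Timed where
  pure a := ⟨a, 0⟩
  bind x f := ⟨(f x.val).val, x.cost + (f x.val).cost⟩

@[simp] theorem val_pure {α : Type} (a : α) : (pure a : Timed α).val = a := rfl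
@[simp] theorem cost_pure {α : Type} (a : α) : (pure a : Timed α).cost = 0 := rfl
@[simp] theorem val_bind {α β : Type} (x : Timed α) (f : α → Timed β) :
    (x >>= f).val = (f x.val).val := rfl
@[simp] theorem cost_bind {α β : Type} (x : Timed α) (f : α → Timed β) :
    (x >>= f).cost = x.cost + (f x.val).cost := rfl

/-- One elementary step with result `a`. -/
def unit {α : Type} (a : α) : Timed α := ⟨a, 1⟩

noncomputable def add (x y : ℝ) : Timed ℝ := unit (x + y)
noncomputable def sub (x y : ℝ) : Timed ℝ := unit (x - y)
noncomputable def mul (x y : ℝ) : Timed ℝ := unit (x * y)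
noncomputable def div (x y : ℝ) : Timed ℝ := unit (x / y)
noncomputable def pos (x : ℝ) : Timed ℝ := unit (max x 0)

/-- A comparison. -/
noncomputable def test (p : Prop) : Timed Bool := open Classical in unit (decide p)

/-- Read an array cell. -/
def rd {ι : Type} {β : Type} (x : ι → β) (k : ι) : Timed β := unit (x k)

/-- Read a cell of a two-dimensional array. -/
def rd₂ {ι κ : Type} {β : Type} (x : ι → κ → β) (k : ι) (l : κ) : Timed β := unit (x k l)

/-- Write an array cell. -/
noncomputable def wr {ι : Type} {β : Type} (x : ι → β) (k : ι) (v : β) : Timed (ι → β) :=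
  open Classical in unit (Function.update x k v)

/-- Run `f` through the elements of a list, from left to right, updating a state. -/
def loop {ι : Type} {β : Type} : List ι → β → (β → ι → Timed β) → Timed β
  | [], s, _ => ⟨s, 0⟩
  | k :: l, s, f => ⟨(loop l (f s k).val f).val, 1 + (f s k).cost + (loop l (f s k).val f).cost⟩

/-- Fill a new array with the values `f k` for `k` in the list `l`. -/
noncomputable def tabulate {ι : Type} {β : Type} [Zero β] (l : List ι) (f : ι → Timed β) :
    Timed (ι → β) :=
  open Classical in
  ⟨fun k => if k ∈ l then (f k).val else 0, (l.map fun k => (f k).cost + 1).sum⟩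

/-- Add the values `f k` for `k` in the list `l`. -/
noncomputable def sum {ι : Type} (l : List ι) (f : ι → Timed ℝ) : Timed ℝ :=
  ⟨(l.map fun k => (f k).val).sum, (l.map fun k => (f k).cost + 1).sum⟩

end Timed

/-! ### Regret matching on a simplex -/

section RegretMatching

variable {ι : Type}

/-- The next point of the simplex: proportional to the positive parts of the cumulative regrets
`R`, and uniform if there are none. -/
noncomputable def rmNext (l : List ι) (R : ι → ℝ) : Timed (ι → ℝ) := do
  let p ← Timed.tabulate l fun k => do Timed.pos (← Timed.rd R k)
  let s ← Timed.sum l fun k => Timed.rd p k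
  if ← Timed.test (s = 0) then
    let m ← Timed.sum l fun _ => pure 1
    let c ← Timed.div 1 m
    Timed.tabulate l fun _ => pure c
  else
    Timed.tabulate l fun k => do Timed.div (← Timed.rd p k) s

/-- Update the cumulative regrets `R` after playing `b` against the utility vector `v`. -/
noncomputable def rmObserve (l : List ι) (R b v : ι → ℝ) : Timed (ι → ℝ) := do
  let m ← Timed.sum l fun k => do Timed.mul (← Timed.rd b k) (← Timed.rd v k)
  Timed.tabulate l fun k => do Timed.add (← Timed.rd R k) (← Timed.sub (← Timed.rd v k) m)

end RegretMatching

namespace Game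

variable {n : ℕ} {Act : Type} [DecidableEq Act] {G : Game n Act} {i : Fin n}

noncomputable def actionList (j : G.InfoSet i) : List (Action j) := Finset.univ.toList

variable (G i)
noncomputable def starList : List (G.SeqStar i) := Finset.univ.toList
noncomputable def seqList : List (G.Seq i) := Finset.univ.toList
variable {G i}

/-! ### Counterfactual regret minimization on the subtree strategies at `j` -/

/-- Next strategy: regret matching at every information set `j' ⪰ j`, converted top-down to
sequence form. `R` holds the cumulative counterfactual regrets. -/
noncomputable def cfrNext (ord : List (G.InfoSet i)) (j : G.InfoSet i) (R : G.SeqStar i → ℝ) :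
    Timed (G.Seq i → ℝ) := do
  let q₀ ← Timed.tabulate (G.seqList i) fun _ => pure 0
  Timed.loop ord q₀ fun q j' => do
    if ← Timed.test (infoLe j j') then
      let b ← rmNext (actionList j') fun a => R ⟨j', a⟩
      let p ← (do
        if ← Timed.test (j' = j) then pure 1
        else
          let σ ← Timed.unit (parentSeq j')
          Timed.rd q σ)
      Timed.loop (actionList j') q fun q a => do
        let v ← Timed.mul (← Timed.rd b a) p
        Timed.wr q (some ⟨j', a⟩) v
    else pure q

/-- Update of the cumulative counterfactual regrets upon the utility vector `g`, bottom-up. At the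
time when `j'` is visited, `v (some ⟨j', a⟩)` is the value of choosing `a` at `j'` and then
following the current strategy. -/
noncomputable def cfrObserve (ord : List (G.InfoSet i)) (j : G.InfoSet i) (R : G.SeqStar i → ℝ)
    (g : G.Seq i → ℝ) : Timed (G.SeqStar i → ℝ) := do
  let v₀ ← Timed.tabulate (G.seqList i) fun σ => Timed.rd g σ
  let R₀ ← Timed.tabulate (G.starList i) fun τ => Timed.rd R τ
  let s ← Timed.loop ord.reverse (R₀, v₀) fun s j' => do
    if ← Timed.test (infoLe j j') then
      let b ← rmNext (actionList j') fun a => s.1 ⟨j', a⟩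
      let V ← Timed.sum (actionList j') fun a => do
        Timed.mul (← Timed.rd b a) (← Timed.rd s.2 (some ⟨j', a⟩))
      let R' ← Timed.loop (actionList j') s.1 fun R' a => do
        let d ← Timed.sub (← Timed.rd s.2 (some ⟨j', a⟩)) V
        Timed.wr R' ⟨j', a⟩ (← Timed.add (← Timed.rd R' ⟨j', a⟩) d)
      if ← Timed.test (j' = j) then pure (R', s.2)
      else
        let σ ← Timed.unit (parentSeq j')
        let v' ← Timed.wr s.2 σ (← Timed.add (← Timed.rd s.2 σ) V)
        pure (R', v')
    else pure s
  pure s.1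

/-! ### Regret minimizer for the deviations with a fixed trigger `τ`

A deviation is stored through its continuation strategy, and a linear functional `L` of deviations
through the matrix `Λ` with `L φ = ∑ r, ∑ c, Λ r c * ⟨φ⟩ r c`. -/

noncomputable def trigNext (ord : List (G.InfoSet i)) (τ : G.SeqStar i) (R : G.SeqStar i → ℝ) :
    Timed (G.Seq i → ℝ) := cfrNext ord τ.1 R

/-- The utility `y ↦ L (φ_y) - L (φ_0)`, whose coordinates are `Λ r τ` for `r ⪰ j`, is passed to
counterfactual regret minimization. -/
noncomputable def trigObserve (ord : List (G.InfoSet i)) (τ : G.SeqStar i) (R : G.SeqStar i → ℝ)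
    (Λ : G.Seq i → G.Seq i → ℝ) : Timed (G.SeqStar i → ℝ) := do
  let g ← Timed.tabulate (G.seqList i) fun r => do
    if ← Timed.test (infoLeSeq τ.1 r) then Timed.rd₂ Λ r (some τ) else pure 0
  cfrObserve ord τ.1 R g

/-- The value `L φ` at the deviation with trigger `τ` and continuation `y`. -/
noncomputable def evalDev (Λ : G.Seq i → G.Seq i → ℝ) (τ : G.SeqStar i) (y : G.Seq i → ℝ) :
    Timed ℝ :=
  Timed.sum (G.seqList i) fun r => do
    let d ← (do
      if ← Timed.test (seqLe (some τ) r) then pure 0 else Timed.rd₂ Λ r r)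
    let e ← (do
      if ← Timed.test (infoLeSeq τ.1 r) then
        Timed.mul (← Timed.rd₂ Λ r (some τ)) (← Timed.rd y r)
      else pure 0)
    Timed.add d e

/-! ### Fixed points of convex combinations of deviations -/

/-- `oracle` returns fixed points, in the simplex, of stochastic matrices (columns sum to one). -/
def IsFixedPointOracle {A : Type} [Fintype A] (oracle : (A → A → ℝ) → A → ℝ) : Prop :=
  ∀ W : A → A → ℝ, (∀ a b, 0 ≤ W a b) → (∀ b, ∑ a, W a b = 1) →
    oracle W ∈ stdSimplex ℝ A ∧ ∀ a, ∑ b, W a b * oracle W b = oracle W a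

/-- A call of the fixed-point oracle for `m × m` matrices takes `fp m` steps. -/
def callOracle (oracle : ∀ j : G.InfoSet i, (Action j → Action j → ℝ) → Action j → ℝ)
    (fp : ℕ → ℕ) (j : G.InfoSet i) (W : Action j → Action j → ℝ) : Timed (Action j → ℝ) :=
  ⟨oracle j W, fp (Fintype.card (Action j)) + 1⟩

/-- Extend a partial fixed point `x` of `∑ τ, lam τ • φ_τ`, where `φ_τ` has trigger `τ` and
continuation `cont τ`, to the information set `j`. -/
noncomputable def extend (oracle : ∀ j : G.InfoSet i, (Action j → Action j → ℝ) → Action j → ℝ)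
    (fp : ℕ → ℕ) (lam : G.SeqStar i → ℝ) (cont : G.SeqStar i → G.Seq i → ℝ)
    (x : G.Seq i → ℝ) (j : G.InfoSet i) : Timed (G.Seq i → ℝ) := do
  let σp ← Timed.unit (parentSeq j)
  let r ← Timed.tabulate (actionList j) fun a => Timed.sum (G.starList i) fun τ => do
    if ← Timed.test (infoLeSeq τ.1 σp) then
      let m ← Timed.mul (← Timed.rd lam τ) (← Timed.rd₂ cont τ (some ⟨j, a⟩))
      Timed.mul m (← Timed.rd x (some τ))
    else pure 0
  let s ← Timed.tabulate (actionList j) fun a => do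
    let m ← Timed.sum (G.starList i) fun τ => do
      if ← Timed.test (seqLe (some τ) (some ⟨j, a⟩)) then Timed.rd lam τ else pure 0
    Timed.sub 1 m
  let p ← Timed.rd x σp
  let W ← Timed.tabulate (actionList j) fun ar => Timed.tabulate (actionList j) fun ac => do
    let d ← (do if ← Timed.test (ar = ac) then Timed.rd s ac else pure 0)
    let m ← Timed.mul (← Timed.rd lam ⟨j, ac⟩) (← Timed.rd₂ cont ⟨j, ac⟩ (some ⟨j, ar⟩))
    Timed.add (← Timed.rd r ar) (← Timed.mul (← Timed.add m d) p)
  let w ← (do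
    if ← Timed.test (p = 0) then Timed.tabulate (actionList j) fun _ => pure 0
    else
      let M ← Timed.tabulate (actionList j) fun ar => Timed.tabulate (actionList j) fun ac => do
        Timed.div (← Timed.rd₂ W ar ac) p
      let b ← callOracle oracle fp j M
      Timed.tabulate (actionList j) fun a => do Timed.mul p (← Timed.rd b a))
  Timed.loop (actionList j) x fun x a => do Timed.wr x (some ⟨j, a⟩) (← Timed.rd w a)

/-- Fixed point of `∑ τ, lam τ • φ_τ`, built one information set at a time, top-down. -/
noncomputable def fixedPoint (ord : List (G.InfoSet i))
    (oracle : ∀ j : G.InfoSet i, (Action j → Action j → ℝ) → Action j → ℝ) (fp : ℕ → ℕ)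
    (lam : G.SeqStar i → ℝ) (cont : G.SeqStar i → G.Seq i → ℝ) : Timed (G.Seq i → ℝ) := do
  let x₀ ← Timed.tabulate (G.seqList i) fun σ => do
    if ← Timed.test (σ = none) then pure 1 else pure 0
  Timed.loop ord x₀ fun x j => extend oracle fp lam cont x j

/-! ### Sampling a deterministic strategy -/

/-- The natural sampling scheme: top-down, at each information set `j` that is reached an action
`a` is drawn with probability `q (j, a) / q (parent of j)`. The draw at `j` uses the random number
`u j`, uniform on the unit interval: the selected action is the first one at which the partial sums
of `q (j, ·)` exceed `u j * q (parent of j)` (the last one if there is none). -/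
noncomputable def sample (ord : List (G.InfoSet i)) (u : G.InfoSet i → unitInterval)
    (q : G.Seq i → ℝ) : Timed (G.Seq i → ℝ) := do
  let π₀ ← Timed.tabulate (G.seqList i) fun σ => do
    if ← Timed.test (σ = none) then pure 1 else pure 0
  Timed.loop ord π₀ fun π j => do
    let σp ← Timed.unit (parentSeq j)
    let m ← Timed.rd π σp
    if ← Timed.test (m = 1) then
      let uj ← Timed.unit (u j : ℝ)
      let z ← Timed.mul uj (← Timed.rd q σp)
      let c ← Timed.loop (actionList j) ((0, none) : ℝ × Option (Action j)) fun c a => do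
        if ← Timed.test (z < c.1) then pure c
        else
          let s ← Timed.add c.1 (← Timed.rd q (some ⟨j, a⟩))
          pure (s, some a)
      match c.2 with
      | some a => Timed.wr π (some ⟨j, a⟩) 1
      | none => pure π
    else pure π

/-! ### The complete algorithm -/

variable (G i)

/-- The memory of the algorithm: cumulative regrets of the minimizer over the simplex of triggers
and of the counterfactual regret minimizers (one for each trigger), and the weights, continuation
strategies and mixed strategy that were computed last. -/
structure Mem where
  regSimplex : G.SeqStar i → ℝ
  regCfr : G.SeqStar i → G.SeqStar i → ℝ
  lam : G.SeqStar i → ℝ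
  cont : G.SeqStar i → G.Seq i → ℝ
  strat : G.Seq i → ℝ

/-- The memory at the start. -/
def Mem.start : G.Mem i := ⟨0, 0, 0, 0, 0⟩

variable {G i}

/-- Next element of the regret minimizer for the convex hull of all deviations: the list of weights
and continuation strategies. -/
noncomputable def hullNext (ord : List (G.InfoSet i)) (M : G.Mem i) : Timed (G.Mem i) := do
  let lam ← rmNext (G.starList i) M.regSimplex
  let cont ← Timed.tabulate (G.starList i) fun τ => trigNext ord τ (M.regCfr τ)
  pure { M with lam := lam, cont := cont }

noncomputable def hullObserve (ord : List (G.InfoSet i)) (M : G.Mem i)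
    (Λ : G.Seq i → G.Seq i → ℝ) : Timed (G.Mem i) := do
  let R ← Timed.tabulate (G.starList i) fun τ => trigObserve ord τ (M.regCfr τ) Λ
  let v ← Timed.tabulate (G.starList i) fun τ => evalDev Λ τ (M.cont τ)
  let S ← rmObserve (G.starList i) M.regSimplex M.lam v
  pure { M with regSimplex := S, regCfr := R }

/-- Next element of the regret minimizer for mixed strategies; the output is `Mem.strat`. -/
noncomputable def mixedNext (ord : List (G.InfoSet i))
    (oracle : ∀ j : G.InfoSet i, (Action j → Action j → ℝ) → Action j → ℝ) (fp : ℕ → ℕ)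
    (M : G.Mem i) : Timed (G.Mem i) := do
  let M' ← hullNext ord M
  let q ← fixedPoint ord oracle fp M'.lam M'.cont
  pure { M' with strat := q }

/-- The functional `φ ↦ ℓ (φ q)`, whose matrix is `ℓ qᵀ`, is passed on. -/
noncomputable def mixedObserve (ord : List (G.InfoSet i)) (M : G.Mem i) (ℓ : G.Seq i → ℝ) :
    Timed (G.Mem i) := do
  let Λ ← Timed.tabulate (G.seqList i) fun r => Timed.tabulate (G.seqList i) fun c => do
    Timed.mul (← Timed.rd ℓ r) (← Timed.rd M.strat c)
  hullObserve ord M Λ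

/-- `NextElement` of the algorithm: new memory and deterministic strategy, from the memory and the
random numbers `u` of this round. -/
noncomputable def nextElement (ord : List (G.InfoSet i))
    (oracle : ∀ j : G.InfoSet i, (Action j → Action j → ℝ) → Action j → ℝ) (fp : ℕ → ℕ)
    (M : G.Mem i) (u : G.InfoSet i → unitInterval) : Timed (G.Mem i × (G.Seq i → ℝ)) := do
  let M' ← mixedNext ord oracle fp M
  let π ← sample ord u M'.strat
  pure (M', π)

/-- `ObserveUtility` of the algorithm, for the linear utility `x ↦ ℓ ⬝ᵥ x`. -/
noncomputable def observeUtility (ord : List (G.InfoSet i)) (M : G.Mem i) (ℓ : G.Seq i → ℝ) :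
    Timed (G.Mem i) := mixedObserve ord M ℓ

/-- The memory before round `t`, for random numbers `u` and utilities `ℓ`. -/
noncomputable def memAt (ord : List (G.InfoSet i))
    (oracle : ∀ j : G.InfoSet i, (Action j → Action j → ℝ) → Action j → ℝ) (fp : ℕ → ℕ)
    (u : ℕ → G.InfoSet i → unitInterval) (ℓ : ℕ → G.Seq i → ℝ) : ℕ → G.Mem i
  | 0 => Mem.start G i
  | t + 1 => (observeUtility ord
      (nextElement ord oracle fp (memAt ord oracle fp u ℓ t) (u t)).val.1 (ℓ t)).val

/-- The mixed strategy computed in round `t`. -/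
noncomputable def mixedAt (ord : List (G.InfoSet i))
    (oracle : ∀ j : G.InfoSet i, (Action j → Action j → ℝ) → Action j → ℝ) (fp : ℕ → ℕ)
    (u : ℕ → G.InfoSet i → unitInterval) (ℓ : ℕ → G.Seq i → ℝ) (t : ℕ) : G.Seq i → ℝ :=
  (nextElement ord oracle fp (memAt ord oracle fp u ℓ t) (u t)).val.1.strat

/-- The deterministic strategy returned in round `t`. -/
noncomputable def playAt (ord : List (G.InfoSet i))
    (oracle : ∀ j : G.InfoSet i, (Action j → Action j → ℝ) → Action j → ℝ) (fp : ℕ → ℕ)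
    (u : ℕ → G.InfoSet i → unitInterval) (ℓ : ℕ → G.Seq i → ℝ) (t : ℕ) : G.Seq i → ℝ :=
  (nextElement ord oracle fp (memAt ord oracle fp u ℓ t) (u t)).val.2

end Game

/-! The mixed strategy `q` of a round is a fixed point of the current average `φ` of trigger
deviations, so `ℓ (φ q) = ℓ q`. Hence the regret of `q` against a deviation is the ordinary external
regret of a learner who chooses points in the convex hull of the deviations and receives the linear
utilities `φ ↦ ℓ (φ q)`. That learner is a composition. Regret matching over the triggers costs `D
√(m T)`, where `m` is the number of nonempty sequences (`regret_matching_bound`). For a fixed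
trigger, counterfactual regret minimization over the continuations costs at most `D √T m`
(`cfr_regret_bound`). The utilities passed to both have range at most `D`, because deviations map
`Q` into `Q` (`dev_mem_Q`). Together this gives `mixed_regret_bound`.

Counterfactual regret minimization rests on a telescoping identity (`cfr_decomposition`): the gap
between a strategy and the current value is the sum of the local advantages, weighted by the
strategy. The local utilities have range at most `D`, since a difference of two of them is also a
difference of two strategies of the subtree (`exists_dotProduct_sub_eq`).

The fixed point exists and is found top-down because flow balance at the parent sequence makes the
next local matrix stochastic, and its fixed point is exactly balance at the new sequences
(`fixedPoint_balanced`).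

Passing from `q` to the sampled strategy uses fresh randomness. A coordinate of the sample is a
product of indicators, one for each information set on the path, so its mean is the matching
coordinate of `q` (`sample_eq_prod`). The utilities and the memory before the round are independent
of the draw, and the memory is updated through `q`, never through the sample. The sampling errors in
the gain of a deviation thus form a martingale difference sequence with increments of variance proxy
`D²`. A Chernoff bound for each deviation (`measure_gainError_ge_le`) and a union bound over at most
`m 2^m` pairs of a trigger and a pure continuation finish the proof. The price of the union bound is
of order `√m`, which the linear term absorbs (`union_bound_arith`, `final_arith`).

All loops are first replaced by closed forms or recursive equations (`val_cfrNext`,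
`val_cfrObserve`, `fixedPoint_spec`, `sample_spec`). Perfect recall enters by making the information
sets a forest, on which top-down and bottom-up induction are available. -/

namespace Timed

variable {α ι κ : Type} {β : Type}

/-! ### Results and costs of the elementary operations -/

@[simp] theorem val_unit (a : α) : (unit a).val = a := rfl
@[simp] theorem cost_unit (a : α) : (unit a).cost = 1 := rfl
@[simp] theorem val_add (x y : ℝ) : (add x y).val = x + y := rfl
@[simp] theorem cost_add (x y : ℝ) : (add x y).cost = 1 := rfl
@[simp] theorem val_sub (x y : ℝ) : (sub x y).val = x - y := rfl
@[simp] theorem cost_sub (x y : ℝ) : (sub x y).cost = 1 := rfl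
@[simp] theorem val_mul (x y : ℝ) : (mul x y).val = x * y := rfl
@[simp] theorem cost_mul (x y : ℝ) : (mul x y).cost = 1 := rfl
@[simp] theorem val_div (x y : ℝ) : (div x y).val = x / y := rfl
@[simp] theorem cost_div (x y : ℝ) : (div x y).cost = 1 := rfl
@[simp] theorem val_pos (x : ℝ) : (pos x).val = max x 0 := rfl
@[simp] theorem cost_pos (x : ℝ) : (pos x).cost = 1 := rfl
@[simp] theorem val_test (p : Prop) [Decidable p] : (test p).val = decide p := by
  simp [test]
@[simp] theorem cost_test (p : Prop) : (test p).cost = 1 := rfl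
@[simp] theorem val_rd (x : ι → β) (k : ι) : (rd x k).val = x k := rfl
@[simp] theorem cost_rd (x : ι → β) (k : ι) : (rd x k).cost = 1 := rfl
@[simp] theorem val_rd₂ (x : ι → κ → β) (k : ι) (l : κ) : (rd₂ x k l).val = x k l := rfl
@[simp] theorem cost_rd₂ (x : ι → κ → β) (k : ι) (l : κ) : (rd₂ x k l).cost = 1 := rfl
@[simp] theorem val_wr [DecidableEq ι] (x : ι → β) (k : ι) (v : β) :
    (wr x k v).val = Function.update x k v := by
  unfold wr
  simp only [val_unit]
  congr!
@[simp] theorem cost_wr (x : ι → β) (k : ι) (v : β) : (wr x k v).cost = 1 := rfl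

@[simp] theorem val_ite (c : Prop) [Decidable c] (x y : Timed α) :
    (if c then x else y).val = if c then x.val else y.val := apply_ite _ _ _ _
@[simp] theorem cost_ite (c : Prop) [Decidable c] (x y : Timed α) :
    (if c then x else y).cost = if c then x.cost else y.cost := apply_ite _ _ _ _

theorem val_loop (l : List ι) (s : β) (f : β → ι → Timed β) :
    (loop l s f).val = l.foldl (fun s k => (f s k).val) s := by
  induction l generalizing s with
  | nil => rfl
  | cons k l ih => exact ih _

theorem cost_loop_le (l : List ι) (s : β) (f : β → ι → Timed β) (c : ι → ℕ)
    (h : ∀ s k, (f s k).cost ≤ c k) : (loop l s f).cost ≤ (l.map fun k => c k + 1).sum := by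
  induction l generalizing s with
  | nil => simp [loop]
  | cons k l ih =>
    simp only [loop, List.map_cons, List.sum_cons]
    have := h s k
    have := ih (f s k).val
    omega

@[simp] theorem val_tabulate [Zero β] [DecidableEq ι] (l : List ι) (f : ι → Timed β) (k : ι) :
    (tabulate l f).val k = if k ∈ l then (f k).val else 0 := by
  unfold tabulate
  congr!

@[simp] theorem val_sum (l : List ι) (f : ι → Timed ℝ) :
    (sum l f).val = (l.map fun k => (f k).val).sum := rfl

end Timed

/-! ### Regret matching -/

section RegretMatching

variable {ι : Type} [Fintype ι]

/-- The result of `rmNext` in closed form. -/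
noncomputable def rmPoint (R : ι → ℝ) (k : ι) : ℝ :=
  if ∑ k, max (R k) 0 = 0 then 1 / Fintype.card ι else max (R k) 0 / ∑ k, max (R k) 0

theorem val_rmNext (R : ι → ℝ) : (rmNext Finset.univ.toList R).val = rmPoint R := by
  classical
  funext k
  simp only [rmNext, Timed.val_bind, Timed.val_pos, Timed.val_rd, Timed.val_test,
    Timed.val_ite, decide_eq_true_eq, Timed.val_sum, Finset.sum_map_toList, Timed.val_div,
    ite_apply, Timed.val_tabulate, Finset.mem_toList, Finset.mem_univ, if_true, Timed.val_pure,
    rmPoint]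
  simp

theorem rmPoint_nonneg (R : ι → ℝ) (k : ι) : 0 ≤ rmPoint R k := by
  unfold rmPoint
  split_ifs
  · positivity
  · exact div_nonneg (le_max_right _ _) (Finset.sum_nonneg fun _ _ => le_max_right _ _)

theorem sum_rmPoint [Nonempty ι] (R : ι → ℝ) : ∑ k, rmPoint R k = 1 := by
  unfold rmPoint
  split_ifs with h
  · simp
  · rw [← Finset.sum_div, div_self h]

/-- Blackwell's condition: the point played is proportional to the positive part of the regrets, and
the average instantaneous regret under the point played is zero. -/
theorem sum_pos_mul_regret (R v : ι → ℝ) :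
    ∑ k, max (R k) 0 * (v k - ∑ k', rmPoint R k' * v k') = 0 := by
  by_cases h : ∑ k, max (R k) 0 = 0
  · have h' := (Finset.sum_eq_zero_iff_of_nonneg fun k _ => le_max_right (R k) 0).1 h
    exact Finset.sum_eq_zero fun k hk => by rw [h' k hk, zero_mul]
  · simp only [rmPoint, if_neg h, mul_sub, Finset.sum_sub_distrib, ← Finset.sum_mul]
    rw [Finset.mul_sum, sub_eq_zero]
    refine Finset.sum_congr rfl fun k _ => ?_
    field_simp

/-- The potential is the squared norm of the positive part. Passing to `(max (R k) 0 + r k) ^ 2`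
only increases it, and the cross term vanishes by `sum_pos_mul_regret`, so only the squares of the
increments remain. -/
theorem sum_sq_regret_step (R v : ι → ℝ) (D : ℝ)
    (hD : ∀ k, |v k - ∑ k', rmPoint R k' * v k'| ≤ D) :
    ∑ k, max (R k + (v k - ∑ k', rmPoint R k' * v k')) 0 ^ 2 ≤
      ∑ k, max (R k) 0 ^ 2 + Fintype.card ι * D ^ 2 := by
  set r := fun k => v k - ∑ k', rmPoint R k' * v k' with hr
  have h1 : ∀ k, max (R k + r k) 0 ^ 2 ≤ max (R k) 0 ^ 2 + 2 * (max (R k) 0 * r k) + D ^ 2 := by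
    intro k
    have h2 : r k ^ 2 ≤ D ^ 2 := sq_le_sq' (by linarith [(abs_le.1 (hD k)).1]) (abs_le.1 (hD k)).2
    have h3 : max (R k + r k) 0 ^ 2 ≤ (max (R k) 0 + r k) ^ 2 := by
      rcases le_total (R k + r k) 0 with h | h
      · rw [max_eq_right h]
        nlinarith [sq_nonneg (max (R k) 0 + r k)]
      · rw [max_eq_left h]
        exact pow_le_pow_left₀ h (by linarith [le_max_left (R k) 0]) 2
    nlinarith
  calc ∑ k, max (R k + r k) 0 ^ 2
      ≤ ∑ k, (max (R k) 0 ^ 2 + 2 * (max (R k) 0 * r k) + D ^ 2) :=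
        Finset.sum_le_sum fun k _ => h1 k
    _ = _ := by
      rw [Finset.sum_add_distrib, Finset.sum_add_distrib, ← Finset.mul_sum,
        sum_pos_mul_regret R v]
      simp

/-- The regret bound of regret matching against utilities of bounded range. -/
theorem regret_matching_bound (R v : ℕ → ι → ℝ) (D : ℝ) (hD0 : 0 ≤ D) (h0 : R 0 = 0)
    (hR : ∀ t k, R (t + 1) k = R t k + (v t k - ∑ k', rmPoint (R t) k' * v t k')) (T : ℕ)
    (hv : ∀ t < T, ∀ k k', v t k - v t k' ≤ D) (k : ι) :
    R T k ≤ D * √(Fintype.card ι * T) := by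
  have : Nonempty ι := ⟨k⟩
  have key : ∀ t ≤ T, ∑ k, max (R t k) 0 ^ 2 ≤ Fintype.card ι * D ^ 2 * t := by
    intro t ht
    induction t with
    | zero => simp [h0]
    | succ t ih =>
      -- The weights sum to one, so an instantaneous regret is an average of differences of
      -- utilities and is bounded by their range, not by their size.
      have h1 : ∀ k, v t k - ∑ k', rmPoint (R t) k' * v t k' =
          ∑ k', rmPoint (R t) k' * (v t k - v t k') := fun k => by
        simp only [mul_sub, Finset.sum_sub_distrib, ← Finset.sum_mul, sum_rmPoint, one_mul]
      have := sum_sq_regret_step (R t) (v t) D fun k => by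
        rw [h1]
        refine (Finset.abs_sum_le_sum_abs _ _).trans ?_
        calc ∑ k', |rmPoint (R t) k' * (v t k - v t k')|
            ≤ ∑ k', rmPoint (R t) k' * D := Finset.sum_le_sum fun k' _ => by
              rw [abs_mul, abs_of_nonneg (rmPoint_nonneg _ _)]
              refine mul_le_mul_of_nonneg_left (abs_le.2 ⟨?_, hv t ht k k'⟩) (rmPoint_nonneg _ _)
              linarith [hv t ht k' k]
          _ = D := by rw [← Finset.sum_mul, sum_rmPoint, one_mul]
      simp only [hR]
      have := ih (by omega)
      push_cast
      linarith
  have h2 : max (R T k) 0 ^ 2 ≤ Fintype.card ι * D ^ 2 * T :=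
    (Finset.single_le_sum (f := fun k => max (R T k) 0 ^ 2) (fun _ _ => sq_nonneg _)
      (Finset.mem_univ k)).trans (key T le_rfl)
  calc R T k ≤ max (R T k) 0 := le_max_left _ _
    _ ≤ √(Fintype.card ι * D ^ 2 * T) := Real.le_sqrt_of_sq_le h2
    _ = √(D ^ 2 * (Fintype.card ι * T)) := by congr 1; ring
    _ = D * √(Fintype.card ι * T) := by rw [Real.sqrt_mul (sq_nonneg D), Real.sqrt_sq hD0]

end RegretMatching

namespace Game

variable {n : ℕ} {Act : Type} [DecidableEq Act] {G : Game n Act} {i : Fin n}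

/-! ### Structure of the decision problem of a player with perfect recall -/

theorem hist_append_singleton (h : List Act) (a : Act) :
    G.hist i (h ++ [a]) = G.hist i h ++
      if h ∈ G.toGameTree.decisionNodes G.turn i then [((G.info i).part h, a)] else [] := by
  unfold hist
  rw [List.length_append, List.length_singleton, List.range_succ, List.filterMap_append]
  congr 1
  · apply List.filterMap_congr
    intro k hk
    rw [List.mem_range] at hk
    rw [List.take_append_of_le_length hk.le, List.getElem?_append_left hk]
  · by_cases hd : h ∈ G.toGameTree.decisionNodes G.turn i <;> simp [hd]

theorem hist_prefix {h h' : List Act} (hh : h <+: h') : G.hist i h <+: G.hist i h' := by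
  obtain ⟨t, rfl⟩ := hh
  induction t using List.reverseRecOn with
  | nil => simp
  | append_singleton t a ih =>
    rw [← List.append_assoc, hist_append_singleton]
    exact ih.trans (List.prefix_append _ _)

/-- The node `h₀` is the one at which the last recorded action is taken; labels after it belong to
other players or to chance. -/
theorem hist_eq_concat {h : List Act} {L : List (Finset (List Act) × Act)}
    {x : Finset (List Act) × Act} (H : G.hist i h = L ++ [x]) :
    ∃ h₀ ∈ G.toGameTree.decisionNodes G.turn i, h₀ ++ [x.2] <+: h ∧
      (G.info i).part h₀ = x.1 ∧ G.hist i h₀ = L := by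
  induction h using List.reverseRecOn with
  | nil => simp [hist] at H
  | append_singleton t a ih =>
    rw [hist_append_singleton] at H
    by_cases hd : t ∈ G.toGameTree.decisionNodes G.turn i
    · rw [if_pos hd] at H
      obtain ⟨H1, H2⟩ := List.append_inj' H rfl
      simp only [List.cons.injEq, and_true] at H2
      subst H2
      exact ⟨t, hd, List.prefix_rfl, rfl, H1⟩
    · rw [if_neg hd, List.append_nil] at H
      obtain ⟨h₀, h1, h2, h3⟩ := ih H
      exact ⟨h₀, h1, h2.trans (List.prefix_append _ _), h3⟩

theorem mem_hist_iff {h : List Act} {x : Finset (List Act) × Act} :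
    x ∈ G.hist i h ↔ ∃ h₀ ∈ G.toGameTree.decisionNodes G.turn i, h₀ ++ [x.2] <+: h ∧
      (G.info i).part h₀ = x.1 := by
  constructor
  · induction h using List.reverseRecOn with
    | nil => simp [hist]
    | append_singleton t a ih =>
      rw [hist_append_singleton, List.mem_append]
      rintro (H | H)
      · obtain ⟨h₀, h1, h2, h3⟩ := ih H
        exact ⟨h₀, h1, h2.trans (List.prefix_append _ _), h3⟩
      · split_ifs at H with hd
        · simp only [List.mem_singleton] at H
          subst H
          exact ⟨t, hd, List.prefix_rfl, rfl⟩
        · simp at H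
  · rintro ⟨h₀, h1, h2, h3⟩
    apply (hist_prefix h2).subset
    rw [hist_append_singleton, if_pos h1, h3]
    simp

theorem mem_nodes_of_prefix {h h' : List Act} (hh : h <+: h') (H : h' ∈ G.nodes) :
    h ∈ G.nodes := by
  obtain ⟨t, rfl⟩ := hh
  induction t using List.reverseRecOn with
  | nil => simpa using H
  | append_singleton t a ih =>
    rw [← List.append_assoc] at H
    exact ih (G.prefix_mem _ _ H)

theorem mem_decisionNodes_of_mem {j : G.InfoSet i} {h : List Act} (hh : h ∈ j.1) :
    h ∈ G.toGameTree.decisionNodes G.turn i := (G.info i).le j.2 hh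

theorem part_eq {j : G.InfoSet i} {h : List Act} (hh : h ∈ j.1) : (G.info i).part h = j.1 :=
  (G.info i).part_eq_of_mem j.2 hh

theorem mem_of_part_eq {j : G.InfoSet i} {h : List Act}
    (hd : h ∈ G.toGameTree.decisionNodes G.turn i) (hh : (G.info i).part h = j.1) : h ∈ j.1 := by
  rw [← hh]; exact (G.info i).mem_part hd

theorem infoSet_nonempty (j : G.InfoSet i) : j.1.Nonempty :=
  Finset.nonempty_iff_ne_empty.2 ((G.info i).ne_bot j.2)

/-- The common past of the nodes of an information set. -/
noncomputable def past (j : G.InfoSet i) : List (Finset (List Act) × Act) :=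
  G.hist i (infoSet_nonempty j).choose

theorem hist_eq_past (hPR : G.PerfectRecall) {j : G.InfoSet i} {h : List Act} (hh : h ∈ j.1) :
    G.hist i h = past j :=
  hPR i j.1 j.2 h hh _ (infoSet_nonempty j).choose_spec

instance (j : G.InfoSet i) : Nonempty (Action j) := by
  obtain ⟨h, hh⟩ := infoSet_nonempty j
  have := mem_decisionNodes_of_mem hh
  simp only [GameTree.decisionNodes, Finset.mem_filter] at this
  obtain ⟨a, ha⟩ := this.2.2
  exact ⟨⟨a, Finset.mem_biUnion.2 ⟨h, hh, ha⟩⟩⟩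

theorem infoLe_refl (j : G.InfoSet i) : infoLe j j := by
  obtain ⟨h, hh⟩ := infoSet_nonempty j
  exact ⟨h, hh, h, hh, List.prefix_rfl⟩

/-- Removes the tree nodes from the order: a path that strictly leaves a node of `j` records `j`
with its next label, and by perfect recall this record does not depend on the node of `j'` that is
reached. -/
theorem infoLe_iff_past (hPR : G.PerfectRecall) {j j' : G.InfoSet i} :
    infoLe j j' ↔ j = j' ∨ ∃ a : Act, (j.1, a) ∈ past j' := by
  constructor
  · rintro ⟨h, hh, h', hh', t, rfl⟩
    rcases t with _ | ⟨a, t⟩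
    · left
      rw [List.append_nil] at hh'
      exact Subtype.ext ((part_eq hh).symm.trans (part_eq hh'))
    · right
      refine ⟨a, ?_⟩
      rw [← hist_eq_past hPR hh', mem_hist_iff]
      exact ⟨h, mem_decisionNodes_of_mem hh, ⟨t, by simp⟩, part_eq hh⟩
  · rintro (rfl | ⟨a, ha⟩)
    · exact infoLe_refl j
    · obtain ⟨h', hh'⟩ := infoSet_nonempty j'
      rw [← hist_eq_past hPR hh', mem_hist_iff] at ha
      obtain ⟨h, hd, hp, hj⟩ := ha
      exact ⟨h, mem_of_part_eq hd hj, h', hh', (List.prefix_append _ _).trans hp⟩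

/-- The pair was recorded at some node of `j`, and by perfect recall the history of that node is
`past j`. -/
theorem past_prefix_of_mem (hPR : G.PerfectRecall) {j j' : G.InfoSet i} {a : Act}
    (h : (j.1, a) ∈ past j') : past j ++ [(j.1, a)] <+: past j' := by
  obtain ⟨h', hh'⟩ := infoSet_nonempty j'
  rw [← hist_eq_past hPR hh'] at h ⊢
  obtain ⟨h₀, hd, hp, hj⟩ := mem_hist_iff.1 h
  have := hist_prefix (G := G) (i := i) hp
  rwa [hist_append_singleton, if_pos hd, hj, hist_eq_past hPR (mem_of_part_eq hd hj)] at this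

/-- Makes the length of the past a rank function; antisymmetry and induction over information sets
come from it. -/
theorem length_past_lt (hPR : G.PerfectRecall) {j j' : G.InfoSet i} (h : infoLe j j')
    (hne : j ≠ j') : (past j).length < (past j').length := by
  obtain ⟨a, ha⟩ := ((infoLe_iff_past hPR).1 h).resolve_left hne
  have := (past_prefix_of_mem hPR ha).length_le
  simp at this
  omega

theorem infoLe_antisymm (hPR : G.PerfectRecall) {j j' : G.InfoSet i} (h : infoLe j j')
    (h' : infoLe j' j) : j = j' := by
  by_contra hne
  have := length_past_lt hPR h hne
  have := length_past_lt hPR h' (Ne.symm hne)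
  omega

theorem infoLe_trans (hPR : G.PerfectRecall) {j j' j'' : G.InfoSet i} (h : infoLe j j')
    (h' : infoLe j' j'') : infoLe j j'' := by
  rcases (infoLe_iff_past hPR).1 h with rfl | ⟨a, ha⟩
  · exact h'
  rcases (infoLe_iff_past hPR).1 h' with rfl | ⟨a', ha'⟩
  · exact h
  refine (infoLe_iff_past hPR).2 (Or.inr ⟨a, ?_⟩)
  exact (past_prefix_of_mem hPR ha').subset (List.mem_append_left _ ha)

theorem past_eq_concat (hPR : G.PerfectRecall) {j : G.InfoSet i}
    {L : List (Finset (List Act) × Act)} {x : Finset (List Act) × Act} (H : past j = L ++ [x]) :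
    ∃ σ : G.SeqStar i, x = (σ.1.1, σ.2.1) ∧ past σ.1 = L := by
  obtain ⟨h, hh⟩ := infoSet_nonempty j
  rw [← hist_eq_past hPR hh] at H
  obtain ⟨h₀, hd, hp, hj, hL⟩ := hist_eq_concat H
  have hpart : (G.info i).part h₀ ∈ (G.info i).parts := (G.info i).part_mem.2 hd
  have hmem : h₀ ∈ (G.info i).part h₀ := (G.info i).mem_part hd
  have hn : h₀ ++ [x.2] ∈ G.nodes := by
    refine mem_nodes_of_prefix hp ?_
    have := mem_decisionNodes_of_mem hh
    simp only [GameTree.decisionNodes, Finset.mem_filter] at this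
    exact this.1
  refine ⟨⟨⟨_, hpart⟩, ⟨x.2, Finset.mem_biUnion.2 ⟨h₀, hmem, (G.toGameTree.mem_acts _ _).2 hn⟩⟩⟩,
    ?_, ?_⟩
  · exact Prod.ext hj.symm rfl
  · rw [← hL]
    exact (hist_eq_past (j := ⟨_, hpart⟩) hPR hmem).symm

theorem seqStar_ext {σ τ : G.SeqStar i} (h : (σ.1.1, σ.2.1) = (τ.1.1, τ.2.1)) : σ = τ := by
  obtain ⟨⟨j, hj⟩, a, ha⟩ := σ
  obtain ⟨⟨j', hj'⟩, a', ha'⟩ := τ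
  simp only [Prod.mk.injEq] at h
  obtain ⟨rfl, rfl⟩ := h
  rfl

/-- Shows that the choice made in `parentSeq` is harmless: the parent is the last entry of the
common past. -/
theorem parentSeq_eq_some (hPR : G.PerfectRecall) {j : G.InfoSet i} {σ : G.SeqStar i}
    (h : parentSeq j = some σ) : past j = past σ.1 ++ [(σ.1.1, σ.2.1)] := by
  classical
  unfold parentSeq at h
  split_ifs at h with H
  obtain ⟨h₀, hh₀, hl⟩ := H.choose_spec
  rw [Option.some.inj h, hist_eq_past hPR hh₀] at hl
  obtain ⟨L, hL⟩ := List.getLast?_eq_some_iff.1 hl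
  obtain ⟨τ, hτ, hτL⟩ := past_eq_concat hPR hL
  obtain rfl := seqStar_ext hτ
  rw [hL, hτL]

theorem parentSeq_eq_none (hPR : G.PerfectRecall) {j : G.InfoSet i}
    (h : parentSeq j = none) : past j = [] := by
  classical
  unfold parentSeq at h
  split_ifs at h with H
  by_contra hne
  obtain ⟨σ, hσ, -⟩ := past_eq_concat hPR (List.dropLast_append_getLast hne).symm
  obtain ⟨h₀, hh₀⟩ := infoSet_nonempty j
  refine H ⟨σ, h₀, hh₀, ?_⟩
  rw [hist_eq_past hPR hh₀, ← hσ, List.getLast?_eq_getLast_of_ne_nil hne]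

theorem seqLe_iff_past (hPR : G.PerfectRecall) {σ τ : G.SeqStar i} :
    seqLe (some τ) (some σ) ↔ τ = σ ∨ (τ.1.1, τ.2.1) ∈ past σ.1 := by
  show (τ = σ ∨ ∃ h ∈ σ.1.1, (τ.1.1, τ.2.1) ∈ G.hist i h) ↔ _
  refine or_congr_right ⟨?_, fun h => ?_⟩
  · rintro ⟨h, hh, H⟩
    rwa [hist_eq_past hPR hh] at H
  · obtain ⟨h₀, hh₀⟩ := infoSet_nonempty σ.1
    exact ⟨h₀, hh₀, by rwa [hist_eq_past hPR hh₀]⟩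

@[simp] theorem not_seqLe_none {τ : G.SeqStar i} : ¬ seqLe (some τ) none := id

theorem seqLe_refl (τ : G.SeqStar i) : seqLe (some τ) (some τ) := Or.inl rfl

@[simp] theorem not_infoLeSeq_none {j : G.InfoSet i} : ¬ infoLeSeq j none := by
  rintro ⟨τ, h, -⟩
  cases h

@[simp] theorem infoLeSeq_some {j : G.InfoSet i} {τ : G.SeqStar i} :
    infoLeSeq j (some τ) ↔ infoLe j τ.1 := by
  constructor
  · rintro ⟨σ, h, h'⟩
    cases h
    exact h'
  · exact fun h => ⟨τ, rfl, h⟩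

theorem mem_past_iff_seqLe (hPR : G.PerfectRecall) {j : G.InfoSet i} {τ : G.SeqStar i} :
    (τ.1.1, τ.2.1) ∈ past j ↔ seqLe (some τ) (parentSeq j) := by
  rcases h : parentSeq j with _ | σ
  · simp [parentSeq_eq_none hPR h]
  · rw [parentSeq_eq_some hPR h, seqLe_iff_past hPR, List.mem_append, List.mem_singleton, or_comm]
    exact or_congr_left ⟨seqStar_ext, fun h => by rw [h]⟩

theorem seqLe_some_iff (hPR : G.PerfectRecall) {j : G.InfoSet i} {a : Action j}
    {τ : G.SeqStar i} :
    seqLe (some τ) (some ⟨j, a⟩) ↔ τ = ⟨j, a⟩ ∨ seqLe (some τ) (parentSeq j) := by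
  rw [seqLe_iff_past hPR, mem_past_iff_seqLe hPR]

/-- The recursive form of the order, one parent at a time. The later inductions use it to descend
from an information set to its parent sequence. -/
theorem infoLe_iff (hPR : G.PerfectRecall) {j j' : G.InfoSet i} :
    infoLe j j' ↔ j = j' ∨ infoLeSeq j (parentSeq j') := by
  rw [infoLe_iff_past hPR]
  rcases h : parentSeq j' with _ | σ
  · simp [parentSeq_eq_none hPR h]
  · rw [infoLeSeq_some, infoLe_iff_past hPR, parentSeq_eq_some hPR h]
    refine or_congr_right ?_
    simp only [List.mem_append, List.mem_singleton, Prod.mk.injEq]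
    constructor
    · rintro ⟨a, ha | ha⟩
      · exact Or.inr ⟨a, ha⟩
      · exact Or.inl (Subtype.ext ha.1)
    · rintro (rfl | ⟨a, ha⟩)
      · exact ⟨_, Or.inr ⟨rfl, rfl⟩⟩
      · exact ⟨a, Or.inl ha⟩

theorem infoLe_of_parentSeq (hPR : G.PerfectRecall) {j : G.InfoSet i} {σ : G.SeqStar i}
    (h : parentSeq j = some σ) : infoLe σ.1 j :=
  (infoLe_iff hPR).2 (Or.inr (by rw [h, infoLeSeq_some]; exact infoLe_refl _))

theorem ne_of_parentSeq (hPR : G.PerfectRecall) {j : G.InfoSet i} {σ : G.SeqStar i}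
    (h : parentSeq j = some σ) : σ.1 ≠ j := by
  intro e
  have := congrArg List.length (parentSeq_eq_some hPR h)
  have h' : (past σ.1).length = (past j).length := by rw [e]
  simp at this
  omega

theorem ne_of_infoLeSeq_parentSeq (hPR : G.PerfectRecall) {j j' : G.InfoSet i}
    (h : infoLeSeq j (parentSeq j')) : j ≠ j' := by
  rintro rfl
  rcases e : parentSeq j with _ | σ
  · simp [e] at h
  · rw [e, infoLeSeq_some] at h
    exact ne_of_parentSeq hPR e (infoLe_antisymm hPR (infoLe_of_parentSeq hPR e) h)

theorem infoLe_of_infoLeSeq_parentSeq (hPR : G.PerfectRecall) {j j' : G.InfoSet i}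
    (h : infoLeSeq j (parentSeq j')) : infoLe j j' := (infoLe_iff hPR).2 (Or.inr h)

/-- Strong induction along the order of information sets. -/
theorem infoSet_induction (hPR : G.PerfectRecall) {p : G.InfoSet i → Prop}
    (H : ∀ j, (∀ j', infoLe j' j → j' ≠ j → p j') → p j) (j : G.InfoSet i) : p j :=
  (measure fun j : G.InfoSet i => (past j).length).wf.induction j fun j ih =>
    H j fun _ h1 h2 => ih _ (length_past_lt hPR h1 h2)

theorem seqLe_parentSeq_infoLeSeq (hPR : G.PerfectRecall) {j : G.InfoSet i} {τ : G.SeqStar i}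
    (h : seqLe (some τ) (parentSeq j)) : infoLeSeq τ.1 (parentSeq j) := by
  rcases e : parentSeq j with _ | σ
  · simp [e] at h
  · rw [e, seqLe_iff_past hPR] at h
    rw [infoLeSeq_some]
    rcases h with rfl | h
    · exact infoLe_refl _
    · exact (infoLe_iff_past hPR).2 (Or.inr ⟨_, h⟩)

theorem infoLe_of_seqLe (hPR : G.PerfectRecall) {σ τ : G.SeqStar i}
    (h : seqLe (some τ) (some σ)) : infoLe τ.1 σ.1 := by
  rcases (seqLe_iff_past hPR).1 h with rfl | h
  · exact infoLe_refl _
  · exact (infoLe_iff_past hPR).2 (Or.inr ⟨_, h⟩)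

theorem not_seqLe_parentSeq_self (hPR : G.PerfectRecall) {j : G.InfoSet i} {a : Action j} :
    ¬ seqLe (some ⟨j, a⟩) (parentSeq j) := fun h =>
  ne_of_infoLeSeq_parentSeq hPR (seqLe_parentSeq_infoLeSeq hPR h) rfl

/-- Together with `action_unique`: exactly one action at an information set leads to a given strict
descendant. This makes `towards` a behavioral strategy. -/
theorem exists_seqLe_parentSeq (hPR : G.PerfectRecall) {j j' : G.InfoSet i} (h : infoLe j j')
    (hne : j ≠ j') : ∃ a : Action j, seqLe (some ⟨j, a⟩) (parentSeq j') := by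
  induction j' using infoSet_induction hPR with
  | H j' ih =>
    have h' := ((infoLe_iff hPR).1 h).resolve_left hne
    rcases e : parentSeq j' with _ | ⟨j₁, a₁⟩
    · simp [e] at h'
    · rw [e, infoLeSeq_some] at h'
      by_cases hj : j = j₁
      · subst hj
        exact ⟨a₁, seqLe_refl _⟩
      · obtain ⟨a, ha⟩ := ih j₁ (infoLe_of_parentSeq hPR e) (ne_of_parentSeq hPR e) h' hj
        exact ⟨a, (seqLe_some_iff hPR).2 (Or.inr ha)⟩

theorem action_unique (hPR : G.PerfectRecall) {j j' : G.InfoSet i} {a a' : Action j}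
    (h : seqLe (some ⟨j, a⟩) (parentSeq j')) (h' : seqLe (some ⟨j, a'⟩) (parentSeq j')) :
    a = a' := by
  induction j' using infoSet_induction hPR with
  | H j' ih =>
    rcases e : parentSeq j' with _ | ⟨j₁, a₁⟩
    · simp [e] at h
    · rw [e, seqLe_some_iff hPR] at h h'
      rcases h with h | h <;> rcases h' with h' | h'
      · have := h.trans h'.symm
        simpa using this
      · cases h
        exact absurd h' (not_seqLe_parentSeq_self hPR)
      · cases h'
        exact absurd h (not_seqLe_parentSeq_self hPR)
      · exact ih j₁ (infoLe_of_parentSeq hPR e) (ne_of_parentSeq hPR e) h h'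

end Game

namespace Timed

variable {α ι : Type} {β : Type}

/-! ### Bounds on costs -/

theorem cost_bind_le {x : Timed α} {f : α → Timed β} {a b : ℕ} (hx : x.cost ≤ a)
    (hf : ∀ v, (f v).cost ≤ b) : (x >>= f).cost ≤ a + b := Nat.add_le_add hx (hf _)

theorem cost_ite_le {c : Prop} [Decidable c] {x y : Timed α} {a : ℕ} (hx : x.cost ≤ a)
    (hy : y.cost ≤ a) : (if c then x else y).cost ≤ a := by
  split_ifs <;> assumption

theorem sum_map_le (l : List ι) (f : ι → ℕ) (c : ℕ) (h : ∀ k, f k ≤ c) :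
    (l.map f).sum ≤ l.length * c := by
  induction l with
  | nil => simp
  | cons k l ih =>
    rw [List.map_cons, List.sum_cons, List.length_cons, Nat.succ_mul]
    have := h k
    omega

theorem cost_sum_le (l : List ι) {f : ι → Timed ℝ} {c : ℕ} (h : ∀ k, (f k).cost ≤ c) :
    (sum l f).cost ≤ l.length * (c + 1) :=
  sum_map_le _ _ _ fun k => Nat.succ_le_succ (h k)

theorem cost_tabulate_le [Zero β] (l : List ι) {f : ι → Timed β} {c : ℕ}
    (h : ∀ k, (f k).cost ≤ c) : (tabulate l f).cost ≤ l.length * (c + 1) :=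
  sum_map_le _ _ _ fun k => Nat.succ_le_succ (h k)

theorem cost_loop_le_const (l : List ι) {s : β} {f : β → ι → Timed β} {c : ℕ}
    (h : ∀ s k, (f s k).cost ≤ c) : (loop l s f).cost ≤ l.length * (c + 1) :=
  (cost_loop_le l s f (fun _ => c) h).trans (sum_map_le _ _ _ fun _ => le_rfl)

end Timed

/-! ### Step counts of the subroutines and of one round -/

section StepCounts

open Timed

theorem cost_rmNext_le {ι : Type} (l : List ι) (R : ι → ℝ) :
    (rmNext l R).cost ≤ 8 * l.length + 3 := by
  unfold rmNext
  refine (cost_bind_le (a := l.length * 3) (b := 5 * l.length + 3)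
    (cost_tabulate_le l fun k => by simp) fun p => ?_).trans (by omega)
  refine (cost_bind_le (a := l.length * 2) (b := 3 * l.length + 3)
    (cost_sum_le l fun k => by simp) fun s => ?_).trans (by omega)
  refine (cost_bind_le (a := 1) (b := 3 * l.length + 1) (by simp) fun _ => ?_).trans (by omega)
  refine cost_ite_le ?_ ?_
  · refine (cost_bind_le (a := l.length * 1) (b := l.length + 1)
      (cost_sum_le l fun k => by simp) fun m => ?_).trans (by omega)
    refine (cost_bind_le (a := 1) (b := l.length * 1) (by simp) fun _ => ?_).trans (by omega)
    exact cost_tabulate_le l fun k => by simp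
  · exact (cost_tabulate_le l (c := 2) fun k => by simp).trans (by omega)

theorem cost_rmObserve_le {ι : Type} (l : List ι) (R b v : ι → ℝ) :
    (rmObserve l R b v).cost ≤ 9 * l.length := by
  unfold rmObserve
  refine (cost_bind_le (a := l.length * 4) (b := l.length * 5)
    (cost_sum_le l fun k => by simp) fun p => ?_).trans (by omega)
  exact cost_tabulate_le l fun k => by simp

namespace Game

variable {n : ℕ} {Act : Type} [DecidableEq Act] {G : Game n Act} {i : Fin n}

@[simp] theorem length_actionList (j : G.InfoSet i) :
    (actionList j).length = Fintype.card (Action j) := by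
  simp [actionList]

@[simp] theorem length_starList : (G.starList i).length = Fintype.card (G.SeqStar i) := by
  rw [starList, Finset.length_toList, Finset.card_univ]

@[simp] theorem length_seqList : (G.seqList i).length = Fintype.card (G.SeqStar i) + 1 := by
  rw [seqList, Finset.length_toList, Finset.card_univ, Fintype.card_option]

theorem sum_map_ord {ord : List (G.InfoSet i)} (hord : IsTopDown ord) (f : G.InfoSet i → ℕ) :
    (ord.map f).sum = ∑ j, f j := by
  rw [← List.sum_toFinset f hord.nodup]
  congr 1
  ext j
  simp [hord.complete j]

theorem sum_card_action :
    ∑ j : G.InfoSet i, Fintype.card (Action j) = Fintype.card (G.SeqStar i) := by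
  rw [Fintype.card_sigma]

/-- Overhead per information set is charged to its actions, of which there is at least one; the
actions of all information sets together are the nonempty sequences. -/
theorem sum_linear_card_le (a b : ℕ) :
    ∑ j : G.InfoSet i, (a * Fintype.card (Action j) + b) ≤
      (a + b) * Fintype.card (G.SeqStar i) := by
  rw [← sum_card_action, Finset.mul_sum]
  refine Finset.sum_le_sum fun j _ => ?_
  have : 1 ≤ Fintype.card (Action j) := Fintype.card_pos
  nlinarith

theorem cost_cfrNext_le {ord : List (G.InfoSet i)} (hord : IsTopDown ord) (j : G.InfoSet i)
    (R : G.SeqStar i → ℝ) : (cfrNext ord j R).cost ≤ 25 * (Fintype.card (G.SeqStar i) + 1) := by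
  unfold cfrNext
  refine (cost_bind_le (a := (Fintype.card (G.SeqStar i) + 1) * 1)
    (b := (12 + 9) * Fintype.card (G.SeqStar i)) ?_ fun p => ?_).trans (by omega)
  · exact (cost_tabulate_le _ (c := 0) fun k => by simp).trans_eq (by simp)
  refine (cost_loop_le _ _ _ (fun j' => 12 * Fintype.card (Action j') + 8) fun s j' => ?_).trans
    ((sum_map_ord hord _).trans_le (sum_linear_card_le 12 9))
  refine (cost_bind_le (a := 1) (b := 12 * Fintype.card (Action j') + 7) (by simp)
    fun _ => ?_).trans (by omega)
  refine cost_ite_le ?_ (by simp)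
  refine (cost_bind_le (a := 8 * Fintype.card (Action j') + 3)
    (b := 4 * Fintype.card (Action j') + 4) ?_ fun p => ?_).trans (by omega)
  · exact (cost_rmNext_le _ _).trans_eq (by simp)
  refine (cost_bind_le (a := 3) (b := 4 * Fintype.card (Action j')) ?_ fun p => ?_).trans (by omega)
  · simp only [cost_bind, cost_test, cost_ite]
    split_ifs <;> simp
  · exact (cost_loop_le_const _ (c := 3) fun s k => by simp).trans_eq (by simp [mul_comm])

theorem cost_cfrObserve_le {ord : List (G.InfoSet i)} (hord : IsTopDown ord) (j : G.InfoSet i)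
    (R : G.SeqStar i → ℝ) (g : G.Seq i → ℝ) :
    (cfrObserve ord j R g).cost ≤ 40 * (Fintype.card (G.SeqStar i) + 1) := by
  unfold cfrObserve
  set m := Fintype.card (G.SeqStar i) with hm
  refine (cost_bind_le (a := (m + 1) * 2) (b := 35 * m) ?_ fun v₀ => ?_).trans (by omega)
  · exact (cost_tabulate_le _ (c := 1) fun k => by simp).trans_eq (by simp [hm])
  refine (cost_bind_le (a := m * 2) (b := 33 * m) ?_ fun R₀ => ?_).trans (by omega)
  · exact (cost_tabulate_le _ (c := 1) fun k => by simp).trans_eq (by simp [hm])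
  refine (cost_bind_le (a := (18 + 15) * m) (b := 0) ?_ fun _ => by simp).trans (by omega)
  refine (cost_loop_le _ _ _ (fun j' => 18 * Fintype.card (Action j') + 14) fun s j' => ?_).trans
    (le_of_eq_of_le ?_ (sum_linear_card_le 18 15))
  swap
  · rw [List.map_reverse, List.sum_reverse, sum_map_ord hord]
  refine (cost_bind_le (a := 1) (b := 18 * Fintype.card (Action j') + 10) (by simp)
    fun _ => ?_).trans (by omega)
  refine cost_ite_le ?_ (by simp)
  refine (cost_bind_le (a := 8 * Fintype.card (Action j') + 3)
    (b := 10 * Fintype.card (Action j') + 7) ?_ fun b => ?_).trans (by omega)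
  · exact (cost_rmNext_le _ _).trans_eq (by simp)
  refine (cost_bind_le (a := Fintype.card (Action j') * 4)
    (b := 6 * Fintype.card (Action j') + 7) ?_ fun V => ?_).trans (by omega)
  · exact (cost_sum_le _ (c := 3) fun k => by simp).trans_eq (by simp)
  refine (cost_bind_le (a := Fintype.card (Action j') * 6) (b := 7) ?_ fun R' => ?_).trans
    (by omega)
  · exact (cost_loop_le_const _ (c := 5) fun s k => by simp).trans_eq (by simp)
  refine (cost_bind_le (a := 1) (b := 6) (by simp) fun _ => ?_).trans (by omega)
  exact cost_ite_le (by simp) (by simp)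

theorem cost_trigObserve_le {ord : List (G.InfoSet i)} (hord : IsTopDown ord) (τ : G.SeqStar i)
    (R : G.SeqStar i → ℝ) (Λ : G.Seq i → G.Seq i → ℝ) :
    (trigObserve ord τ R Λ).cost ≤ 43 * (Fintype.card (G.SeqStar i) + 1) := by
  unfold trigObserve
  refine (cost_bind_le (a := (Fintype.card (G.SeqStar i) + 1) * 3)
    (b := 40 * (Fintype.card (G.SeqStar i) + 1)) ?_
    fun g => cost_cfrObserve_le hord _ _ _).trans (by omega)
  refine (cost_tabulate_le _ (c := 2) fun k => ?_).trans_eq (by simp)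
  simp only [cost_bind, cost_test, cost_ite]
  split_ifs <;> simp

theorem cost_evalDev_le (Λ : G.Seq i → G.Seq i → ℝ) (τ : G.SeqStar i) (y : G.Seq i → ℝ) :
    (evalDev Λ τ y).cost ≤ (Fintype.card (G.SeqStar i) + 1) * 8 := by
  unfold evalDev
  refine (cost_sum_le _ (c := 7) fun k => ?_).trans_eq (by simp)
  simp only [cost_bind, cost_test, cost_ite]
  split_ifs <;> simp

theorem cost_observeUtility_le {ord : List (G.InfoSet i)} (hord : IsTopDown ord) (M : G.Mem i)
    (ℓ : G.Seq i → ℝ) :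
    (observeUtility ord M ℓ).cost ≤ 100 * (Fintype.card (G.SeqStar i) + 1) ^ 2 := by
  unfold observeUtility mixedObserve hullObserve
  set m := Fintype.card (G.SeqStar i) with hm
  refine (cost_bind_le (a := (m + 1) * ((m + 1) * 4 + 1))
    (b := m * (43 * (m + 1) + 1) + (m * ((m + 1) * 8 + 1) + 9 * m)) ?_ fun Λ => ?_).trans
    (by nlinarith)
  · refine (cost_tabulate_le _ (c := (m + 1) * 4) fun k => ?_).trans_eq (by simp [hm])
    exact (cost_tabulate_le _ (c := 3) fun k => by simp).trans_eq (by simp [hm])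
  refine cost_bind_le ?_ fun R => ?_
  · exact (cost_tabulate_le _ fun τ => cost_trigObserve_le hord _ _ _).trans_eq (by simp [hm])
  refine cost_bind_le ?_ fun v => ?_
  · exact (cost_tabulate_le _ fun τ => cost_evalDev_le _ _ _).trans_eq (by simp [hm])
  refine (cost_bind_le (b := 0) (cost_rmObserve_le _ _ _ _) fun _ => by simp).trans_eq
    (by simp [hm])

theorem cost_extend_le
    (oracle : ∀ j : G.InfoSet i, (Action j → Action j → ℝ) → Action j → ℝ)
    (fp : ℕ → ℕ) (lam : G.SeqStar i → ℝ) (cont : G.SeqStar i → G.Seq i → ℝ)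
    (x : G.Seq i → ℝ) (j : G.InfoSet i) :
    (extend oracle fp lam cont x j).cost ≤
      (10 * Fintype.card (G.SeqStar i) + 40) * Fintype.card (Action j) +
        20 * Fintype.card (Action j) ^ 2 + fp (Fintype.card (Action j)) + 10 := by
  unfold extend
  set m := Fintype.card (G.SeqStar i) with hm
  set A := Fintype.card (Action j) with hA
  refine (cost_bind_le (a := 1) (b := A * (m * 7 + 1) + (A * (m * 3 + 1 + 1) + (1 +
    (A * (A * 12 + 1) + (1 + (A * (A * 3 + 1) + (fp A + 1 + A * 3)) + A * 3)))))
    (by simp) fun σp => ?_).trans (by nlinarith)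
  refine cost_bind_le ?_ fun r => ?_
  · refine (cost_tabulate_le _ (c := m * 7) fun k => ?_).trans_eq (by simp [hA])
    refine (cost_sum_le _ (c := 6) fun k => ?_).trans_eq (by simp [hm])
    simp only [cost_bind, cost_test, cost_ite]
    split_ifs <;> simp
  refine cost_bind_le ?_ fun s => ?_
  · refine (cost_tabulate_le _ (c := m * 3 + 1) fun k => ?_).trans_eq (by simp [hA])
    refine cost_bind_le ((cost_sum_le _ (c := 2) fun k => ?_).trans_eq (by simp [hm]))
      fun _ => by simp
    simp only [cost_bind, cost_test, cost_ite]
    split_ifs <;> simp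
  refine cost_bind_le (by simp) fun p => ?_
  refine cost_bind_le ?_ fun W => ?_
  · refine (cost_tabulate_le _ (c := A * 12) fun k => ?_).trans_eq (by simp [hA])
    refine (cost_tabulate_le _ (c := 11) fun k => ?_).trans_eq (by simp [hA])
    simp only [cost_bind, cost_test, cost_ite]
    split_ifs <;> simp
  refine cost_bind_le ?_ fun w => ?_
  · refine cost_bind_le (by simp) fun _ => cost_ite_le ?_ ?_
    · refine (cost_tabulate_le _ (c := 0) fun k => by simp).trans ?_
      rw [length_actionList]
      nlinarith
    · refine cost_bind_le ?_ fun M => cost_bind_le le_rfl fun b => ?_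
      · refine (cost_tabulate_le _ (c := A * 3) fun k => ?_).trans_eq (by simp [hA])
        exact (cost_tabulate_le _ (c := 2) fun k => by simp).trans_eq (by simp [hA])
      · exact (cost_tabulate_le _ (c := 2) fun k => by simp).trans_eq (by simp [hA])
  · exact (cost_loop_le_const _ (c := 2) fun s k => by simp).trans_eq (by simp [hA])

theorem cost_sample_le {ord : List (G.InfoSet i)} (hord : IsTopDown ord)
    (u : G.InfoSet i → unitInterval) (q : G.Seq i → ℝ) :
    (sample ord u q).cost ≤ 25 * (Fintype.card (G.SeqStar i) + 1) := by
  unfold sample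
  refine (cost_bind_le (a := (Fintype.card (G.SeqStar i) + 1) * 2)
    (b := (4 + 8) * Fintype.card (G.SeqStar i)) ?_ fun p => ?_).trans (by omega)
  · refine (cost_tabulate_le _ (c := 1) fun k => ?_).trans_eq (by simp)
    simp only [cost_bind, cost_test, cost_ite]
    split_ifs <;> simp
  refine (cost_loop_le _ _ _ (fun j' => 4 * Fintype.card (Action j') + 7) fun s j => ?_).trans
    ((sum_map_ord hord _).trans_le (sum_linear_card_le 4 8))
  refine (cost_bind_le (a := 1) (b := 1 + (1 + (1 + (1 + (1 + (4 * Fintype.card (Action j) + 1))))))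
    (by simp) fun σp => ?_).trans (by omega)
  refine cost_bind_le (by simp) fun m => ?_
  refine cost_bind_le (by simp) fun _ => cost_ite_le ?_ (by simp)
  refine cost_bind_le (by simp) fun uj => ?_
  refine cost_bind_le (by simp) fun qp => ?_
  refine cost_bind_le (by simp) fun z => ?_
  refine cost_bind_le (α := ℝ × Option (Action j)) ?_ fun c => ?_
  · refine (cost_loop_le_const (actionList j) (c := 3) fun s k => ?_).trans_eq (by simp [mul_comm])
    simp only [cost_bind, cost_test, cost_ite]
    split_ifs <;> simp
  · rcases c.2 with _ | a <;> simp

theorem cost_fixedPoint_le {ord : List (G.InfoSet i)} (hord : IsTopDown ord)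
    (oracle : ∀ j : G.InfoSet i, (Action j → Action j → ℝ) → Action j → ℝ)
    (fp : ℕ → ℕ) (lam : G.SeqStar i → ℝ) (cont : G.SeqStar i → G.Seq i → ℝ) :
    (fixedPoint ord oracle fp lam cont).cost ≤ 100 * (Fintype.card (G.SeqStar i) + 1) ^ 2 +
      ∑ j : G.InfoSet i, fp (Fintype.card (Action j)) := by
  unfold fixedPoint
  set m := Fintype.card (G.SeqStar i) with hm
  -- The local matrices have `|A(j)|²` entries. No `|A(j)|` exceeds the total `m`, so all these
  -- matrices together still cost only `m²`.
  have hsq : ∑ j : G.InfoSet i, Fintype.card (Action j) ^ 2 ≤ m * m := by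
    nth_rewrite 1 [hm]
    rw [← sum_card_action, Finset.sum_mul]
    refine Finset.sum_le_sum fun j _ => ?_
    rw [sq]
    refine Nat.mul_le_mul_left _ ?_
    rw [hm, ← sum_card_action]
    exact Finset.single_le_sum (f := fun j : G.InfoSet i => Fintype.card (Action j))
      (fun _ _ => Nat.zero_le _) (Finset.mem_univ j)
  have h1 := sum_linear_card_le (G := G) (i := i) (10 * m + 40) 11
  refine (cost_bind_le (a := (m + 1) * 2) (b := (10 * m + 40 + 11) * m + (20 * (m * m) +
    ∑ j : G.InfoSet i, fp (Fintype.card (Action j)))) ?_ fun p => ?_).trans (by nlinarith)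
  · refine (cost_tabulate_le _ (c := 1) fun k => ?_).trans_eq (by simp [hm])
    simp only [cost_bind, cost_test, cost_ite]
    split_ifs <;> simp
  refine (cost_loop_le _ _ _ _ fun s j => cost_extend_le oracle fp lam cont s j).trans
    ((sum_map_ord hord _).trans_le ?_)
  rw [← hm] at h1 ⊢
  calc _ = ∑ j : G.InfoSet i, ((10 * m + 40) * Fintype.card (Action j) + 11) +
        (20 * ∑ j : G.InfoSet i, Fintype.card (Action j) ^ 2 +
          ∑ j : G.InfoSet i, fp (Fintype.card (Action j))) := by
        rw [Finset.mul_sum, ← Finset.sum_add_distrib, ← Finset.sum_add_distrib]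
        exact Finset.sum_congr rfl fun j _ => by ring
    _ ≤ _ := by gcongr

theorem cost_nextElement_le {ord : List (G.InfoSet i)} (hord : IsTopDown ord)
    (oracle : ∀ j : G.InfoSet i, (Action j → Action j → ℝ) → Action j → ℝ)
    (fp : ℕ → ℕ) (M : G.Mem i) (u : G.InfoSet i → unitInterval) :
    (nextElement ord oracle fp M u).cost ≤ 200 * (Fintype.card (G.SeqStar i) + 1) ^ 2 +
      ∑ j : G.InfoSet i, fp (Fintype.card (Action j)) := by
  unfold nextElement mixedNext hullNext
  set m := Fintype.card (G.SeqStar i) with hm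
  set F := ∑ j : G.InfoSet i, fp (Fintype.card (Action j)) with hF
  refine (cost_bind_le (a := 8 * m + 3 + (m * (25 * (m + 1) + 1) + 0) +
      (100 * (m + 1) ^ 2 + F + 0)) (b := 25 * (m + 1) + 0) ?_ fun M' => ?_).trans (by nlinarith)
  · refine cost_bind_le ?_ fun M' => ?_
    · refine cost_bind_le ((cost_rmNext_le _ _).trans_eq (by simp [hm])) fun lam => ?_
      refine cost_bind_le ?_ fun _ => by simp
      exact (cost_tabulate_le _ fun τ => cost_cfrNext_le hord _ _).trans_eq (by simp [hm])
    · exact cost_bind_le (cost_fixedPoint_le hord _ _ _ _) fun _ => by simp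
  · exact cost_bind_le (cost_sample_le hord _ _) fun _ => by simp

end Game

end StepCounts

/-! ### Loops that update the cells of an array one by one -/

/-- Every cell is visited at most once, so it still holds its initial value when it is updated. -/
theorem foldl_update_apply {ι κ β : Type} [DecidableEq κ] {e : ι → κ} (he : e.Injective)
    (f : ι → β → β) (l : List ι) (hl : l.Nodup) (x : κ → β) (a : ι) (ha : a ∈ l) :
    l.foldl (fun x a => Function.update x (e a) (f a (x (e a)))) x (e a) = f a (x (e a)) := by
  induction l using List.reverseRecOn with
  | nil => simp at ha
  | append_singleton l b ih =>
    rw [List.nodup_append] at hl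
    rw [List.foldl_append, List.foldl_cons, List.foldl_nil]
    by_cases hab : a = b
    · subst hab
      rw [Function.update_self]
      congr 1
      have hn : a ∉ l := fun h => hl.2.2 a h a (by simp) rfl
      clear ih hl ha
      induction l using List.reverseRecOn with
      | nil => rfl
      | append_singleton l b ih =>
        rw [List.foldl_append, List.foldl_cons, List.foldl_nil, Function.update_of_ne, ih]
        · exact fun h => hn (List.mem_append_left _ h)
        · exact fun h => hn (by simp [he h])
    · rw [Function.update_of_ne fun h => hab (he h)]
      exact ih hl.1 (by simpa [hab] using ha)

theorem foldl_update_of_ne {ι κ β : Type} [DecidableEq κ] {e : ι → κ}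
    (f : ι → β → β) (l : List ι) (x : κ → β) (k : κ) (hk : ∀ a, k ≠ e a) :
    l.foldl (fun x a => Function.update x (e a) (f a (x (e a)))) x k = x k := by
  induction l using List.reverseRecOn with
  | nil => rfl
  | append_singleton l b ih =>
    rw [List.foldl_append, List.foldl_cons, List.foldl_nil, Function.update_of_ne (hk b), ih]

namespace Game

variable {n : ℕ} {Act : Type} [DecidableEq Act] {G : Game n Act} {i : Fin n}

theorem actionList_nodup (j : G.InfoSet i) : (actionList j).Nodup := Finset.nodup_toList _

@[simp] theorem mem_actionList {j : G.InfoSet i} (a : Action j) : a ∈ actionList j := by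
  simp [actionList]

@[simp] theorem mem_seqList (σ : G.Seq i) : σ ∈ G.seqList i := by
  simp [seqList]

@[simp] theorem mem_starList (τ : G.SeqStar i) : τ ∈ G.starList i := by
  simp [starList]

theorem sum_map_actionList {β : Type*} [AddCommMonoid β] (j : G.InfoSet i) (f : Action j → β) :
    ((actionList j).map f).sum = ∑ a, f a := Finset.sum_map_toList _ _

theorem some_mk_injective (j : G.InfoSet i) :
    Function.Injective fun a : Action j => (some ⟨j, a⟩ : G.Seq i) := by
  intro a b h
  simpa using h

theorem mk_injective (j : G.InfoSet i) :
    Function.Injective fun a : Action j => (⟨j, a⟩ : G.SeqStar i) := by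
  intro a b h
  simpa using h

/-! ### Loops over the information sets -/

theorem foldl_infoSet_of_ne {β : Type} {F : (G.Seq i → β) → G.InfoSet i → G.Seq i → β}
    (hF : ∀ x j σ, (∀ a, σ ≠ some ⟨j, a⟩) → F x j σ = x σ) (l : List (G.InfoSet i))
    (x : G.Seq i → β) (σ : G.Seq i) (hσ : ∀ j ∈ l, ∀ a, σ ≠ some ⟨j, a⟩) :
    l.foldl F x σ = x σ := by
  induction l generalizing x with
  | nil => rfl
  | cons j l ih =>
    rw [List.foldl_cons, ih _ fun j' hj' => hσ j' (List.mem_cons_of_mem _ hj'),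
      hF _ _ _ (hσ j List.mem_cons_self)]

/-- If the round of `j` changes only the entries at `j`, then the final entries at `j` are those
computed by that round, from a state that has the final entries at the ancestors of `j`. -/
theorem foldl_topDown {β : Type} {ord : List (G.InfoSet i)} (hord : IsTopDown ord)
    {F : (G.Seq i → β) → G.InfoSet i → G.Seq i → β}
    (hF : ∀ x j σ, (∀ a, σ ≠ some ⟨j, a⟩) → F x j σ = x σ) (x₀ : G.Seq i → β)
    (j : G.InfoSet i) :
    ∃ x, x none = x₀ none ∧ (∀ a, x (some ⟨j, a⟩) = x₀ (some ⟨j, a⟩)) ∧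
      (∀ σ : G.SeqStar i, infoLe σ.1 j → σ.1 ≠ j → x (some σ) = ord.foldl F x₀ (some σ)) ∧
      ∀ a, ord.foldl F x₀ (some ⟨j, a⟩) = F x j (some ⟨j, a⟩) := by
  obtain ⟨l₁, l₂, rfl⟩ := List.append_of_mem (hord.complete j)
  have hnd := hord.nodup
  rw [List.nodup_append, List.nodup_cons] at hnd
  have hs := hord.sorted
  rw [List.pairwise_append, List.pairwise_cons] at hs
  refine ⟨l₁.foldl F x₀, ?_, fun a => ?_, fun σ h1 h2 => ?_, fun a => ?_⟩
  · exact foldl_infoSet_of_ne hF _ _ _ (by simp)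
  · refine foldl_infoSet_of_ne hF _ _ _ fun j' hj' a' h => ?_
    have e : j = j' := congrArg Sigma.fst (Option.some.inj h)
    exact hnd.2.2 j' hj' j List.mem_cons_self e.symm
  · rw [List.foldl_append]
    refine (foldl_infoSet_of_ne hF _ _ _ fun j' hj' a' h => ?_).symm
    have e : σ.1 = j' := congrArg Sigma.fst (Option.some.inj h)
    rcases List.mem_cons.1 hj' with h' | h'
    · exact h2 (e.trans h')
    · exact hs.2.1.1 j' h' (e ▸ h1)
  · rw [List.foldl_append, List.foldl_cons]
    refine foldl_infoSet_of_ne hF _ _ _ fun j' hj' a' h => ?_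
    have e : j = j' := congrArg Sigma.fst (Option.some.inj h)
    exact hnd.2.1.1 (e ▸ hj')

theorem parentSeq_congr (hPR : G.PerfectRecall) {β : Type} {x x' : G.Seq i → β} {j : G.InfoSet i}
    (h0 : x none = x' none)
    (h : ∀ σ : G.SeqStar i, infoLe σ.1 j → σ.1 ≠ j → x (some σ) = x' (some σ)) :
    x (parentSeq j) = x' (parentSeq j) := by
  rcases e : parentSeq j with _ | σ
  · exact h0
  · exact h σ (infoLe_of_parentSeq hPR e) (ne_of_parentSeq hPR e)

/-! ### From behavioral strategies to sequence form -/

/-- The sequence-form strategy for the subtree at `j` with the behavior `b`. -/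
noncomputable def seqForm (b : G.SeqStar i → ℝ) (j : G.InfoSet i) : G.Seq i → ℝ
  | none => 0
  | some σ =>
    open Classical in
    if infoLe j σ.1 then ∏ τ with seqLe (some τ) (some σ) ∧ infoLe j τ.1, b τ else 0

theorem seqForm_of_not (b : G.SeqStar i → ℝ) {j : G.InfoSet i} {σ : G.Seq i}
    (h : ¬ infoLeSeq j σ) : seqForm b j σ = 0 := by
  rcases σ with _ | σ
  · rfl
  · rw [infoLeSeq_some] at h
    exact if_neg h

/-- Splits off the last factor of the product. At `j` itself no factor is left, because a sequence
before `j` cannot end at `j` or below it. -/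
theorem seqForm_some (hPR : G.PerfectRecall) (b : G.SeqStar i → ℝ) {j j' : G.InfoSet i}
    (h : infoLe j j') (a : Action j') [Decidable (j' = j)] :
    seqForm b j (some ⟨j', a⟩) =
      b ⟨j', a⟩ * if j' = j then 1 else seqForm b j (parentSeq j') := by
  classical
  have h1 : Finset.univ.filter (fun τ : G.SeqStar i =>
      seqLe (some τ) (some ⟨j', a⟩) ∧ infoLe j τ.1) =
      insert ⟨j', a⟩ (Finset.univ.filter fun τ : G.SeqStar i =>
        seqLe (some τ) (parentSeq j') ∧ infoLe j τ.1) := by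
    ext τ
    simp only [Finset.mem_filter, Finset.mem_univ, true_and, Finset.mem_insert, seqLe_some_iff hPR]
    constructor
    · rintro ⟨h1 | h1, h2⟩
      · exact Or.inl h1
      · exact Or.inr ⟨h1, h2⟩
    · rintro (rfl | h1)
      · exact ⟨Or.inl rfl, h⟩
      · exact ⟨Or.inr h1.1, h1.2⟩
  rw [seqForm, if_pos h, h1, Finset.prod_insert]
  · congr 1
    split_ifs with hj
    · subst hj
      refine Finset.prod_eq_one fun τ hτ => ?_
      simp only [Finset.mem_filter, Finset.mem_univ, true_and] at hτ
      have h2 := seqLe_parentSeq_infoLeSeq hPR hτ.1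
      exact absurd (infoLe_antisymm hPR (infoLe_of_infoLeSeq_parentSeq hPR h2) hτ.2)
        (ne_of_infoLeSeq_parentSeq hPR h2)
    · have h2 := ((infoLe_iff hPR).1 h).resolve_left (Ne.symm hj)
      rcases e : parentSeq j' with _ | σ
      · simp [e] at h2
      · rw [e, infoLeSeq_some] at h2
        simp only [seqForm]
        rw [if_pos h2]
  · simp only [Finset.mem_filter, Finset.mem_univ, true_and, not_and]
    exact fun h2 => absurd h2 (not_seqLe_parentSeq_self hPR)

theorem seqForm_nonneg {b : G.SeqStar i → ℝ} (hb : ∀ τ, 0 ≤ b τ) (j : G.InfoSet i)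
    (σ : G.Seq i) : 0 ≤ seqForm b j σ := by
  rcases σ with _ | σ
  · exact le_rfl
  · simp only [seqForm]
    split_ifs
    · exact Finset.prod_nonneg fun τ _ => hb τ
    · exact le_rfl

theorem seqForm_mem_QSub (hPR : G.PerfectRecall) {b : G.SeqStar i → ℝ} (hb : ∀ τ, 0 ≤ b τ)
    (hb1 : ∀ j, ∑ a : Action j, b ⟨j, a⟩ = 1) (j : G.InfoSet i) : seqForm b j ∈ QSub j := by
  classical
  refine ⟨seqForm_nonneg hb j, fun σ => seqForm_of_not b, ?_, fun j' h hne => ?_⟩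
  · simp only [seqForm_some hPR b (infoLe_refl j), if_true, mul_one, hb1]
  · simp only [seqForm_some hPR b h, if_neg hne, ← Finset.sum_mul, hb1, one_mul]

/-- The behavior of counterfactual regret minimization with cumulative regrets `R`. -/
noncomputable def cfrBehavior (R : G.SeqStar i → ℝ) (τ : G.SeqStar i) : ℝ :=
  rmPoint (fun a => R ⟨τ.1, a⟩) τ.2

theorem cfrBehavior_nonneg (R : G.SeqStar i → ℝ) (τ : G.SeqStar i) : 0 ≤ cfrBehavior R τ :=
  rmPoint_nonneg _ _

theorem sum_cfrBehavior (R : G.SeqStar i → ℝ) (j : G.InfoSet i) :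
    ∑ a : Action j, cfrBehavior R ⟨j, a⟩ = 1 := sum_rmPoint fun a => R ⟨j, a⟩

theorem val_cfrNext (hPR : G.PerfectRecall) {ord : List (G.InfoSet i)} (hord : IsTopDown ord)
    (j : G.InfoSet i) (R : G.SeqStar i → ℝ) :
    (cfrNext ord j R).val = seqForm (cfrBehavior R) j := by
  classical
  obtain ⟨F, hF⟩ : ∃ F : (G.Seq i → ℝ) → G.InfoSet i → G.Seq i → ℝ, ∀ q j', F q j' =
    if infoLe j j' then
      (actionList j').foldl (fun x a => Function.update x (some ⟨j', a⟩)
        (cfrBehavior R ⟨j', a⟩ * if j' = j then 1 else q (parentSeq j'))) q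
    else q := ⟨_, fun _ _ => rfl⟩
  have hv : (cfrNext ord j R).val = ord.foldl F (fun _ => 0) := by
    simp only [cfrNext, Timed.val_bind, Timed.val_loop]
    congr 1
    · funext q j'
      have h : (rmNext (actionList j') fun a => R ⟨j', a⟩).val = rmPoint fun a => R ⟨j', a⟩ :=
        val_rmNext _
      simp only [Timed.val_bind, Timed.val_test, Timed.val_ite, decide_eq_true_eq, Timed.val_pure,
        Timed.val_unit, Timed.val_rd, Timed.val_loop, Timed.val_mul, Timed.val_wr, h, hF,
        cfrBehavior]
    · funext σ
      simp
  have hF1 : ∀ q j' σ, (∀ a, σ ≠ some ⟨j', a⟩) → F q j' σ = q σ := by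
    intro q j' σ hσ
    rw [hF]
    by_cases hj : infoLe j j'
    · rw [if_pos hj]
      exact foldl_update_of_ne (e := fun a : Action j' => (some ⟨j', a⟩ : G.Seq i))
        (fun a _ => cfrBehavior R ⟨j', a⟩ * if j' = j then 1 else q (parentSeq j')) _ _ _ hσ
    · rw [if_neg hj]
  have hF2 : ∀ q j' a, infoLe j j' → F q j' (some ⟨j', a⟩) =
      cfrBehavior R ⟨j', a⟩ * if j' = j then 1 else q (parentSeq j') := by
    intro q j' a hj
    rw [hF, if_pos hj]
    exact foldl_update_apply (some_mk_injective j')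
      (fun a _ => cfrBehavior R ⟨j', a⟩ * if j' = j then 1 else q (parentSeq j')) _
      (actionList_nodup j') _ a (mem_actionList a)
  rw [hv]
  have key := foldl_topDown hord hF1 fun _ => 0
  have h0 := foldl_infoSet_of_ne hF1 ord (fun _ => 0) none (by simp)
  -- The loop and the product formula obey the same recursion along parents, so they agree by
  -- top-down induction.
  have main : ∀ j' (a : Action j'), ord.foldl F (fun _ => 0) (some ⟨j', a⟩) =
      seqForm (cfrBehavior R) j (some ⟨j', a⟩) := by
    intro j'
    induction j' using infoSet_induction hPR with
    | H j' ih =>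
      intro a
      obtain ⟨y, hy0, hy1, hy2, hy3⟩ := key j'
      rw [hy3]
      by_cases hj : infoLe j j'
      · rw [seqForm_some hPR _ hj, hF2 _ _ _ hj]
        congr 2
        refine parentSeq_congr hPR hy0 fun σ h1 h2 => ?_
        rw [hy2 σ h1 h2]
        exact ih σ.1 h1 h2 σ.2
      · rw [hF, if_neg hj, hy1, seqForm_of_not]
        rwa [infoLeSeq_some]
  funext σ
  rcases σ with _ | ⟨j', a⟩
  · exact h0
  · exact main j' a

/-! ### Counterfactual values -/

/-- The value of choosing the last action of `σ` if the information sets have the values `V`. -/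
noncomputable def actionValue (g : G.Seq i → ℝ) (V : G.InfoSet i → ℝ) (σ : G.Seq i) : ℝ :=
  open Classical in g σ + ∑ j, if parentSeq j = σ then V j else 0

/-- The bottom-up counterpart of `infoSet_induction`: descendants count as smaller, as is needed for
values defined through children. -/
theorem wellFounded_infoSet (hPR : G.PerfectRecall) :
    WellFounded fun j j' : G.InfoSet i => infoLe j' j ∧ j' ≠ j :=
  haveI : IsTrans (G.InfoSet i) fun j j' => infoLe j' j ∧ j' ≠ j :=
    ⟨fun a b c h1 h2 => ⟨infoLe_trans hPR h2.1 h1.1, fun e => by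
      subst e; exact h1.2 (infoLe_antisymm hPR h1.1 h2.1)⟩⟩
  haveI : Std.Irrefl fun j j' : G.InfoSet i => infoLe j' j ∧ j' ≠ j := ⟨fun a h => h.2 rfl⟩
  Finite.wellFounded_of_trans_of_irrefl _

theorem exists_values (hPR : G.PerfectRecall) (b : G.SeqStar i → ℝ) (g : G.Seq i → ℝ) :
    ∃ V : G.InfoSet i → ℝ,
      ∀ j, V j = ∑ a : Action j, b ⟨j, a⟩ * actionValue g V (some ⟨j, a⟩) := by
  classical
  have wf := wellFounded_infoSet (G := G) (i := i) hPR
  refine ⟨wf.fix fun j rec => ∑ a : Action j, b ⟨j, a⟩ * (g (some ⟨j, a⟩) +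
    ∑ j', if h : parentSeq j' = some ⟨j, a⟩ then
      rec j' ⟨infoLe_of_parentSeq hPR h, ne_of_parentSeq hPR h⟩ else 0), fun j => ?_⟩
  rw [wf.fix_eq]
  simp only [actionValue, dite_eq_ite]

theorem val_cfrObserve (hPR : G.PerfectRecall) {ord : List (G.InfoSet i)} (hord : IsTopDown ord)
    (j : G.InfoSet i) (R : G.SeqStar i → ℝ) (g : G.Seq i → ℝ) (V : G.InfoSet i → ℝ)
    (hV : ∀ j, V j = ∑ a : Action j, cfrBehavior R ⟨j, a⟩ * actionValue g V (some ⟨j, a⟩))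
    (τ : G.SeqStar i) [Decidable (infoLe j τ.1)] :
    (cfrObserve ord j R g).val τ =
      if infoLe j τ.1 then R τ + (actionValue g V (some τ) - V τ.1) else R τ := by
  classical
  set F : (G.SeqStar i → ℝ) × (G.Seq i → ℝ) → G.InfoSet i → (G.SeqStar i → ℝ) × (G.Seq i → ℝ) :=
    fun s j' => if infoLe j j' then
      ((actionList j').foldl (fun R' a => Function.update R' ⟨j', a⟩ (R' ⟨j', a⟩ +
        (s.2 (some ⟨j', a⟩) - ∑ a : Action j', rmPoint (fun a => s.1 ⟨j', a⟩) a *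
          s.2 (some ⟨j', a⟩)))) s.1,
       if j' = j then s.2 else Function.update s.2 (parentSeq j') (s.2 (parentSeq j') +
        ∑ a : Action j', rmPoint (fun a => s.1 ⟨j', a⟩) a * s.2 (some ⟨j', a⟩))) else s with hF
  have hv : (cfrObserve ord j R g).val = (ord.reverse.foldl F (R, g)).1 := by
    simp only [cfrObserve, Timed.val_bind, Timed.val_loop, Timed.val_pure]
    congr 2
    · funext s j'
      have h3 : (rmNext (actionList j') fun a => s.1 ⟨j', a⟩).val =
        rmPoint fun a => s.1 ⟨j', a⟩ := val_rmNext _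
      simp only [Timed.val_bind, Timed.val_test, Timed.val_ite, decide_eq_true_eq, Timed.val_pure,
        Timed.val_unit, Timed.val_rd, Timed.val_loop, Timed.val_mul, Timed.val_add, Timed.val_sub,
        Timed.val_sum, Timed.val_wr, sum_map_actionList, h3, hF]
      split_ifs <;> rfl
    · congr 1 <;> funext k <;> simp
  rw [hv]
  -- Loop invariant after the information sets in `l`: regrets are final exactly there, and a
  -- sequence has collected the values of exactly its visited children. The root `j` of the subtree
  -- is left out of the sum because its value is not passed to its parent.
  have key : ∀ l, l <+: ord.reverse →
      (∀ τ : G.SeqStar i, (l.foldl F (R, g)).1 τ = if τ.1 ∈ l ∧ infoLe j τ.1 then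
        R τ + (actionValue g V (some τ) - V τ.1) else R τ) ∧
      ∀ σ, (l.foldl F (R, g)).2 σ = g σ +
        ∑ j', if parentSeq j' = σ ∧ j' ∈ l ∧ infoLe j j' ∧ j' ≠ j then V j' else 0 := by
    intro l
    induction l using List.reverseRecOn with
    | nil => simp
    | append_singleton l j' ih =>
      rintro ⟨l₂, hl₂⟩
      obtain ⟨ih1, ih2⟩ := ih ⟨[j'] ++ l₂, by rw [← hl₂, List.append_assoc]⟩
      have e : ord = l₂.reverse ++ j' :: l.reverse := by
        rw [← List.reverse_reverse ord, ← hl₂]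
        simp
      have hnd := hord.nodup
      rw [e, List.nodup_append, List.nodup_cons] at hnd
      have hj' : j' ∉ l := fun h => hnd.2.1.1 (List.mem_reverse.2 h)
      have hs := hord.sorted
      rw [e, List.pairwise_append, List.pairwise_cons] at hs
      -- In the reversed order all strict descendants of `j'` come first, so the entries at `j'`
      -- already hold the full action values.
      have hmem : ∀ j'', infoLe j' j'' → j'' ≠ j' → j'' ∈ l := by
        intro j'' h1 h2
        have h3 := hord.complete j''
        rw [e, List.mem_append, List.mem_cons, List.mem_reverse, List.mem_reverse] at h3
        rcases h3 with h3 | h3 | h3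
        · exact absurd h1 (hs.2.2 j'' (List.mem_reverse.2 h3) j' List.mem_cons_self)
        · exact absurd h3 h2
        · exact h3
      rw [List.foldl_append, List.foldl_cons, List.foldl_nil]
      set s := l.foldl F (R, g) with hs_def
      by_cases hjj : infoLe j j'
      · have hR : ∀ a, s.1 ⟨j', a⟩ = R ⟨j', a⟩ := fun a => by
          rw [ih1]
          simp [hj']
        have hval : ∀ a, s.2 (some ⟨j', a⟩) = actionValue g V (some ⟨j', a⟩) := fun a => by
          rw [ih2, actionValue]
          congr 1
          refine Finset.sum_congr rfl fun j'' _ => ?_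
          by_cases hp : parentSeq j'' = some ⟨j', a⟩
          · have h1 := infoLe_of_parentSeq hPR hp
            have h2 : j' ≠ j'' := ne_of_parentSeq hPR hp
            have h3 : j'' ≠ j := fun h => h2 (infoLe_antisymm hPR h1 (h ▸ hjj))
            simp [hp, hmem j'' h1 h2.symm, infoLe_trans hPR hjj h1, h3]
          · simp [hp]
        have hVs : ∑ a : Action j', rmPoint (fun a => s.1 ⟨j', a⟩) a * s.2 (some ⟨j', a⟩) =
            V j' := by
          rw [hV]
          refine Finset.sum_congr rfl fun a _ => ?_
          rw [hval, cfrBehavior]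
          simp only [hR]
        simp only [hF, if_pos hjj, hVs]
        refine ⟨fun τ => ?_, fun σ => ?_⟩
        · by_cases hτ : τ.1 = j'
          · obtain ⟨j₁, a⟩ := τ
            subst hτ
            rw [foldl_update_apply (mk_injective j₁)
              (fun a r => r + (s.2 (some ⟨j₁, a⟩) - V j₁)) _ (actionList_nodup j₁) _ a
              (mem_actionList a), hR, hval]
            simp [hjj]
          · rw [foldl_update_of_ne (fun a r => r + (s.2 (some ⟨j', a⟩) - V j')), ih1]
            · simp [hτ]
            · rintro a rfl
              exact hτ rfl
        · by_cases hj : j' = j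
          · rw [if_pos hj, ih2]
            congr 1
            refine Finset.sum_congr rfl fun j'' _ => ?_
            congr 1
            simp only [List.mem_append, List.mem_singleton]
            refine propext (and_congr_right fun _ => ⟨fun h => ⟨Or.inl h.1, h.2⟩, fun h => ?_⟩)
            exact ⟨h.1.resolve_right fun e => h.2.2 (e.trans hj), h.2⟩
          · have h1 : ∑ j'', (if parentSeq j'' = σ ∧ j'' ∈ l ++ [j'] ∧ infoLe j j'' ∧ j'' ≠ j then
                V j'' else 0) =
                ∑ j'', (if parentSeq j'' = σ ∧ j'' ∈ l ∧ infoLe j j'' ∧ j'' ≠ j then V j'' else 0) +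
                ∑ j'', if j' = j'' then (if parentSeq j' = σ then V j' else 0) else 0 := by
              rw [← Finset.sum_add_distrib]
              refine Finset.sum_congr rfl fun j'' _ => ?_
              by_cases h : j' = j''
              · subst h
                simp [hj', hjj, hj]
              · simp [h, Ne.symm h]
            rw [h1, Finset.sum_ite_eq, if_pos (Finset.mem_univ _), if_neg hj, ← add_assoc, ← ih2]
            by_cases hp : σ = parentSeq j'
            · subst hp
              simp
            · rw [Function.update_of_ne hp, if_neg (Ne.symm hp), add_zero]
      · simp only [hF, if_neg hjj]
        refine ⟨fun τ => ?_, fun σ => ?_⟩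
        · rw [ih1]
          congr 1
          simp only [List.mem_append, List.mem_singleton]
          refine propext ⟨fun h => ⟨Or.inl h.1, h.2⟩, fun h => ⟨h.1.resolve_right fun e => ?_, h.2⟩⟩
          exact hjj (e ▸ h.2)
        · rw [ih2]
          congr 1
          refine Finset.sum_congr rfl fun j'' _ => ?_
          congr 1
          simp only [List.mem_append, List.mem_singleton]
          refine propext (and_congr_right fun _ => ⟨fun h => ⟨Or.inl h.1, h.2⟩, fun h => ?_⟩)
          exact ⟨h.1.resolve_right fun e => hjj (e ▸ h.2.1), h.2⟩
  rw [(key _ List.prefix_rfl).1 τ]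
  simp [hord.complete]

end Game

namespace Game

variable {n : ℕ} {Act : Type} [DecidableEq Act] {G : Game n Act} {i : Fin n}

/-! ### Deviations -/

-- The two nonzero cases of the matrix concern different columns, since the trigger does not survive
-- its own deletion. The map is therefore a coordinate projection plus a single column.
open Classical in
theorem devMatrix_mulVecLin_apply (τ : G.SeqStar i) (y x : G.Seq i → ℝ)
    (r : G.Seq i) :
    (devMatrix τ y).mulVecLin x r = (if seqLe (some τ) r then 0 else x r) +
      if infoLeSeq τ.1 r then y r * x (some τ) else 0 := by
  rw [Matrix.mulVecLin_apply, Matrix.mulVec, dotProduct]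
  have h : ∀ c, devMatrix τ y r c * x c =
      (if r = c then if seqLe (some τ) c then 0 else x c else 0) +
      if some τ = c then if infoLeSeq τ.1 r then y r * x c else 0 else 0 := by
    intro c
    simp only [devMatrix, Matrix.of_apply]
    by_cases hc : some τ = c
    · subst hc
      by_cases hr : r = some τ <;> by_cases hi : infoLeSeq τ.1 r <;>
        simp [seqLe_refl, hi, hr]
    · by_cases hs : seqLe (some τ) c <;> by_cases hr : r = c <;> simp [hs, hr, hc, Ne.symm hc]
  simp only [h, Finset.sum_add_distrib, Finset.sum_ite_eq, Finset.mem_univ, if_true]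

theorem not_infoLeSeq_of_parentSeq (hPR : G.PerfectRecall) {j j' : G.InfoSet i}
    (h : ¬ infoLe j j') : ¬ infoLeSeq j (parentSeq j') := fun h' =>
  h (infoLe_of_infoLeSeq_parentSeq hPR h')

/-- Deviations map sequence-form strategies to sequence-form strategies. -/
theorem dev_mem_Q (hPR : G.PerfectRecall) {τ : G.SeqStar i} {y x : G.Seq i → ℝ}
    (hy : y ∈ QSub τ.1) (hx : x ∈ G.Q i) : (devMatrix τ y).mulVecLin x ∈ G.Q i := by
  classical
  obtain ⟨hy0, hy1, hy2, hy3⟩ := hy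
  obtain ⟨hx0, hx1, hx2⟩ := hx
  refine ⟨fun r => ?_, ?_, fun j => ?_⟩
  · rw [devMatrix_mulVecLin_apply]
    refine add_nonneg ?_ ?_
    · split_ifs
      · exact le_rfl
      · exact hx0 r
    · split_ifs
      · exact mul_nonneg (hy0 _) (hx0 _)
      · exact le_rfl
  · rw [devMatrix_mulVecLin_apply]
    simp [hx1]
  · simp only [devMatrix_mulVecLin_apply, Finset.sum_add_distrib, infoLeSeq_some]
    -- At the trigger's own information set, the mass removed at the trigger comes back through the
    -- continuation, whose total mass is one. Strictly below, the surviving part and the inserted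
    -- part conserve flow separately. Elsewhere nothing changes.
    by_cases hj : infoLe τ.1 j
    · simp only [if_pos hj, ← Finset.sum_mul]
      by_cases he : τ.1 = j
      · obtain ⟨j', a'⟩ := τ
        subst he
        have h1 : ¬ seqLe (some ⟨j', a'⟩) (parentSeq j') := not_seqLe_parentSeq_self hPR
        have h2 : ¬ infoLeSeq j' (parentSeq j') := fun h => ne_of_infoLeSeq_parentSeq hPR h rfl
        simp only [seqLe_some_iff hPR, h1, h2, or_false, if_false]
        have h3 : ∀ a, (if (⟨j', a'⟩ : G.SeqStar i) = ⟨j', a⟩ then 0 else x (some ⟨j', a⟩)) =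
            x (some ⟨j', a⟩) - if a' = a then x (some ⟨j', a⟩) else 0 := fun a => by
          by_cases h : a' = a
          · subst h
            simp
          · rw [if_neg h, if_neg fun e => h (mk_injective j' e), sub_zero]
        simp only [h3]
        rw [Finset.sum_sub_distrib, Finset.sum_ite_eq, if_pos (Finset.mem_univ a'), hy2, hx2]
        ring
      · have h1 : ∀ a, seqLe (some τ) (some ⟨j, a⟩) ↔ seqLe (some τ) (parentSeq j) := by
          intro a
          rw [seqLe_some_iff hPR, or_iff_right]
          rintro rfl
          exact he rfl
        simp only [h1]
        rw [if_pos (((infoLe_iff hPR).1 hj).resolve_left he), hy3 j hj (Ne.symm he)]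
        congr 1
        split_ifs
        · simp
        · exact hx2 j
    · have h1 : ¬ seqLe (some τ) (parentSeq j) := fun h =>
        not_infoLeSeq_of_parentSeq hPR hj (seqLe_parentSeq_infoLeSeq hPR h)
      have h2 : ∀ a, ¬ seqLe (some τ) (some ⟨j, a⟩) := fun a h => hj (infoLe_of_seqLe hPR h)
      rw [if_neg h1, if_neg (not_infoLeSeq_of_parentSeq hPR hj)]
      simp only [h2, hj, if_false, Finset.sum_const_zero]
      rw [hx2]

/-! ### Fixed points -/

/-- The part of the matrix of `extend` that comes from triggers above `j`. -/
noncomputable def inflow (lam : G.SeqStar i → ℝ) (cont : G.SeqStar i → G.Seq i → ℝ)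
    (x : G.Seq i → ℝ) (j : G.InfoSet i) (a : Action j) : ℝ :=
  open Classical in
  ∑ τ, if infoLeSeq τ.1 (parentSeq j) then lam τ * cont τ (some ⟨j, a⟩) * x (some τ) else 0

/-- The total weight of the triggers that precede `σ`. -/
noncomputable def trigMass (lam : G.SeqStar i → ℝ) (σ : G.Seq i) : ℝ :=
  open Classical in ∑ τ, if seqLe (some τ) σ then lam τ else 0

/-- The matrix of `extend`. -/
noncomputable def extMatrix (lam : G.SeqStar i → ℝ) (cont : G.SeqStar i → G.Seq i → ℝ)
    (x : G.Seq i → ℝ) (j : G.InfoSet i) (ar ac : Action j) : ℝ :=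
  inflow lam cont x j ar + (lam ⟨j, ac⟩ * cont ⟨j, ac⟩ (some ⟨j, ar⟩) +
    if ar = ac then 1 - trigMass lam (some ⟨j, ac⟩) else 0) * x (parentSeq j)

/-- The values that `extend` assigns at `j`. -/
noncomputable def extValue
    (oracle : ∀ j : G.InfoSet i, (Action j → Action j → ℝ) → Action j → ℝ)
    (lam : G.SeqStar i → ℝ) (cont : G.SeqStar i → G.Seq i → ℝ)
    (x : G.Seq i → ℝ) (j : G.InfoSet i) (a : Action j) : ℝ :=
  open Classical in
  if x (parentSeq j) = 0 then 0 else
    x (parentSeq j) *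
      oracle j (fun ar ac => extMatrix lam cont x j ar ac / x (parentSeq j)) a

theorem sum_map_starList (f : G.SeqStar i → ℝ) :
    ((G.starList i).map f).sum = ∑ τ, f τ := Finset.sum_map_toList _ _

theorem val_extend (oracle : ∀ j : G.InfoSet i, (Action j → Action j → ℝ) → Action j → ℝ)
    (fp : ℕ → ℕ) (lam : G.SeqStar i → ℝ) (cont : G.SeqStar i → G.Seq i → ℝ)
    (x : G.Seq i → ℝ) (j : G.InfoSet i) :
    (extend oracle fp lam cont x j).val = (actionList j).foldl
      (fun x' a => Function.update x' (some ⟨j, a⟩) (extValue oracle lam cont x j a)) x := by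
  classical
  simp only [extend, Timed.val_bind, Timed.val_loop, Timed.val_unit, Timed.val_rd, Timed.val_test,
    Timed.val_wr]
  congr 1
  funext x' a
  congr 1
  simp only [Timed.val_ite, decide_eq_true_eq]
  rw [extValue]
  by_cases h : x (parentSeq j) = 0
  · rw [if_pos h, if_pos h]
    simp
  rw [if_neg h, if_neg h]
  simp only [Timed.val_bind, Timed.val_tabulate, mem_actionList, if_true, Timed.val_mul,
    Timed.val_rd, callOracle]
  congr 2
  funext ar ac
  simp only [Timed.val_bind, Timed.val_tabulate, mem_actionList, if_true, Timed.val_mul,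
    Timed.val_rd, Timed.val_rd₂, Timed.val_div, Timed.val_sum, Timed.val_ite, Timed.val_test,
    decide_eq_true_eq, Timed.val_add, Timed.val_sub, Timed.val_pure, sum_map_starList,
    extMatrix, inflow, trigMass]

/-- The round of `j` reads only its parent and the sequences at ancestors, which are final by then.
Hence the finished vector satisfies the equations of all rounds simultaneously. -/
theorem fixedPoint_spec (hPR : G.PerfectRecall) {ord : List (G.InfoSet i)} (hord : IsTopDown ord)
    (oracle : ∀ j : G.InfoSet i, (Action j → Action j → ℝ) → Action j → ℝ)
    (fp : ℕ → ℕ) (lam : G.SeqStar i → ℝ) (cont : G.SeqStar i → G.Seq i → ℝ) :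
    (fixedPoint ord oracle fp lam cont).val none = 1 ∧ ∀ j (a : Action j),
      (fixedPoint ord oracle fp lam cont).val (some ⟨j, a⟩) =
        extValue oracle lam cont (fixedPoint ord oracle fp lam cont).val j a := by
  classical
  set F : (G.Seq i → ℝ) → G.InfoSet i → G.Seq i → ℝ :=
    fun x j => (extend oracle fp lam cont x j).val with hF
  set x₀ : G.Seq i → ℝ := fun σ => if σ = none then 1 else 0 with hx₀
  have hv : (fixedPoint ord oracle fp lam cont).val = ord.foldl F x₀ := by
    simp only [fixedPoint, Timed.val_bind, Timed.val_loop]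
    congr 1
    funext σ
    simp [hx₀]
  have hF1 : ∀ x j σ, (∀ a, σ ≠ some ⟨j, a⟩) → F x j σ = x σ := by
    intro x j σ hσ
    simp only [hF, val_extend]
    exact foldl_update_of_ne (e := fun a : Action j => (some ⟨j, a⟩ : G.Seq i))
      (fun a _ => extValue oracle lam cont x j a) _ _ _ hσ
  have hF2 : ∀ x j a, F x j (some ⟨j, a⟩) = extValue oracle lam cont x j a := by
    intro x j a
    simp only [hF, val_extend]
    exact foldl_update_apply (some_mk_injective j) (fun a _ => extValue oracle lam cont x j a) _
      (actionList_nodup j) _ a (mem_actionList a)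
  rw [hv]
  have h0 : ord.foldl F x₀ none = 1 := foldl_infoSet_of_ne hF1 ord x₀ none (by simp)
  refine ⟨h0, fun j a => ?_⟩
  obtain ⟨y, hy0, -, hy2, hy3⟩ := foldl_topDown hord hF1 x₀ j
  rw [hy3, hF2]
  have hp : y (parentSeq j) = ord.foldl F x₀ (parentSeq j) :=
    parentSeq_congr hPR (hy0.trans h0.symm) hy2
  have hin : inflow lam cont y j = inflow lam cont (ord.foldl F x₀) j := by
    funext a
    refine Finset.sum_congr rfl fun τ _ => ?_
    split_ifs with hτ
    · rw [hy2 τ (infoLe_of_infoLeSeq_parentSeq hPR hτ) (ne_of_infoLeSeq_parentSeq hPR hτ)]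
    · rfl
  simp only [extValue, extMatrix, hp, hin]

theorem sum_infoLe_split (hPR : G.PerfectRecall) (f : G.SeqStar i → ℝ) (j : G.InfoSet i)
    [DecidablePred fun τ : G.SeqStar i => infoLe τ.1 j]
    [DecidablePred fun τ : G.SeqStar i => infoLeSeq τ.1 (parentSeq j)] :
    ∑ τ, (if infoLe τ.1 j then f τ else 0) =
      ∑ τ, (if infoLeSeq τ.1 (parentSeq j) then f τ else 0) + ∑ a : Action j, f ⟨j, a⟩ := by
  classical
  have h1 : ∑ a : Action j, f ⟨j, a⟩ = ∑ τ : G.SeqStar i, if τ.1 = j then f τ else 0 := by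
    rw [Fintype.sum_sigma, Finset.sum_eq_single j]
    · simp
    · intro j' _ hj'
      simp [hj']
    · simp
  rw [h1, ← Finset.sum_add_distrib]
  refine Finset.sum_congr rfl fun τ _ => ?_
  by_cases h2 : infoLeSeq τ.1 (parentSeq j)
  · simp [h2, infoLe_of_infoLeSeq_parentSeq hPR h2, ne_of_infoLeSeq_parentSeq hPR h2]
  · by_cases h3 : τ.1 = j
    · simp [h3, h3 ▸ h2, infoLe_refl]
    · have : ¬ infoLe τ.1 j := fun h => ((infoLe_iff hPR).1 h).elim h3 h2
      simp [h2, h3, this]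

theorem trigMass_some (hPR : G.PerfectRecall) (lam : G.SeqStar i → ℝ) (j : G.InfoSet i)
    (a : Action j) :
    trigMass lam (some ⟨j, a⟩) = trigMass lam (parentSeq j) + lam ⟨j, a⟩ := by
  classical
  have h1 : lam ⟨j, a⟩ = ∑ τ : G.SeqStar i, if ⟨j, a⟩ = τ then lam τ else 0 := by simp
  rw [trigMass, trigMass, h1, ← Finset.sum_add_distrib]
  refine Finset.sum_congr rfl fun τ _ => ?_
  simp only [seqLe_some_iff hPR]
  by_cases h : τ = ⟨j, a⟩
  · subst h
    simp [not_seqLe_parentSeq_self hPR]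
  · simp [h, Ne.symm h]

/-- In a fixed point, what the triggers move away from `σ` equals what they move to `σ`. -/
def Balanced (lam : G.SeqStar i → ℝ) (cont : G.SeqStar i → G.Seq i → ℝ) (x : G.Seq i → ℝ)
    (σ : G.Seq i) : Prop :=
  open Classical in
  x σ * trigMass lam σ = ∑ τ, if infoLeSeq τ.1 σ then lam τ * cont τ σ * x (some τ) else 0

/-- Balance is carried from the parent to the children. Balance at the parent says that the inflow
into `j` totals the mass which triggers remove from the parent; this completes each column of the
local matrix to the parent's mass. The fixed-point equation of the oracle is then balance at the new
sequences. -/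
theorem fixedPoint_balanced (hPR : G.PerfectRecall) {ord : List (G.InfoSet i)}
    (hord : IsTopDown ord)
    {oracle : ∀ j : G.InfoSet i, (Action j → Action j → ℝ) → Action j → ℝ}
    (horacle : ∀ j, IsFixedPointOracle (oracle j)) (fp : ℕ → ℕ) {lam : G.SeqStar i → ℝ}
    (hlam : ∀ τ, 0 ≤ lam τ) (hlam1 : ∑ τ, lam τ ≤ 1) {cont : G.SeqStar i → G.Seq i → ℝ}
    (hcont : ∀ τ, cont τ ∈ QSub τ.1) :
    (fixedPoint ord oracle fp lam cont).val ∈ G.Q i ∧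
      ∀ σ, Balanced lam cont (fixedPoint ord oracle fp lam cont).val σ := by
  classical
  obtain ⟨hx1, hx2⟩ := fixedPoint_spec hPR hord oracle fp lam cont
  set x := (fixedPoint ord oracle fp lam cont).val with hx
  have hnone : Balanced lam cont x none := by simp [Balanced, trigMass]
  have main : ∀ j, (∀ a, 0 ≤ x (some ⟨j, a⟩)) ∧ x (parentSeq j) = ∑ a, x (some ⟨j, a⟩) ∧
      ∀ a, Balanced lam cont x (some ⟨j, a⟩) := by
    intro j
    induction j using infoSet_induction hPR with
    | H j ih =>
      obtain ⟨hp0, hpB⟩ : 0 ≤ x (parentSeq j) ∧ Balanced lam cont x (parentSeq j) := by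
        rcases e : parentSeq j with _ | ⟨j', a'⟩
        · exact ⟨hx1 ▸ zero_le_one, hnone⟩
        · have := ih j' (infoLe_of_parentSeq hPR e) (ne_of_parentSeq hPR e)
          exact ⟨this.1 a', this.2.2 a'⟩
      have hin0 : ∀ a, 0 ≤ inflow lam cont x j a := fun a => by
        refine Finset.sum_nonneg fun τ _ => ?_
        split_ifs with hτ
        · exact mul_nonneg (mul_nonneg (hlam τ) ((hcont τ).1 _))
            ((ih τ.1 (infoLe_of_infoLeSeq_parentSeq hPR hτ)
              (ne_of_infoLeSeq_parentSeq hPR hτ)).1 τ.2)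
        · exact le_rfl
      have hinsum : ∑ a, inflow lam cont x j a = x (parentSeq j) * trigMass lam (parentSeq j) := by
        rw [Balanced] at hpB
        rw [hpB]
        simp only [inflow]
        rw [Finset.sum_comm]
        refine Finset.sum_congr rfl fun τ _ => ?_
        split_ifs with hτ
        · rw [← Finset.sum_mul, ← Finset.mul_sum,
            (hcont τ).2.2.2 j (infoLe_of_infoLeSeq_parentSeq hPR hτ)
              (ne_of_infoLeSeq_parentSeq hPR hτ).symm]
        · simp
      have hbal : ∀ a, Balanced lam cont x (some ⟨j, a⟩) ↔
          x (some ⟨j, a⟩) * trigMass lam (some ⟨j, a⟩) = inflow lam cont x j a +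
            ∑ ac, lam ⟨j, ac⟩ * cont ⟨j, ac⟩ (some ⟨j, a⟩) * x (some ⟨j, ac⟩) := by
        intro a
        simp only [Balanced, infoLeSeq_some]
        rw [sum_infoLe_split hPR (fun τ => lam τ * cont τ (some ⟨j, a⟩) * x (some τ)), inflow]
      -- If the parent has no mass, the inflows are nonnegative with sum zero, so they vanish and
      -- the zero extension is balanced.
      by_cases hp : x (parentSeq j) = 0
      · have hz : ∀ a, x (some ⟨j, a⟩) = 0 := fun a => by rw [hx2, extValue, if_pos hp]
        have hinz : ∀ a, inflow lam cont x j a = 0 := by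
          rw [hp, zero_mul] at hinsum
          exact fun a => (Finset.sum_eq_zero_iff_of_nonneg fun a _ => hin0 a).1 hinsum a
            (Finset.mem_univ a)
        refine ⟨fun a => (hz a).ge, by simp [hp, hz], fun a => ?_⟩
        rw [hbal, hinz]
        simp [hz]
      · have hp' : 0 < x (parentSeq j) := lt_of_le_of_ne hp0 (Ne.symm hp)
        set b := oracle j (fun ar ac => extMatrix lam cont x j ar ac / x (parentSeq j)) with hb
        have hmass : ∀ σ, trigMass lam σ ≤ 1 := fun σ => by
          refine le_trans (Finset.sum_le_sum fun τ _ => ?_) hlam1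
          split_ifs
          · exact le_rfl
          · exact hlam τ
        obtain ⟨⟨hb0, hb1⟩, hb2⟩ := horacle j
          (fun ar ac => extMatrix lam cont x j ar ac / x (parentSeq j))
          (fun ar ac => by
            refine div_nonneg (add_nonneg (hin0 ar) (mul_nonneg (add_nonneg ?_ ?_) hp0)) hp0
            · exact mul_nonneg (hlam _) ((hcont _).1 _)
            · split_ifs
              · linarith [hmass (some ⟨j, ac⟩)]
              · exact le_rfl)
          -- Column sum: the inflow contributes `trigMass` of the parent, the column's own trigger
          -- contributes its weight, and the diagonal contributes one minus the sum of the two.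
          (fun ac => by
            rw [← Finset.sum_div, div_eq_one_iff_eq hp]
            simp only [extMatrix]
            rw [Finset.sum_add_distrib, hinsum, ← Finset.sum_mul, Finset.sum_add_distrib,
              ← Finset.mul_sum, (hcont ⟨j, ac⟩).2.2.1, Finset.sum_ite_eq',
              if_pos (Finset.mem_univ ac), trigMass_some hPR]
            ring)
        have hxb : ∀ a, x (some ⟨j, a⟩) = x (parentSeq j) * b a := fun a => by
          rw [hx2, extValue, if_neg hp]
        refine ⟨fun a => ?_, ?_, fun a => ?_⟩
        · rw [hxb]
          exact mul_nonneg hp0 (hb0 a)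
        · simp only [hxb]
          rw [← Finset.mul_sum, hb1, mul_one]
        · rw [hbal]
          have h1 := hb2 a
          rw [← hb] at h1 hb1
          have h2 : ∑ ac, extMatrix lam cont x j a ac * b ac = x (parentSeq j) * b a := by
            rw [← h1, Finset.mul_sum]
            refine Finset.sum_congr rfl fun ac _ => ?_
            field_simp
          have h3 : ∑ ac, extMatrix lam cont x j a ac * b ac = inflow lam cont x j a +
              ∑ ac, lam ⟨j, ac⟩ * cont ⟨j, ac⟩ (some ⟨j, a⟩) * x (some ⟨j, ac⟩) +
              (1 - trigMass lam (some ⟨j, a⟩)) * x (some ⟨j, a⟩) := by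
            have h4 : ∀ ac, extMatrix lam cont x j a ac * b ac = inflow lam cont x j a * b ac +
                lam ⟨j, ac⟩ * cont ⟨j, ac⟩ (some ⟨j, a⟩) * x (some ⟨j, ac⟩) +
                if a = ac then (1 - trigMass lam (some ⟨j, ac⟩)) * x (some ⟨j, ac⟩) else 0 := by
              intro ac
              rw [hxb, extMatrix]
              split_ifs <;> ring
            simp only [h4]
            rw [Finset.sum_add_distrib, Finset.sum_add_distrib, ← Finset.mul_sum, hb1, mul_one,
              Finset.sum_ite_eq, if_pos (Finset.mem_univ a)]
          have h5 := hxb a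
          linarith
  refine ⟨⟨fun σ => ?_, hx1, fun j => (main j).2.1⟩, fun σ => ?_⟩
  · rcases σ with _ | ⟨j, a⟩
    · exact hx1 ▸ zero_le_one
    · exact (main j).1 a
  · rcases σ with _ | ⟨j, a⟩
    · exact hnone
    · exact (main j).2.2 a

/-- With weights of total one, being a fixed point at `σ` means that the mass removed there equals
the mass inserted there. -/
theorem sum_dev_eq_of_balanced {lam : G.SeqStar i → ℝ}
    (hlam1 : ∑ τ, lam τ = 1) {cont : G.SeqStar i → G.Seq i → ℝ} {x : G.Seq i → ℝ}
    {σ : G.Seq i} (h : Balanced lam cont x σ) :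
    ∑ τ, lam τ * (devMatrix τ (cont τ)).mulVecLin x σ = x σ := by
  classical
  have h1 : ∀ τ : G.SeqStar i, lam τ * (devMatrix τ (cont τ)).mulVecLin x σ =
      lam τ * x σ - x σ * (if seqLe (some τ) σ then lam τ else 0) +
      if infoLeSeq τ.1 σ then lam τ * cont τ σ * x (some τ) else 0 := by
    intro τ
    rw [devMatrix_mulVecLin_apply]
    split_ifs <;> ring
  rw [Balanced] at h
  simp only [h1, Finset.sum_add_distrib, Finset.sum_sub_distrib, ← Finset.mul_sum,
    ← Finset.sum_mul, hlam1]
  rw [← h, trigMass]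
  ring

/-! ### Sampling -/

/-- One round of the selection of an action by the partial sums of `f`. -/
noncomputable def pickStep {A : Type} (f : A → ℝ) (z : ℝ) (c : ℝ × Option A) (a : A) :
    ℝ × Option A :=
  open Classical in if z < c.1 then c else (c.1 + f a, some a)

/-- The action drawn at `j` with the number `z`. -/
noncomputable def pick (j : G.InfoSet i) (q : G.Seq i → ℝ) (z : ℝ) : Option (Action j) :=
  ((actionList j).foldl (pickStep (fun a => q (some ⟨j, a⟩)) z) (0, none)).2

theorem isSome_foldl_pickStep {A : Type} (f : A → ℝ) (z : ℝ) (l : List A) (c : ℝ × Option A)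
    (h : c.2.isSome) : (l.foldl (pickStep f z) c).2.isSome := by
  induction l generalizing c with
  | nil => exact h
  | cons a l ih =>
    refine ih _ ?_
    unfold pickStep
    split_ifs
    · exact h
    · rfl

/-- The partial sums start at zero, so for nonnegative `z` the first action is always accepted
before the stopping test can succeed. -/
theorem isSome_pick (j : G.InfoSet i) (q : G.Seq i → ℝ) {z : ℝ} (hz : 0 ≤ z) :
    (pick j q z).isSome := by
  have hne : actionList j ≠ [] :=
    List.ne_nil_of_mem (mem_actionList (Classical.arbitrary (Action j)))
  obtain ⟨a, l, h⟩ := List.exists_cons_of_ne_nil hne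
  rw [pick, h, List.foldl_cons]
  refine isSome_foldl_pickStep _ _ _ _ ?_
  rw [pickStep, if_neg (not_lt.2 hz)]
  rfl

open Classical in
theorem sample_spec (hPR : G.PerfectRecall) {ord : List (G.InfoSet i)} (hord : IsTopDown ord)
    (u : G.InfoSet i → unitInterval) (q : G.Seq i → ℝ) :
    (sample ord u q).val none = 1 ∧ ∀ j (a : Action j), (sample ord u q).val (some ⟨j, a⟩) =
      if (sample ord u q).val (parentSeq j) = 1 ∧ pick j q (u j * q (parentSeq j)) = some a
      then 1 else 0 := by
  obtain ⟨F, hF⟩ : ∃ F : (G.Seq i → ℝ) → G.InfoSet i → G.Seq i → ℝ, ∀ π j, F π j =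
      if π (parentSeq j) = 1 then
        match pick j q (u j * q (parentSeq j)) with
        | some a => Function.update π (some ⟨j, a⟩) 1
        | none => π
      else π := ⟨_, fun _ _ => rfl⟩
  set x₀ : G.Seq i → ℝ := fun σ => if σ = none then 1 else 0 with hx₀
  have hv : (sample ord u q).val = ord.foldl F x₀ := by
    simp only [sample, Timed.val_bind, Timed.val_loop]
    congr 1
    · funext π j
      have hpick : ∀ z, ((actionList j).foldl (fun (c : ℝ × Option (Action j)) a =>
          if z < c.1 then c else (c.1 + q (some ⟨j, a⟩), some a)) (0, none)).2 = pick j q z := by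
        intro z
        rfl
      simp only [Timed.val_bind, Timed.val_test, Timed.val_ite, decide_eq_true_eq, Timed.val_pure,
        Timed.val_unit, Timed.val_rd, Timed.val_loop, Timed.val_mul, Timed.val_add, hF, hpick]
      split_ifs
      · rcases pick j q (u j * q (parentSeq j)) with _ | a <;> simp
      · rfl
    · funext σ
      simp [hx₀]
  have hF1 : ∀ π j σ, (∀ a, σ ≠ some ⟨j, a⟩) → F π j σ = π σ := by
    intro π j σ hσ
    rw [hF]
    split_ifs
    · rcases pick j q (u j * q (parentSeq j)) with _ | a
      · rfl
      · exact Function.update_of_ne (hσ a) _ _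
    · rfl
  rw [hv]
  have h0 : ord.foldl F x₀ none = 1 := foldl_infoSet_of_ne hF1 ord x₀ none (by simp)
  refine ⟨h0, fun j a => ?_⟩
  obtain ⟨y, hy0, hy1, hy2, hy3⟩ := foldl_topDown hord hF1 x₀ j
  have hp : y (parentSeq j) = ord.foldl F x₀ (parentSeq j) :=
    parentSeq_congr hPR (hy0.trans h0.symm) hy2
  rw [hy3, hF, hp]
  have hya : y (some ⟨j, a⟩) = 0 := by rw [hy1]; simp [hx₀]
  by_cases h1 : ord.foldl F x₀ (parentSeq j) = 1
  · rw [if_pos h1]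
    rcases pick j q (u j * q (parentSeq j)) with _ | a'
    · simp [hya]
    · by_cases h2 : a' = a
      · subst h2
        simp [h1]
      · refine (Function.update_of_ne (fun h => h2 (some_mk_injective j h.symm)) (1 : ℝ) y).trans ?_
        rw [if_neg fun h => h2 (Option.some.inj h.2)]
        exact hya
  · rw [if_neg h1, if_neg fun h => h1 h.1, hya]

theorem sample_mem_Pure (hPR : G.PerfectRecall) {ord : List (G.InfoSet i)} (hord : IsTopDown ord)
    (u : G.InfoSet i → unitInterval) {q : G.Seq i → ℝ} (hq : ∀ σ, 0 ≤ q σ) :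
    (sample ord u q).val ∈ G.Pure i := by
  classical
  obtain ⟨h0, h1⟩ := sample_spec hPR hord u q
  have h01 : ∀ σ, (sample ord u q).val σ = 0 ∨ (sample ord u q).val σ = 1 := by
    rintro (_ | ⟨j, a⟩)
    · exact Or.inr h0
    · rw [h1]
      split_ifs
      · exact Or.inr rfl
      · exact Or.inl rfl
  refine ⟨⟨fun σ => ?_, h0, fun j => ?_⟩, h01⟩
  · rcases h01 σ with h | h <;> rw [h]
    exact zero_le_one
  · simp only [h1]
    obtain ⟨a, ha⟩ := Option.isSome_iff_exists.1
      (isSome_pick j q (mul_nonneg (u j).2.1 (hq (parentSeq j))))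
    rcases h01 (parentSeq j) with h | h
    · simp [h]
    · simp [h, ha]

end Game

namespace Game

variable {n : ℕ} {Act : Type} [DecidableEq Act] {G : Game n Act} {i : Fin n}

/-! ### Regret of counterfactual regret minimization -/

theorem QSub_none {j : G.InfoSet i} {y : G.Seq i → ℝ} (hy : y ∈ QSub j) : y none = 0 :=
  hy.2.1 none not_infoLeSeq_none

/-- A single flow equation for all information sets: a unit source sits at `j`, and outside the
subtree both sides are zero. -/
theorem QSub_sum_eq (hPR : G.PerfectRecall) {j : G.InfoSet i} {y : G.Seq i → ℝ} (hy : y ∈ QSub j)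
    (j' : G.InfoSet i) [Decidable (j' = j)] :
    ∑ a : Action j', y (some ⟨j', a⟩) = y (parentSeq j') + if j' = j then 1 else 0 := by
  by_cases h : j' = j
  · subst h
    rw [if_pos rfl, hy.2.2.1, hy.2.1 _ fun h => ne_of_infoLeSeq_parentSeq hPR h rfl, zero_add]
  · rw [if_neg h, add_zero]
    by_cases hj : infoLe j j'
    · exact (hy.2.2.2 j' hj h).symm
    · rw [hy.2.1 _ (not_infoLeSeq_of_parentSeq hPR hj)]
      exact Finset.sum_eq_zero fun a _ => hy.2.1 _ (by rwa [infoLeSeq_some])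

theorem QSub_sum_le_one (hPR : G.PerfectRecall) {j : G.InfoSet i} {y : G.Seq i → ℝ}
    (hy : y ∈ QSub j) (j' : G.InfoSet i) : ∑ a : Action j', y (some ⟨j', a⟩) ≤ 1 := by
  classical
  induction j' using infoSet_induction hPR with
  | H j' ih =>
    by_cases h : j' = j
    · subst h
      exact hy.2.2.1.le
    · rw [QSub_sum_eq hPR hy, if_neg h, add_zero]
      rcases e : parentSeq j' with _ | ⟨j₁, a₁⟩
      · rw [QSub_none hy]
        exact zero_le_one
      · exact (Finset.single_le_sum (f := fun a => y (some ⟨j₁, a⟩)) (fun a _ => hy.1 _)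
          (Finset.mem_univ a₁)).trans (ih j₁ (infoLe_of_parentSeq hPR e) (ne_of_parentSeq hPR e))

/-- Summation by parts along the tree. By flow conservation, the value of an information set counted
at its parent sequence cancels against the same value subtracted at its own actions; only the source
at `j` is left. The identity holds for arbitrary `V`. -/
theorem cfr_decomposition (hPR : G.PerfectRecall) (g : G.Seq i → ℝ) (V : G.InfoSet i → ℝ)
    {j : G.InfoSet i} {y : G.Seq i → ℝ} (hy : y ∈ QSub j) :
    g ⬝ᵥ y - V j = ∑ τ : G.SeqStar i, y (some τ) * (actionValue g V (some τ) - V τ.1) := by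
  classical
  have h1 : ∑ τ : G.SeqStar i, y (some τ) * ∑ j', (if parentSeq j' = some τ then V j' else 0) =
      ∑ j', V j' * y (parentSeq j') := by
    simp only [Finset.mul_sum]
    rw [Finset.sum_comm]
    refine Finset.sum_congr rfl fun j' _ => ?_
    rcases e : parentSeq j' with _ | σ
    · simp [QSub_none hy]
    · simp [mul_comm]
  have h2 : ∑ τ : G.SeqStar i, y (some τ) * V τ.1 = ∑ j', V j' * y (parentSeq j') + V j := by
    have h3 : V j = ∑ j', V j' * if j' = j then 1 else 0 := by simp
    rw [Fintype.sum_sigma, h3, ← Finset.sum_add_distrib]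
    refine Finset.sum_congr rfl fun j' _ => ?_
    rw [← mul_add, ← QSub_sum_eq hPR hy, mul_comm, Finset.sum_mul]
  have h4 : g ⬝ᵥ y = ∑ τ : G.SeqStar i, y (some τ) * g (some τ) := by
    rw [dotProduct, Fintype.sum_option, QSub_none hy, mul_zero, zero_add]
    exact Finset.sum_congr rfl fun τ _ => mul_comm _ _
  simp only [mul_sub, actionValue, mul_add, Finset.sum_sub_distrib, Finset.sum_add_distrib]
  rw [h1, h2, h4]
  ring

theorem sum_behavior_mul_advantage {b : G.SeqStar i → ℝ} (hb1 : ∀ j, ∑ a : Action j, b ⟨j, a⟩ = 1)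
    {g : G.Seq i → ℝ} {V : G.InfoSet i → ℝ}
    (hV : ∀ j, V j = ∑ a : Action j, b ⟨j, a⟩ * actionValue g V (some ⟨j, a⟩))
    (j : G.InfoSet i) (c : ℝ) :
    ∑ a : Action j, b ⟨j, a⟩ * c * (actionValue g V (some ⟨j, a⟩) - V j) = 0 := by
  have h : ∀ a : Action j, b ⟨j, a⟩ * c * (actionValue g V (some ⟨j, a⟩) - V j) =
      c * (b ⟨j, a⟩ * actionValue g V (some ⟨j, a⟩)) - c * V j * b ⟨j, a⟩ := fun a => by ring
  simp only [h, Finset.sum_sub_distrib, ← Finset.mul_sum, hb1, ← hV]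
  ring

theorem seqForm_eq_mul (hPR : G.PerfectRecall) (b : G.SeqStar i → ℝ) (j j' : G.InfoSet i) :
    ∃ c, ∀ a, seqForm b j (some ⟨j', a⟩) = b ⟨j', a⟩ * c := by
  classical
  by_cases h : infoLe j j'
  · exact ⟨_, fun a => seqForm_some hPR b h a⟩
  · exact ⟨0, fun a => by rw [mul_zero, seqForm_of_not]; rwa [infoLeSeq_some]⟩

/-- Apply the decomposition to the current strategy itself: the average advantage of the behavior is
zero at each information set. -/
theorem dotProduct_seqForm (hPR : G.PerfectRecall) {b : G.SeqStar i → ℝ} (hb : ∀ τ, 0 ≤ b τ)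
    (hb1 : ∀ j, ∑ a : Action j, b ⟨j, a⟩ = 1) {g : G.Seq i → ℝ} {V : G.InfoSet i → ℝ}
    (hV : ∀ j, V j = ∑ a : Action j, b ⟨j, a⟩ * actionValue g V (some ⟨j, a⟩))
    (j : G.InfoSet i) : g ⬝ᵥ seqForm b j = V j := by
  have h := cfr_decomposition hPR g V (seqForm_mem_QSub hPR hb hb1 j)
  rw [Fintype.sum_sigma, Finset.sum_eq_zero, sub_eq_zero] at h
  · exact h
  · intro j' _
    obtain ⟨c, hc⟩ := seqForm_eq_mul hPR b j j'
    simp only [hc]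
    exact sum_behavior_mul_advantage hb1 hV j' c

/-- The behavior that goes to `j'`, plays `a'` there, and follows `b` elsewhere. -/
noncomputable def towards (b : G.SeqStar i → ℝ) (j' : G.InfoSet i) (a' : Action j')
    (τ : G.SeqStar i) : ℝ :=
  open Classical in
  if τ.1 = j' then if τ = ⟨j', a'⟩ then 1 else 0
  else if infoLe τ.1 j' then if seqLe (some τ) (parentSeq j') then 1 else 0
  else b τ

theorem towards_nonneg {b : G.SeqStar i → ℝ} (hb : ∀ τ, 0 ≤ b τ) (j' : G.InfoSet i)
    (a' : Action j') (τ : G.SeqStar i) : 0 ≤ towards b j' a' τ := by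
  unfold towards
  split_ifs
  exacts [zero_le_one, le_rfl, zero_le_one, le_rfl, hb τ]

theorem sum_towards (hPR : G.PerfectRecall) {b : G.SeqStar i → ℝ}
    (hb1 : ∀ j, ∑ a : Action j, b ⟨j, a⟩ = 1) (j' : G.InfoSet i) (a' : Action j')
    (j : G.InfoSet i) : ∑ a : Action j, towards b j' a' ⟨j, a⟩ = 1 := by
  classical
  by_cases h : j = j'
  · subst h
    simp [towards]
  by_cases h' : infoLe j j'
  · obtain ⟨a₀, ha₀⟩ := exists_seqLe_parentSeq hPR h' h
    have : ∀ a, towards b j' a' ⟨j, a⟩ = if a = a₀ then 1 else 0 := fun a => by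
      simp only [towards, if_neg h, if_pos h']
      congr 1
      exact propext ⟨fun ha => action_unique hPR ha ha₀, fun e => e ▸ ha₀⟩
    simp [this]
  · simp only [towards, if_neg h, if_neg h', hb1]

/-- Bounds the range of the local utilities at `j'` by the range of `g` on strategies. The two
strategies reach `j'` with mass one, differ only in the action there, and follow `b` off the path,
where the advantages average to zero. -/
theorem exists_dotProduct_sub_eq (hPR : G.PerfectRecall) {b : G.SeqStar i → ℝ}
    (hb : ∀ τ, 0 ≤ b τ) (hb1 : ∀ j, ∑ a : Action j, b ⟨j, a⟩ = 1) {g : G.Seq i → ℝ}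
    {V : G.InfoSet i → ℝ}
    (hV : ∀ j, V j = ∑ a : Action j, b ⟨j, a⟩ * actionValue g V (some ⟨j, a⟩))
    {j j' : G.InfoSet i} (h : infoLe j j') (a a' : Action j') :
    ∃ y ∈ QSub j, ∃ y' ∈ QSub j,
      g ⬝ᵥ y - g ⬝ᵥ y' = actionValue g V (some ⟨j', a⟩) - actionValue g V (some ⟨j', a'⟩) := by
  classical
  have hmem : ∀ a, seqForm (towards b j' a) j ∈ QSub j := fun a =>
    seqForm_mem_QSub hPR (towards_nonneg hb j' a) (sum_towards hPR hb1 j' a) j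
  refine ⟨_, hmem a, _, hmem a', ?_⟩
  -- The last sum is the contribution of the information sets above `j'`; it does not depend on `a`
  -- and cancels in the difference.
  have key : ∀ a, g ⬝ᵥ seqForm (towards b j' a) j - V j =
      actionValue g V (some ⟨j', a⟩) - V j' + ∑ j₀ ∈ Finset.univ.erase j',
        if infoLe j₀ j' then ∑ a₀ : Action j₀, seqForm (fun τ =>
          if seqLe (some τ) (parentSeq j') then 1 else 0) j (some ⟨j₀, a₀⟩) *
            (actionValue g V (some ⟨j₀, a₀⟩) - V j₀) else 0 := by
    intro a
    rw [cfr_decomposition hPR g V (hmem a), Fintype.sum_sigma,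
      ← Finset.add_sum_erase _ _ (Finset.mem_univ j')]
    congr 1
    · have h1 : ∀ a₀, seqForm (towards b j' a) j (some ⟨j', a₀⟩) = if a₀ = a then 1 else 0 := by
        intro a₀
        have h2 : (if j' = j then 1 else seqForm (towards b j' a) j (parentSeq j')) = 1 := by
          split_ifs with hj
          · rfl
          · have h3 := ((infoLe_iff hPR).1 h).resolve_left (Ne.symm hj)
            rcases e : parentSeq j' with _ | σ
            · simp [e] at h3
            · rw [e, infoLeSeq_some] at h3
              simp only [seqForm, if_pos h3]
              refine Finset.prod_eq_one fun τ hτ => ?_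
              simp only [Finset.mem_filter, Finset.mem_univ, true_and] at hτ
              have h4 : seqLe (some τ) (parentSeq j') := e ▸ hτ.1
              have h5 := seqLe_parentSeq_infoLeSeq hPR h4
              rw [towards, if_neg (ne_of_infoLeSeq_parentSeq hPR h5),
                if_pos (infoLe_of_infoLeSeq_parentSeq hPR h5), if_pos h4]
        rw [seqForm_some hPR _ h, h2, mul_one, towards, if_pos rfl]
        congr 1
        exact propext ⟨fun e => mk_injective j' e, fun e => e ▸ rfl⟩
      simp only [h1]
      simp
    · refine Finset.sum_congr rfl fun j₀ hj₀ => ?_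
      have hne := Finset.ne_of_mem_erase hj₀
      split_ifs with hle
      · refine Finset.sum_congr rfl fun a₀ _ => ?_
        congr 1
        simp only [seqForm]
        split_ifs with hj
        · refine Finset.prod_congr rfl fun τ hτ => ?_
          simp only [Finset.mem_filter, Finset.mem_univ, true_and] at hτ
          have h1 : infoLe τ.1 j₀ := infoLe_of_seqLe hPR hτ.1
          rw [towards, if_neg, if_pos (infoLe_trans hPR h1 hle)]
          rintro e
          exact hne (infoLe_antisymm hPR hle (e ▸ h1))
        · rfl
      · obtain ⟨c, hc⟩ := seqForm_eq_mul hPR (towards b j' a) j j₀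
        have h1 : ∀ a₀, towards b j' a ⟨j₀, a₀⟩ = b ⟨j₀, a₀⟩ := fun a₀ => by
          simp only [towards, if_neg hne, if_neg hle]
        simp only [hc, h1]
        exact sum_behavior_mul_advantage hb1 hV j₀ c
  linarith [key a, key a']

/-- The regret bound of counterfactual regret minimization. -/
theorem cfr_regret_bound (hPR : G.PerfectRecall) {ord : List (G.InfoSet i)} (hord : IsTopDown ord)
    (j : G.InfoSet i) (R : ℕ → G.SeqStar i → ℝ) (g : ℕ → G.Seq i → ℝ) {D : ℝ} (hD0 : 0 ≤ D)
    (h0 : R 0 = 0) (hR : ∀ t, R (t + 1) = (cfrObserve ord j (R t) (g t)).val) (T : ℕ)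
    (hg : ∀ t < T, ∀ y ∈ QSub j, ∀ y' ∈ QSub j, g t ⬝ᵥ y - g t ⬝ᵥ y' ≤ D)
    {y : G.Seq i → ℝ} (hy : y ∈ QSub j) :
    ∑ t ∈ Finset.range T, (g t ⬝ᵥ y - g t ⬝ᵥ seqForm (cfrBehavior (R t)) j) ≤
      D * √T * Fintype.card (G.SeqStar i) := by
  classical
  choose V hV using fun t => exists_values hPR (cfrBehavior (R t)) (g t)
  have hstep : ∀ t τ, R (t + 1) τ = if infoLe j τ.1 then
      R t τ + (actionValue (g t) (V t) (some τ) - V t τ.1) else R t τ := fun t τ => by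
    rw [hR, val_cfrObserve hPR hord j _ _ _ (hV t)]
  -- Summed over time, the decomposition expresses the regret against `y` as the `y`-weighted sum of
  -- the cumulative local regrets.
  have hsum : ∀ T, ∑ t ∈ Finset.range T, (g t ⬝ᵥ y - g t ⬝ᵥ seqForm (cfrBehavior (R t)) j) =
      ∑ τ : G.SeqStar i, y (some τ) * R T τ := by
    intro T
    induction T with
    | zero => simp [h0]
    | succ T ih =>
      rw [Finset.sum_range_succ, ih, dotProduct_seqForm hPR (cfrBehavior_nonneg _)
        (sum_cfrBehavior _) (hV T), cfr_decomposition hPR _ _ hy, ← Finset.sum_add_distrib]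
      refine Finset.sum_congr rfl fun τ _ => ?_
      rw [hstep]
      split_ifs with hτ
      · ring
      · rw [hy.2.1 (some τ) (by rwa [infoLeSeq_some])]
        ring
  have hbound : ∀ τ : G.SeqStar i, infoLe j τ.1 →
      R T τ ≤ D * √(Fintype.card (Action τ.1) * T) := by
    rintro ⟨j', a⟩ hj
    refine regret_matching_bound (fun t a => R t ⟨j', a⟩)
      (fun t a => actionValue (g t) (V t) (some ⟨j', a⟩)) D hD0 ?_ ?_ T ?_ a
    · simp only [h0]
      rfl
    · intro t a
      rw [hstep, if_pos hj, hV t j']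
      rfl
    · intro t ht a a'
      obtain ⟨y, hy, y', hy', e⟩ := exists_dotProduct_sub_eq hPR (cfrBehavior_nonneg (R t))
        (sum_cfrBehavior _) (hV t) hj a a'
      rw [← e]
      exact hg t ht y hy y' hy'
  rw [hsum]
  calc ∑ τ : G.SeqStar i, y (some τ) * R T τ
      ≤ ∑ τ : G.SeqStar i, y (some τ) * (D * √(Fintype.card (Action τ.1) * T)) := by
        refine Finset.sum_le_sum fun τ _ => ?_
        by_cases hτ : infoLe j τ.1
        · exact mul_le_mul_of_nonneg_left (hbound τ hτ) (hy.1 _)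
        · rw [hy.2.1 (some τ) (by rwa [infoLeSeq_some]), zero_mul, zero_mul]
    _ = ∑ j' : G.InfoSet i, (∑ a : Action j', y (some ⟨j', a⟩)) *
          (D * √(Fintype.card (Action j') * T)) := by
        rw [Fintype.sum_sigma]
        exact Finset.sum_congr rfl fun j' _ => by rw [Finset.sum_mul]
    _ ≤ ∑ j' : G.InfoSet i, D * √T * Fintype.card (Action j') := by
        refine Finset.sum_le_sum fun j' _ => ?_
        -- The mass of `y` at each information set is at most one, and `√|A|` is bounded by `|A|` so
        -- that the sum over information sets counts sequences.
        refine (mul_le_of_le_one_left (by positivity) (QSub_sum_le_one hPR hy j')).trans ?_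
        have h1 : √(Fintype.card (Action j') : ℝ) ≤ Fintype.card (Action j') := by
          rw [Real.sqrt_le_left (by positivity)]
          have : (1 : ℝ) ≤ Fintype.card (Action j') := by exact_mod_cast Fintype.card_pos
          nlinarith
        rw [Real.sqrt_mul (Nat.cast_nonneg _)]
        have h2 : 0 ≤ D * √(T : ℝ) := by positivity
        nlinarith
    _ = D * √T * Fintype.card (G.SeqStar i) := by
        rw [← Finset.mul_sum, ← Nat.cast_sum, sum_card_action]

/-! ### The memory of the algorithm -/

section Memory

variable {ord : List (G.InfoSet i)}
  (oracle : ∀ j : G.InfoSet i, (Action j → Action j → ℝ) → Action j → ℝ) (fp : ℕ → ℕ)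

theorem val_mixedNext (hPR : G.PerfectRecall) (hord : IsTopDown ord) (M : G.Mem i) :
    (mixedNext ord oracle fp M).val =
      { regSimplex := M.regSimplex
        regCfr := M.regCfr
        lam := rmPoint M.regSimplex
        cont := fun τ => seqForm (cfrBehavior (M.regCfr τ)) τ.1
        strat := (fixedPoint ord oracle fp (rmPoint M.regSimplex)
          fun τ => seqForm (cfrBehavior (M.regCfr τ)) τ.1).val } := by
  have h1 : (rmNext (G.starList i) M.regSimplex).val = rmPoint M.regSimplex := val_rmNext _
  have h2 : (Timed.tabulate (G.starList i) fun τ => trigNext ord τ (M.regCfr τ)).val =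
      fun τ => seqForm (cfrBehavior (M.regCfr τ)) τ.1 := by
    classical
    funext τ
    simp [trigNext, val_cfrNext hPR hord]
  simp only [mixedNext, hullNext, Timed.val_bind, Timed.val_pure, h1, h2]

theorem val_nextElement (M : G.Mem i) (u : G.InfoSet i → unitInterval) :
    (nextElement ord oracle fp M u).val = ((mixedNext ord oracle fp M).val,
      (sample ord u (mixedNext ord oracle fp M).val.strat).val) := rfl

/-- The utility that is passed to counterfactual regret minimization for the trigger `τ`. -/
noncomputable def trigUtility (ℓ q : G.Seq i → ℝ) (τ : G.SeqStar i) (r : G.Seq i) : ℝ :=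
  open Classical in if infoLeSeq τ.1 r then ℓ r * q (some τ) else 0

theorem observeUtility_regCfr (M : G.Mem i) (ℓ : G.Seq i → ℝ) (τ : G.SeqStar i) :
    (observeUtility ord M ℓ).val.regCfr τ =
      (cfrObserve ord τ.1 (M.regCfr τ) (trigUtility ℓ M.strat τ)).val := by
  classical
  simp only [observeUtility, mixedObserve, hullObserve, Timed.val_bind, Timed.val_pure,
    Timed.val_tabulate, mem_starList, if_true, trigObserve]
  congr 2
  funext r
  simp [trigUtility]

theorem observeUtility_regSimplex (M : G.Mem i) (ℓ : G.Seq i → ℝ) (τ : G.SeqStar i) :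
    (observeUtility ord M ℓ).val.regSimplex τ = M.regSimplex τ +
      (ℓ ⬝ᵥ (devMatrix τ (M.cont τ)).mulVecLin M.strat -
        ∑ τ', M.lam τ' * ℓ ⬝ᵥ (devMatrix τ' (M.cont τ')).mulVecLin M.strat) := by
  classical
  have h : ∀ τ', (evalDev (fun r c => ℓ r * M.strat c) τ' (M.cont τ')).val =
      ℓ ⬝ᵥ (devMatrix τ' (M.cont τ')).mulVecLin M.strat := by
    intro τ'
    simp only [evalDev, Timed.val_sum, Timed.val_bind, Timed.val_test, decide_eq_true_eq,
      Timed.val_ite, Timed.val_add, Timed.val_mul, Timed.val_rd, Timed.val_rd₂, Timed.val_pure,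
      dotProduct, devMatrix_mulVecLin_apply]
    rw [seqList, Finset.sum_map_toList]
    refine Finset.sum_congr rfl fun r _ => ?_
    split_ifs <;> ring
  have hΛ : (Timed.tabulate (G.seqList i) fun r => Timed.tabulate (G.seqList i) fun c => do
      Timed.mul (← Timed.rd ℓ r) (← Timed.rd M.strat c)).val = fun r c => ℓ r * M.strat c := by
    funext r c
    simp
  simp only [observeUtility, mixedObserve, hullObserve, Timed.val_bind, Timed.val_pure, rmObserve,
    Timed.val_tabulate, mem_starList, if_true, hΛ, h, Timed.val_add, Timed.val_sub, Timed.val_rd,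
    Timed.val_sum, Timed.val_mul, sum_map_starList]

/-- Only an inequality, because a player without information sets has no triggers and the weights
then sum to zero. -/
theorem rmPoint_regSimplex_sum_le (R : G.SeqStar i → ℝ) : ∑ τ, rmPoint R τ ≤ 1 := by
  rcases isEmpty_or_nonempty (G.SeqStar i) with h | h
  · simp
  · exact (sum_rmPoint R).le

theorem mixedNext_balanced (hPR : G.PerfectRecall) (hord : IsTopDown ord)
    (horacle : ∀ j, IsFixedPointOracle (oracle j)) (M : G.Mem i) :
    (mixedNext ord oracle fp M).val.strat ∈ G.Q i ∧ ∀ σ, Balanced (rmPoint M.regSimplex)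
      (fun τ => seqForm (cfrBehavior (M.regCfr τ)) τ.1)
      (mixedNext ord oracle fp M).val.strat σ := by
  rw [val_mixedNext oracle fp hPR hord]
  exact fixedPoint_balanced hPR hord horacle fp (rmPoint_nonneg _) (rmPoint_regSimplex_sum_le _)
    fun τ => seqForm_mem_QSub hPR (cfrBehavior_nonneg _) (sum_cfrBehavior _) τ.1

theorem mixedAt_mem_Q (hPR : G.PerfectRecall) (hord : IsTopDown ord)
    (horacle : ∀ j, IsFixedPointOracle (oracle j)) (u : ℕ → G.InfoSet i → unitInterval)
    (ℓ : ℕ → G.Seq i → ℝ) (t : ℕ) : mixedAt ord oracle fp u ℓ t ∈ G.Q i :=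
  (mixedNext_balanced oracle fp hPR hord horacle _).1

theorem playAt_eq (u : ℕ → G.InfoSet i → unitInterval) (ℓ : ℕ → G.Seq i → ℝ) (t : ℕ) :
    playAt ord oracle fp u ℓ t = (sample ord (u t) (mixedAt ord oracle fp u ℓ t)).val := rfl

theorem playAt_mem_Pure (hPR : G.PerfectRecall) (hord : IsTopDown ord)
    (horacle : ∀ j, IsFixedPointOracle (oracle j)) (u : ℕ → G.InfoSet i → unitInterval)
    (ℓ : ℕ → G.Seq i → ℝ) (t : ℕ) : playAt ord oracle fp u ℓ t ∈ G.Pure i :=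
  sample_mem_Pure hPR hord _ (mixedAt_mem_Q oracle fp hPR hord horacle u ℓ t).1

/-- The regret of the mixed strategies. -/
theorem mixed_regret_bound (hPR : G.PerfectRecall) (hord : IsTopDown ord)
    (horacle : ∀ j, IsFixedPointOracle (oracle j)) (u : ℕ → G.InfoSet i → unitInterval)
    (ℓ : ℕ → G.Seq i → ℝ) {D : ℝ} (hD0 : 0 ≤ D) (T : ℕ)
    (hℓ : ∀ t < T, ∀ q ∈ G.Q i, ∀ q' ∈ G.Q i, ℓ t ⬝ᵥ q - ℓ t ⬝ᵥ q' ≤ D)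
    {τ : G.SeqStar i} {y : G.Seq i → ℝ} (hy : y ∈ QSub τ.1) :
    ∑ t ∈ Finset.range T, (ℓ t ⬝ᵥ (devMatrix τ y).mulVecLin (mixedAt ord oracle fp u ℓ t) -
      ℓ t ⬝ᵥ mixedAt ord oracle fp u ℓ t) ≤
      D * √T * (√(Fintype.card (G.SeqStar i)) + Fintype.card (G.SeqStar i)) := by
  classical
  set M := memAt ord oracle fp u ℓ with hM
  set q := mixedAt ord oracle fp u ℓ with hq
  have hqQ : ∀ t, q t ∈ G.Q i := mixedAt_mem_Q oracle fp hPR hord horacle u ℓ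
  set cont : ℕ → G.SeqStar i → G.Seq i → ℝ :=
    fun t τ => seqForm (cfrBehavior ((M t).regCfr τ)) τ.1 with hcont
  have hcQ : ∀ t τ, cont t τ ∈ QSub τ.1 := fun t τ =>
    seqForm_mem_QSub hPR (cfrBehavior_nonneg _) (sum_cfrBehavior _) τ.1
  set v : ℕ → G.SeqStar i → ℝ :=
    fun t τ => ℓ t ⬝ᵥ (devMatrix τ (cont t τ)).mulVecLin (q t) with hv
  have hsucc : ∀ t, M (t + 1) =
      (observeUtility ord (mixedNext ord oracle fp (M t)).val (ℓ t)).val := fun t => rfl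
  have hqt : ∀ t, (mixedNext ord oracle fp (M t)).val.strat = q t := fun t => rfl
  have hRs : ∀ t τ, (M (t + 1)).regSimplex τ = (M t).regSimplex τ +
      (v t τ - ∑ τ', rmPoint (M t).regSimplex τ' * v t τ') := by
    intro t τ
    rw [hsucc, observeUtility_regSimplex, hqt]
    simp only [val_mixedNext oracle fp hPR hord, hv, hcont]
  have hRc : ∀ t τ, (M (t + 1)).regCfr τ =
      (cfrObserve ord τ.1 ((M t).regCfr τ) (trigUtility (ℓ t) (q t) τ)).val := by
    intro t τ
    rw [hsucc, observeUtility_regCfr, hqt]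
    simp only [val_mixedNext oracle fp hPR hord]
  -- The value of a deviation is affine in its continuation, with linear part `trigUtility`.
  -- Differences of these utilities are thus differences of `ℓ t` between points of `Q`, which gives
  -- the range `D`.
  have hdev : ∀ t (y y' : G.Seq i → ℝ),
      ℓ t ⬝ᵥ (devMatrix τ y).mulVecLin (q t) - ℓ t ⬝ᵥ (devMatrix τ y').mulVecLin (q t) =
      trigUtility (ℓ t) (q t) τ ⬝ᵥ y - trigUtility (ℓ t) (q t) τ ⬝ᵥ y' := by
    intro t y y'
    simp only [dotProduct, ← Finset.sum_sub_distrib, devMatrix_mulVecLin_apply, trigUtility]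
    refine Finset.sum_congr rfl fun r _ => ?_
    split_ifs <;> ring
  have hcfr := cfr_regret_bound hPR hord τ.1 (fun t => (M t).regCfr τ)
    (fun t => trigUtility (ℓ t) (q t) τ) hD0 rfl (fun t => hRc t τ) T
    (fun t ht y hy y' hy' => by
      rw [← hdev]
      exact hℓ t ht _ (dev_mem_Q hPR hy (hqQ t)) _ (dev_mem_Q hPR hy' (hqQ t))) hy
  have hrm := regret_matching_bound (fun t => (M t).regSimplex) v D hD0 rfl hRs T
    (fun t ht k k' => hℓ t ht _ (dev_mem_Q hPR (hcQ t k) (hqQ t)) _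
      (dev_mem_Q hPR (hcQ t k') (hqQ t))) τ
  have : Nonempty (G.SeqStar i) := ⟨τ⟩
  -- The fixed-point property: the utility of `q t` equals the utility of the point that regret
  -- matching plays, so the simplex regrets compare deviations with `q t` itself.
  have hfix : ∀ t, ℓ t ⬝ᵥ q t = ∑ τ', rmPoint (M t).regSimplex τ' * v t τ' := by
    intro t
    have h1 : q t = fun σ => ∑ τ', rmPoint (M t).regSimplex τ' *
        (devMatrix τ' (cont t τ')).mulVecLin (q t) σ := funext fun σ =>
      (sum_dev_eq_of_balanced (sum_rmPoint _)
        ((mixedNext_balanced oracle fp hPR hord horacle (M t)).2 σ)).symm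
    nth_rewrite 1 [h1]
    simp only [dotProduct, hv, Finset.mul_sum]
    rw [Finset.sum_comm]
    exact Finset.sum_congr rfl fun τ' _ => Finset.sum_congr rfl fun σ _ => by ring
  have hRT : ∀ T, ∑ t ∈ Finset.range T, (v t τ - ℓ t ⬝ᵥ q t) = (M T).regSimplex τ := by
    intro T
    induction T with
    | zero => rfl
    | succ T ih => rw [Finset.sum_range_succ, ih, hRs, hfix]
  -- The regret splits into that of the best continuation against the current one and that of the
  -- current continuation against `q t`.
  calc ∑ t ∈ Finset.range T, (ℓ t ⬝ᵥ (devMatrix τ y).mulVecLin (q t) - ℓ t ⬝ᵥ q t)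
      = ∑ t ∈ Finset.range T, (trigUtility (ℓ t) (q t) τ ⬝ᵥ y -
          trigUtility (ℓ t) (q t) τ ⬝ᵥ cont t τ) + (M T).regSimplex τ := by
        rw [← hRT, ← Finset.sum_add_distrib]
        refine Finset.sum_congr rfl fun t _ => ?_
        rw [← hdev]
        ring
    _ ≤ D * √T * Fintype.card (G.SeqStar i) + D * √(Fintype.card (G.SeqStar i) * T) :=
        add_le_add hcfr hrm
    _ = _ := by
        rw [Real.sqrt_mul (Nat.cast_nonneg _)]
        ring

end Memory

end Game

namespace Game

variable {n : ℕ} {Act : Type} [DecidableEq Act] {G : Game n Act} {i : Fin n}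

/-! ### Measurability -/

section Measurability

variable {Ω : Type*} [MeasurableSpace Ω]

theorem measurable_rmPoint {ι : Type} [Fintype ι] {R : Ω → ι → ℝ}
    (hR : ∀ k, Measurable fun ω => R ω k) (k : ι) : Measurable fun ω => rmPoint (R ω) k := by
  have h : Measurable fun ω => ∑ k, max (R ω k) 0 :=
    Finset.measurable_sum _ fun k _ => (hR k).max measurable_const
  exact Measurable.ite (h (measurableSet_singleton 0)) measurable_const
    (((hR k).max measurable_const).div h)

theorem measurable_cfrBehavior {R : Ω → G.SeqStar i → ℝ}
    (hR : ∀ τ, Measurable fun ω => R ω τ) (τ : G.SeqStar i) :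
    Measurable fun ω => cfrBehavior (R ω) τ :=
  measurable_rmPoint (R := fun ω (a : Action τ.1) => R ω ⟨τ.1, a⟩) (fun a => hR ⟨τ.1, a⟩) τ.2

theorem measurable_seqForm {b : Ω → G.SeqStar i → ℝ} (hb : ∀ τ, Measurable fun ω => b ω τ)
    (j : G.InfoSet i) (σ : G.Seq i) : Measurable fun ω => seqForm (b ω) j σ := by
  rcases σ with _ | σ
  · exact measurable_const
  · simp only [seqForm]
    split_ifs
    · exact Finset.measurable_prod _ fun τ _ => hb τ
    · exact measurable_const

/-- Measurability is read from the recursive equations, not from the loop: each entry is a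
measurable expression in entries at ancestors. -/
theorem measurable_fixedPoint (hPR : G.PerfectRecall) {ord : List (G.InfoSet i)}
    (hord : IsTopDown ord)
    {oracle : ∀ j : G.InfoSet i, (Action j → Action j → ℝ) → Action j → ℝ}
    (horacle : ∀ j, Measurable (oracle j)) (fp : ℕ → ℕ) {lam : Ω → G.SeqStar i → ℝ}
    (hlam : ∀ τ, Measurable fun ω => lam ω τ) {cont : Ω → G.SeqStar i → G.Seq i → ℝ}
    (hcont : ∀ τ σ, Measurable fun ω => cont ω τ σ) (σ : G.Seq i) :
    Measurable fun ω => (fixedPoint ord oracle fp (lam ω) (cont ω)).val σ := by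
  classical
  have hs := fun ω => fixedPoint_spec hPR hord oracle fp (lam ω) (cont ω)
  set x := fun ω => (fixedPoint ord oracle fp (lam ω) (cont ω)).val with hx
  have hnone : Measurable fun ω => x ω none := by
    simp only [hx, (hs _).1]
    exact measurable_const
  have main : ∀ j (a : Action j), Measurable fun ω => x ω (some ⟨j, a⟩) := by
    intro j
    induction j using infoSet_induction hPR with
    | H j ih =>
      have hp : Measurable fun ω => x ω (parentSeq j) := by
        rcases e : parentSeq j with _ | ⟨j', a'⟩
        · exact hnone
        · exact ih j' (infoLe_of_parentSeq hPR e) (ne_of_parentSeq hPR e) a'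
      have hin : ∀ a, Measurable fun ω => inflow (lam ω) (cont ω) (x ω) j a := fun a => by
        refine Finset.measurable_sum _ fun τ _ => ?_
        split_ifs with hτ
        · exact ((hlam τ).mul (hcont τ _)).mul (ih τ.1 (infoLe_of_infoLeSeq_parentSeq hPR hτ)
            (ne_of_infoLeSeq_parentSeq hPR hτ) τ.2)
        · exact measurable_const
      have hmass : ∀ σ, Measurable fun ω => trigMass (lam ω) σ := fun σ => by
        refine Finset.measurable_sum _ fun τ _ => ?_
        split_ifs
        · exact hlam τ
        · exact measurable_const
      have hW : ∀ ar ac, Measurable fun ω => extMatrix (lam ω) (cont ω) (x ω) j ar ac := by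
        intro ar ac
        refine (hin ar).add ((((hlam _).mul (hcont _ _)).add ?_).mul hp)
        split_ifs
        · exact measurable_const.sub (hmass _)
        · exact measurable_const
      intro a
      have he : (fun ω => x ω (some ⟨j, a⟩)) =
          fun ω => extValue oracle (lam ω) (cont ω) (x ω) j a := funext fun ω => (hs ω).2 j a
      rw [he]
      refine Measurable.ite (hp (measurableSet_singleton 0)) measurable_const (hp.mul ?_)
      refine (measurable_pi_apply a).comp ((horacle j).comp ?_)
      exact measurable_pi_lambda _ fun ar => measurable_pi_lambda _ fun ac => (hW ar ac).div hp
  rcases σ with _ | ⟨j, a⟩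
  · exact hnone
  · exact main j a

theorem measurableSet_pick (j : G.InfoSet i) {q : Ω → G.Seq i → ℝ} {z : Ω → ℝ}
    (hq : ∀ σ, Measurable fun ω => q ω σ) (hz : Measurable z) (a : Action j) :
    MeasurableSet {ω | pick j (q ω) (z ω) = some a} := by
  -- The discrete σ-algebra on the selected action makes the whole loop state a measurable pair.
  let _ : MeasurableSpace (Option (Action j)) := ⊤
  have key : ∀ (l : List (Action j)) (c : Ω → ℝ × Option (Action j)), Measurable c →
      Measurable fun ω => l.foldl (pickStep (fun a => q ω (some ⟨j, a⟩)) (z ω)) (c ω) := by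
    intro l
    induction l with
    | nil => exact fun c hc => hc
    | cons a l ih =>
      intro c hc
      refine ih (fun ω => pickStep (fun a => q ω (some ⟨j, a⟩)) (z ω) (c ω) a) ?_
      exact Measurable.ite (measurableSet_lt hz hc.fst) hc
        ((hc.fst.add (hq _)).prodMk measurable_const)
  exact (key (actionList j) (fun _ => (0, none)) measurable_const).snd
    (MeasurableSpace.measurableSet_top (s := {some a}))

theorem measurable_sample (hPR : G.PerfectRecall) {ord : List (G.InfoSet i)}
    (hord : IsTopDown ord) {u : Ω → G.InfoSet i → unitInterval} (hu : Measurable u)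
    {q : Ω → G.Seq i → ℝ} (hq : ∀ σ, Measurable fun ω => q ω σ) (σ : G.Seq i) :
    Measurable fun ω => (sample ord (u ω) (q ω)).val σ := by
  classical
  have hs := fun ω => sample_spec hPR hord (u ω) (q ω)
  set x := fun ω => (sample ord (u ω) (q ω)).val with hx
  have hnone : Measurable fun ω => x ω none := by
    simp only [hx, (hs _).1]
    exact measurable_const
  have main : ∀ j (a : Action j), Measurable fun ω => x ω (some ⟨j, a⟩) := by
    intro j
    induction j using infoSet_induction hPR with
    | H j ih =>
      intro a
      have hp : Measurable fun ω => x ω (parentSeq j) := by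
        rcases e : parentSeq j with _ | ⟨j', a'⟩
        · exact hnone
        · exact ih j' (infoLe_of_parentSeq hPR e) (ne_of_parentSeq hPR e) a'
      have he := funext fun ω => (hs ω).2 j a
      rw [he]
      refine Measurable.ite (MeasurableSet.inter (hp (measurableSet_singleton 1))
        (measurableSet_pick j hq ?_ a)) measurable_const measurable_const
      exact (measurable_subtype_coe.comp ((measurable_pi_apply j).comp hu)).mul (hq _)
  rcases σ with _ | ⟨j, a⟩
  · exact hnone
  · exact main j a

theorem measurable_cfrObserve (hPR : G.PerfectRecall) {ord : List (G.InfoSet i)}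
    (hord : IsTopDown ord) (j : G.InfoSet i) {R : Ω → G.SeqStar i → ℝ}
    (hR : ∀ τ, Measurable fun ω => R ω τ) {g : Ω → G.Seq i → ℝ}
    (hg : ∀ σ, Measurable fun ω => g ω σ) (τ : G.SeqStar i) :
    Measurable fun ω => (cfrObserve ord j (R ω) (g ω)).val τ := by
  classical
  -- The values are chosen separately for each `ω`, but their recursion over descendants determines
  -- them and yields measurability.
  choose V hV using fun ω => exists_values hPR (cfrBehavior (R ω)) (g ω)
  have hval : ∀ σ, (∀ j, parentSeq j = some σ → Measurable fun ω => V ω j) →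
      Measurable fun ω => actionValue (g ω) (V ω) (some σ) := by
    intro σ h
    refine (hg _).add (Finset.measurable_sum _ fun j' _ => ?_)
    split_ifs with hj'
    · exact h j' hj'
    · exact measurable_const
  have hVm : ∀ j, Measurable fun ω => V ω j := by
    intro j
    induction j using (wellFounded_infoSet hPR).induction with
    | _ j ih =>
      rw [show (fun ω => V ω j) = fun ω => _ from funext fun ω => hV ω j]
      refine Finset.measurable_sum _ fun a _ => (measurable_cfrBehavior hR _).mul (hval _ ?_)
      exact fun j' hj' => ih j' ⟨infoLe_of_parentSeq hPR hj', ne_of_parentSeq hPR hj'⟩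
  simp only [fun ω => val_cfrObserve hPR hord j (R ω) (g ω) (V ω) (hV ω) τ]
  split_ifs
  · exact (hR τ).add ((hval τ fun j _ => hVm j).sub (hVm _))
  · exact hR τ

theorem measurable_dotProduct {S : Type*} [Fintype S] {x y : Ω → S → ℝ}
    (hx : ∀ s, Measurable fun ω => x ω s) (hy : ∀ s, Measurable fun ω => y ω s) :
    Measurable fun ω => x ω ⬝ᵥ y ω :=
  Finset.measurable_sum _ fun s _ => (hx s).mul (hy s)

theorem measurable_dev (τ : G.SeqStar i) {y x : Ω → G.Seq i → ℝ}
    (hy : ∀ σ, Measurable fun ω => y ω σ) (hx : ∀ σ, Measurable fun ω => x ω σ) (σ : G.Seq i) :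
    Measurable fun ω => (devMatrix τ (y ω)).mulVecLin (x ω) σ := by
  classical
  simp only [devMatrix_mulVecLin_apply]
  refine Measurable.add ?_ ?_
  · split_ifs
    · exact measurable_const
    · exact hx σ
  · split_ifs
    · exact (hy σ).mul (hx _)
    · exact measurable_const

section Memory

variable {ord : List (G.InfoSet i)}
  {oracle : ∀ j : G.InfoSet i, (Action j → Action j → ℝ) → Action j → ℝ} (fp : ℕ → ℕ)

theorem measurable_mixedNext (hPR : G.PerfectRecall) (hord : IsTopDown ord)
    (horacle : ∀ j, Measurable (oracle j)) {M : Ω → G.Mem i}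
    (hs : ∀ τ, Measurable fun ω => (M ω).regSimplex τ)
    (hc : ∀ τ τ', Measurable fun ω => (M ω).regCfr τ τ') (σ : G.Seq i) :
    Measurable fun ω => (mixedNext ord oracle fp (M ω)).val.strat σ := by
  simp only [val_mixedNext oracle fp hPR hord]
  exact measurable_fixedPoint hPR hord horacle fp (measurable_rmPoint hs)
    (fun τ => measurable_seqForm (measurable_cfrBehavior (hc τ)) τ.1) σ

theorem measurable_memAt (hPR : G.PerfectRecall) (hord : IsTopDown ord)
    (horacle : ∀ j, Measurable (oracle j)) (u : Ω → ℕ → G.InfoSet i → unitInterval)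
    {ℓ : Ω → ℕ → G.Seq i → ℝ} (hℓ : ∀ t σ, Measurable fun ω => ℓ ω t σ) (t : ℕ) :
    (∀ τ, Measurable fun ω => (memAt ord oracle fp (u ω) (ℓ ω) t).regSimplex τ) ∧
    ∀ τ τ', Measurable fun ω => (memAt ord oracle fp (u ω) (ℓ ω) t).regCfr τ τ' := by
  classical
  induction t with
  | zero => exact ⟨fun τ => measurable_const, fun τ τ' => measurable_const⟩
  | succ t ih =>
    have hq := measurable_mixedNext fp hPR hord horacle ih.1 ih.2
    have hcont := fun τ => measurable_seqForm (measurable_cfrBehavior (ih.2 τ)) τ.1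
    simp only [memAt, val_nextElement]
    refine ⟨fun τ => ?_, fun τ τ' => ?_⟩
    · simp only [observeUtility_regSimplex]
      have hv : ∀ τ, Measurable fun ω => ℓ ω t ⬝ᵥ
          (devMatrix τ ((mixedNext ord oracle fp (memAt ord oracle fp (u ω) (ℓ ω) t)).val.cont
            τ)).mulVecLin
          (mixedNext ord oracle fp (memAt ord oracle fp (u ω) (ℓ ω) t)).val.strat := fun τ => by
        refine measurable_dotProduct (hℓ t) (measurable_dev τ ?_ hq)
        simp only [val_mixedNext oracle fp hPR hord]
        exact hcont τ
      refine Measurable.add ?_ ((hv τ).sub (Finset.measurable_sum _ fun τ' _ =>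
        Measurable.mul ?_ (hv τ')))
      · simp only [val_mixedNext oracle fp hPR hord]
        exact ih.1 τ
      · simp only [val_mixedNext oracle fp hPR hord]
        exact measurable_rmPoint ih.1 τ'
    · simp only [observeUtility_regCfr]
      refine measurable_cfrObserve hPR hord τ.1 ?_ (fun σ => ?_) τ'
      · simp only [val_mixedNext oracle fp hPR hord]
        exact ih.2 τ
      · unfold trigUtility
        split_ifs
        · exact (hℓ t σ).mul (hq _)
        · exact measurable_const

theorem measurable_mixedAt (hPR : G.PerfectRecall) (hord : IsTopDown ord)
    (horacle : ∀ j, Measurable (oracle j)) (u : Ω → ℕ → G.InfoSet i → unitInterval)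
    {ℓ : Ω → ℕ → G.Seq i → ℝ} (hℓ : ∀ t σ, Measurable fun ω => ℓ ω t σ) (t : ℕ) (σ : G.Seq i) :
    Measurable fun ω => mixedAt ord oracle fp (u ω) (ℓ ω) t σ :=
  measurable_mixedNext fp hPR hord horacle (measurable_memAt fp hPR hord horacle u hℓ t).1
    (measurable_memAt fp hPR hord horacle u hℓ t).2 σ

theorem measurable_playAt (hPR : G.PerfectRecall) (hord : IsTopDown ord)
    (horacle : ∀ j, Measurable (oracle j)) {u : Ω → ℕ → G.InfoSet i → unitInterval}
    (hu : ∀ t, Measurable fun ω => u ω t)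
    {ℓ : Ω → ℕ → G.Seq i → ℝ} (hℓ : ∀ t σ, Measurable fun ω => ℓ ω t σ) (t : ℕ) (σ : G.Seq i) :
    Measurable fun ω => playAt ord oracle fp (u ω) (ℓ ω) t σ :=
  measurable_sample hPR hord (hu t) (measurable_mixedAt fp hPR hord horacle u hℓ t) σ

end Memory

end Measurability

end Game

namespace Game

variable {n : ℕ} {Act : Type} [DecidableEq Act] {G : Game n Act} {i : Fin n}

/-! ### The sampling step is unbiased -/

theorem foldl_pickStep_of_lt {A : Type} (f : A → ℝ) {z : ℝ} (l : List A) {c : ℝ × Option A}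
    (h : z < c.1) : l.foldl (pickStep f z) c = c := by
  induction l with
  | nil => rfl
  | cons a l ih => rw [List.foldl_cons, pickStep, if_pos h, ih]

theorem foldl_pickStep_mem {A : Type} (f : A → ℝ) {z : ℝ} (l : List A) {c : ℝ × Option A}
    (h : c.1 ≤ z) (h' : z < c.1 + (l.map f).sum) :
    ∃ a ∈ l, (l.foldl (pickStep f z) c).2 = some a := by
  induction l generalizing c with
  | nil => exact absurd h' (by simpa using h)
  | cons a l ih =>
    rw [List.foldl_cons, pickStep, if_neg (not_lt.2 h)]
    rw [List.map_cons, List.sum_cons, ← add_assoc] at h'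
    rcases lt_or_ge z (c.1 + f a) with h1 | h1
    · exact ⟨a, List.mem_cons_self, by rw [foldl_pickStep_of_lt f l h1]⟩
    · obtain ⟨a', ha', e⟩ := ih (c := (c.1 + f a, some a)) h1 h'
      exact ⟨a', List.mem_cons_of_mem _ ha', e⟩

/-- The selecting numbers form a half-open interval of length `f a`, whose offset `r` is the sum
over the actions before `a`. The starting state is arbitrary so that the induction goes through. -/
theorem foldl_pickStep_eq_iff {A : Type} {f : A → ℝ} (hf : ∀ a, 0 ≤ f a) {l : List A}
    (hl : l.Nodup) {a : A} (ha : a ∈ l) :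
    ∃ r, 0 ≤ r ∧ r + f a ≤ (l.map f).sum ∧ ∀ z (c : ℝ × Option A), c.1 ≤ z →
      z < c.1 + (l.map f).sum → ((l.foldl (pickStep f z) c).2 = some a ↔
        c.1 + r ≤ z ∧ z < c.1 + (r + f a)) := by
  induction l with
  | nil => simp at ha
  | cons b l ih =>
    rw [List.nodup_cons] at hl
    have hnn : 0 ≤ (l.map f).sum := List.sum_nonneg (by simpa using fun a _ => hf a)
    by_cases hab : a = b
    · subst hab
      refine ⟨0, le_rfl, by simpa using hnn, fun z c h h' => ?_⟩
      rw [List.foldl_cons, pickStep, if_neg (not_lt.2 h)]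
      rw [List.map_cons, List.sum_cons, ← add_assoc] at h'
      rcases lt_or_ge z (c.1 + f a) with h1 | h1
      · rw [foldl_pickStep_of_lt f l h1]
        simpa using ⟨h, h1⟩
      · obtain ⟨a', ha', e⟩ := foldl_pickStep_mem f l (c := (c.1 + f a, some a)) h1 h'
        rw [e]
        constructor
        · intro e'
          exact absurd (Option.some.inj e' ▸ ha') hl.1
        · rintro ⟨-, h2⟩
          linarith
    · obtain ⟨r, hr0, hr1, hr2⟩ := ih hl.2 ((List.mem_cons.1 ha).resolve_left hab)
      refine ⟨f b + r, add_nonneg (hf b) hr0, ?_, fun z c h h' => ?_⟩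
      · rw [List.map_cons, List.sum_cons]
        linarith
      · rw [List.foldl_cons, pickStep, if_neg (not_lt.2 h)]
        rw [List.map_cons, List.sum_cons, ← add_assoc] at h'
        rcases lt_or_ge z (c.1 + f b) with h1 | h1
        · rw [foldl_pickStep_of_lt f l h1]
          constructor
          · intro e
            exact absurd (Option.some.inj e).symm hab
          · rintro ⟨h2, -⟩
            linarith
        · rw [hr2 z (c.1 + f b, some b) h1 h']
          constructor <;> rintro ⟨h2, h3⟩ <;> constructor <;> simp only at * <;> linarith

open Classical in
theorem integral_pick {q : G.Seq i → ℝ} (hq : q ∈ G.Q i) (j : G.InfoSet i) (a : Action j)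
    (hp : q (parentSeq j) ≠ 0) :
    ∫ x : unitInterval, (if pick j q (x * q (parentSeq j)) = some a then (1 : ℝ) else 0) =
      q (some ⟨j, a⟩) / q (parentSeq j) := by
  set p := q (parentSeq j) with hpdef
  have hp0 : 0 < p := lt_of_le_of_ne (hq.1 _) (Ne.symm hp)
  obtain ⟨r, hr0, hr1, hr2⟩ := foldl_pickStep_eq_iff (f := fun a => q (some ⟨j, a⟩))
    (fun a => hq.1 _) (actionList_nodup j) (mem_actionList a)
  rw [sum_map_actionList, ← hq.2.2 j, ← hpdef] at hr1 hr2
  have hae : ∀ᵐ x : unitInterval, (if pick j q (x * p) = some a then (1 : ℝ) else 0) =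
      (((↑) : unitInterval → ℝ) ⁻¹' Set.Ico (r / p) ((r + q (some ⟨j, a⟩)) / p)).indicator 1 x := by
    -- At `x = 1` the partial sums never exceed the threshold and the rule falls back on the last
    -- action; this single point is discarded.
    have h1 : ∀ᵐ x : unitInterval, x ≠ 1 := by simp [ae_iff]
    filter_upwards [h1] with x hx
    have hx1 : (x : ℝ) < 1 := lt_of_le_of_ne x.2.2 fun e => hx (Subtype.ext e)
    have h2 := hr2 (x * p) (0, none) (mul_nonneg x.2.1 hp0.le) (by
      simp only [zero_add]
      nlinarith)
    simp only [zero_add] at h2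
    rw [← pick] at h2
    simp only [Set.indicator_apply, Set.mem_preimage, Set.mem_Ico, div_le_iff₀ hp0, lt_div_iff₀ hp0,
      h2, Pi.one_apply]
  rw [integral_congr_ae hae, integral_indicator_one
    (measurable_subtype_coe measurableSet_Ico), measureReal_def]
  rw [volume_preimage_coe measurableSet_Icc.nullMeasurableSet measurableSet_Ico]
  rw [Set.inter_eq_left.2, Real.volume_Ico, ENNReal.toReal_ofReal]
  · field_simp
    ring
  · rw [← sub_div, add_sub_cancel_left]
    exact div_nonneg (hq.1 _) hp0.le
  · intro z hz
    exact ⟨(div_nonneg hr0 hp0.le).trans hz.1, hz.2.le.trans ((div_le_one hp0).2 hr1)⟩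

/-- The coordinate is one iff every draw on its path goes the right way. Each such event involves
the random number of its own information set only, so the mean is a product of conditional
probabilities, which telescopes to `q σ`. Trivial factors off the path leave room to insert the
factor of the next information set. -/
theorem sample_eq_prod (hPR : G.PerfectRecall) {ord : List (G.InfoSet i)} (hord : IsTopDown ord)
    {q : G.Seq i → ℝ} (hq : q ∈ G.Q i) (σ : G.Seq i) :
    ∃ f : G.InfoSet i → unitInterval → ℝ, (∀ j, ¬ infoLeSeq j σ → f j = 1) ∧
      (∀ u, (sample ord u q).val σ = ∏ j, f j (u j)) ∧ ∏ j, ∫ x, f j x = q σ := by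
  classical
  have hs := fun u => sample_spec hPR hord u q
  have h0 : ∃ f : G.InfoSet i → unitInterval → ℝ, (∀ j, ¬ infoLeSeq j none → f j = 1) ∧
      (∀ u, (sample ord u q).val none = ∏ j, f j (u j)) ∧ ∏ j, ∫ x, f j x = q none :=
    ⟨fun _ => 1, fun _ _ => rfl, fun u => by simp [(hs u).1], by simp [hq.2.1]⟩
  rcases σ with _ | ⟨j, a⟩
  · exact h0
  induction j using infoSet_induction hPR with
  | H j ih =>
    obtain ⟨f, hf1, hf2, hf3⟩ : ∃ f : G.InfoSet i → unitInterval → ℝ,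
        (∀ j', ¬ infoLeSeq j' (parentSeq j) → f j' = 1) ∧
        (∀ u, (sample ord u q).val (parentSeq j) = ∏ j, f j (u j)) ∧
        ∏ j, ∫ x, f j x = q (parentSeq j) := by
      rcases e : parentSeq j with _ | ⟨j', a'⟩
      · exact h0
      · exact ih j' (infoLe_of_parentSeq hPR e) (ne_of_parentSeq hPR e) a'
    have hfj : f j = 1 := hf1 j fun h => ne_of_infoLeSeq_parentSeq hPR h rfl
    set h : unitInterval → ℝ :=
      fun x => if pick j q (x * q (parentSeq j)) = some a then 1 else 0 with hh
    refine ⟨Function.update f j h, fun j' hj' => ?_, fun u => ?_, ?_⟩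
    · rw [infoLeSeq_some] at hj'
      rw [Function.update_of_ne, hf1 j' (not_infoLeSeq_of_parentSeq hPR hj')]
      rintro rfl
      exact hj' (infoLe_refl _)
    · have h1 : ∏ j', Function.update f j h j' (u j') = (∏ j', f j' (u j')) * h (u j) := by
        rw [← Finset.mul_prod_erase _ _ (Finset.mem_univ j),
          ← Finset.mul_prod_erase _ (fun j' => f j' (u j')) (Finset.mem_univ j), hfj,
          Function.update_self, Pi.one_apply, one_mul, mul_comm]
        congr 1
        refine Finset.prod_congr rfl fun j' hj' => ?_
        rw [Function.update_of_ne (Finset.ne_of_mem_erase hj')]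
      rw [h1, ← hf2, (hs u).2]
      rcases (sample_mem_Pure hPR hord u hq.1).2 (parentSeq j) with h2 | h2 <;>
        simp [h2, hh]
    · have h1 : ∏ j', ∫ x, Function.update f j h j' x = (∏ j', ∫ x, f j' x) * ∫ x, h x := by
        rw [← Finset.mul_prod_erase _ _ (Finset.mem_univ j),
          ← Finset.mul_prod_erase _ (fun j' => ∫ x, f j' x) (Finset.mem_univ j), hfj,
          Function.update_self, mul_comm]
        simp only [Pi.one_apply, integral_const, probReal_univ, smul_eq_mul, mul_one, one_mul]
        congr 1
        refine Finset.prod_congr rfl fun j' hj' => ?_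
        rw [Function.update_of_ne (Finset.ne_of_mem_erase hj')]
      rw [h1, hf3]
      -- With no mass at the parent the conditional probability is undefined, but then the child has
      -- no mass either.
      by_cases hp : q (parentSeq j) = 0
      · rw [hp, zero_mul]
        have h2 := hq.2.2 j
        rw [hp] at h2
        exact ((Finset.sum_eq_zero_iff_of_nonneg fun a _ => hq.1 _).1 h2.symm a
          (Finset.mem_univ a)).symm
      · rw [integral_pick hq j a hp, mul_div_cancel₀ _ hp]

theorem integrable_sample (hPR : G.PerfectRecall) {ord : List (G.InfoSet i)}
    (hord : IsTopDown ord) {q : G.Seq i → ℝ} (hq : q ∈ G.Q i) (σ : G.Seq i) :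
    Integrable fun u : G.InfoSet i → unitInterval => (sample ord u q).val σ := by
  refine Integrable.of_bound
    (measurable_sample (Ω := G.InfoSet i → unitInterval) hPR hord
      (u := fun u => u) (q := fun _ => q) measurable_id (fun _ => measurable_const) σ).aestronglyMeasurable
    1
    (Filter.Eventually.of_forall fun u => ?_)
  rcases (sample_mem_Pure hPR hord u hq.1).2 σ with h | h <;> rw [h] <;> simp

theorem integral_sample (hPR : G.PerfectRecall) {ord : List (G.InfoSet i)}
    (hord : IsTopDown ord) {q : G.Seq i → ℝ} (hq : q ∈ G.Q i) (σ : G.Seq i) :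
    ∫ u : G.InfoSet i → unitInterval, (sample ord u q).val σ = q σ := by
  obtain ⟨f, -, hf1, hf2⟩ := sample_eq_prod hPR hord hq σ
  simp only [hf1]
  rw [integral_fintype_prod_volume_eq_prod, hf2]

/-- Hoeffding's bound for the error that the sampling step makes in a linear functional. -/
theorem lintegral_exp_sample_le (hPR : G.PerfectRecall) {ord : List (G.InfoSet i)}
    (hord : IsTopDown ord) {q : G.Seq i → ℝ} (hq : q ∈ G.Q i) (w : G.Seq i → ℝ) {D : ℝ}
    (hD : ∀ π ∈ G.Q i, |w ⬝ᵥ π| ≤ D) (c : ℝ) :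
    ∫⁻ u : G.InfoSet i → unitInterval,
      ENNReal.ofReal (Real.exp (c * (w ⬝ᵥ (sample ord u q).val - w ⬝ᵥ q))) ≤
      ENNReal.ofReal (Real.exp (D ^ 2 * c ^ 2 / 2)) := by
  have hD0 : 0 ≤ D := (abs_nonneg _).trans (hD q hq)
  have hm : Measurable fun u : G.InfoSet i → unitInterval => w ⬝ᵥ (sample ord u q).val :=
    measurable_dotProduct (fun _ => measurable_const)
      (measurable_sample (Ω := G.InfoSet i → unitInterval) hPR hord (u := fun u => u)
        (q := fun _ => q) measurable_id fun _ => measurable_const)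
  have hint : ∫ u : G.InfoSet i → unitInterval, w ⬝ᵥ (sample ord u q).val = w ⬝ᵥ q := by
    simp only [dotProduct]
    rw [integral_finsetSum _ fun σ _ => (integrable_sample hPR hord hq σ).const_mul _]
    refine Finset.sum_congr rfl fun σ _ => ?_
    rw [integral_const_mul, integral_sample hPR hord hq]
  -- Hoeffding's lemma on `[-D, D]`: the variance proxy is the square of half the length, that is `D
  -- ^ 2`.
  have hsub := hasSubgaussianMGF_of_mem_Icc (μ := (volume : Measure (G.InfoSet i → unitInterval)))
    (X := fun u => w ⬝ᵥ (sample ord u q).val) (a := -D) (b := D) hm.aemeasurable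
    (Filter.Eventually.of_forall fun u =>
      abs_le.1 (hD _ (sample_mem_Pure hPR hord u hq.1).1))
  rw [hint] at hsub
  rw [← ofReal_integral_eq_lintegral_ofReal (hsub.integrable_exp_mul c)
    (Filter.Eventually.of_forall fun u => (Real.exp_pos _).le)]
  refine ENNReal.ofReal_le_ofReal ((hsub.mgf_le c).trans_eq ?_)
  congr 2
  simp only [NNReal.coe_pow, NNReal.coe_div, coe_nnnorm, Real.norm_eq_abs, NNReal.coe_ofNat]
  rw [sub_neg_eq_add, abs_of_nonneg (by linarith)]
  ring

end Game

/-! ### Concentration -/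

/-- Exponential moments of a sum whose increments, conditionally on the past, have sub-Gaussian
exponential moments. -/
theorem lintegral_exp_sum_le {Ω : Type*} [MeasurableSpace Ω] {P : Measure Ω}
    [IsProbabilityMeasure P] {E : Type*} [MeasurableSpace E] {μ : Measure E} [SFinite μ]
    {K : ℕ → Type*} [∀ t, MeasurableSpace (K t)] {U : ℕ → Ω → E} {H : ∀ t, Ω → K t}
    (hU : ∀ t, Measurable (U t)) (hH : ∀ t, Measurable (H t)) (hlaw : ∀ t, P.map (U t) = μ)
    (hind : ∀ t, IndepFun (U t) (H t) P) {S : ℕ → Ω → ℝ} {F : ∀ t, K t → ℝ} {Z : ∀ t, K t × E → ℝ}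
    (hF : ∀ t, Measurable (F t)) (hZ : ∀ t, Measurable (Z t)) (hS0 : ∀ ω, S 0 ω = 0)
    (hSF : ∀ t ω, S t ω = F t (H t ω)) (hS : ∀ t ω, S (t + 1) ω = S t ω + Z t (H t ω, U t ω))
    {D : ℝ} (c : ℝ) (T : ℕ)
    (hD : ∀ t < T, ∀ᵐ ω ∂P, ∫⁻ u, ENNReal.ofReal (Real.exp (c * Z t (H t ω, u))) ∂μ ≤
      ENNReal.ofReal (Real.exp (D ^ 2 * c ^ 2 / 2))) :
    ∫⁻ ω, ENNReal.ofReal (Real.exp (c * S T ω)) ∂P ≤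
      ENNReal.ofReal (Real.exp (T * (D ^ 2 * c ^ 2 / 2))) := by
  induction T with
  | zero => simp [hS0]
  | succ t ih =>
    have hm1 : Measurable fun h => ENNReal.ofReal (Real.exp (c * F t h)) :=
      (Real.measurable_exp.comp ((hF t).const_mul c)).ennreal_ofReal
    have hm2 : Measurable fun p => ENNReal.ofReal (Real.exp (c * Z t p)) :=
      (Real.measurable_exp.comp ((hZ t).const_mul c)).ennreal_ofReal
    have hm : Measurable fun p : K t × E =>
        ENNReal.ofReal (Real.exp (c * F t p.1)) * ENNReal.ofReal (Real.exp (c * Z t p)) :=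
      (hm1.comp measurable_fst).mul hm2
    -- Independence makes the joint law a product, so the fresh variable can be integrated out
    -- first, for a frozen history.
    have hmap : P.map (fun ω => (H t ω, U t ω)) = (P.map (H t)).prod μ := by
      rw [(indepFun_iff_map_prod_eq_prod_map_map (hH t).aemeasurable (hU t).aemeasurable).1
        (hind t).symm, hlaw]
    calc ∫⁻ ω, ENNReal.ofReal (Real.exp (c * S (t + 1) ω)) ∂P
        = ∫⁻ ω, (fun p : K t × E => ENNReal.ofReal (Real.exp (c * F t p.1)) *
            ENNReal.ofReal (Real.exp (c * Z t p))) (H t ω, U t ω) ∂P := by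
          refine lintegral_congr fun ω => ?_
          rw [hS, hSF, mul_add, Real.exp_add, ENNReal.ofReal_mul (Real.exp_pos _).le]
      _ = ∫⁻ p, ENNReal.ofReal (Real.exp (c * F t p.1)) * ENNReal.ofReal (Real.exp (c * Z t p))
            ∂((P.map (H t)).prod μ) := by
          rw [← hmap, lintegral_map hm ((hH t).prodMk (hU t))]
      _ = ∫⁻ h, ENNReal.ofReal (Real.exp (c * F t h)) *
            ∫⁻ u, ENNReal.ofReal (Real.exp (c * Z t (h, u))) ∂μ ∂(P.map (H t)) := by
          rw [lintegral_prod _ hm.aemeasurable]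
          refine lintegral_congr fun h => ?_
          exact lintegral_const_mul (f := fun u => ENNReal.ofReal (Real.exp (c * Z t (h, u))))
            (ENNReal.ofReal (Real.exp (c * F t h)))
            (hm2.comp measurable_prodMk_left)
      _ = ∫⁻ ω, ENNReal.ofReal (Real.exp (c * F t (H t ω))) *
            ∫⁻ u, ENNReal.ofReal (Real.exp (c * Z t (H t ω, u))) ∂μ ∂P :=
          lintegral_map (hm1.mul hm2.lintegral_prod_right') (hH t)
      _ ≤ ∫⁻ ω, ENNReal.ofReal (Real.exp (c * S t ω)) *
            ENNReal.ofReal (Real.exp (D ^ 2 * c ^ 2 / 2)) ∂P := by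
          refine lintegral_mono_ae ?_
          filter_upwards [hD t (Nat.lt_succ_self t)] with ω hω
          rw [← hSF]
          exact mul_le_mul_right hω _
      _ = (∫⁻ ω, ENNReal.ofReal (Real.exp (c * S t ω)) ∂P) *
            ENNReal.ofReal (Real.exp (D ^ 2 * c ^ 2 / 2)) := by
          refine lintegral_mul_const _ ?_
          simp only [hSF]
          exact hm1.comp (hH t)
      _ ≤ ENNReal.ofReal (Real.exp (t * (D ^ 2 * c ^ 2 / 2))) *
            ENNReal.ofReal (Real.exp (D ^ 2 * c ^ 2 / 2)) :=
          mul_le_mul_left (ih fun s hs => hD s (hs.trans (Nat.lt_succ_self t))) _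
      _ = _ := by
          rw [← ENNReal.ofReal_mul (Real.exp_pos _).le, ← Real.exp_add]
          congr 2
          push_cast
          ring

/-- The tail bound that follows from sub-Gaussian exponential moments. -/
theorem measure_ge_le_of_lintegral_exp {Ω : Type*} [MeasurableSpace Ω] {P : Measure Ω}
    {X : Ω → ℝ} (hX : Measurable X) {V : ℝ} (hV : 0 < V)
    (h : ∀ c, ∫⁻ ω, ENNReal.ofReal (Real.exp (c * X ω)) ∂P ≤
      ENNReal.ofReal (Real.exp (V * c ^ 2 / 2))) {s : ℝ} (hs : 0 ≤ s) :
    P {ω | s ≤ X ω} ≤ ENNReal.ofReal (Real.exp (-(s ^ 2 / (2 * V)))) := by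
  -- Chernoff's bound with `c = s / V`, the minimizer of `V * c ^ 2 / 2 - c * s`.
  have h1 : {ω | s ≤ X ω} ⊆ {ω | ENNReal.ofReal (Real.exp (s / V * s)) ≤
      ENNReal.ofReal (Real.exp (s / V * X ω))} := fun ω hω => by
    refine ENNReal.ofReal_le_ofReal (Real.exp_le_exp.2 ?_)
    exact mul_le_mul_of_nonneg_left hω (div_nonneg hs hV.le)
  have hm : Measurable fun ω => ENNReal.ofReal (Real.exp (s / V * X ω)) :=
    (Real.measurable_exp.comp (hX.const_mul _)).ennreal_ofReal
  have h2 : ENNReal.ofReal (Real.exp (s / V * s)) ≠ 0 := by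
    simp [Real.exp_pos]
  refine (measure_mono h1).trans ((meas_ge_le_lintegral_div hm.aemeasurable h2
    ENNReal.ofReal_ne_top).trans ?_)
  refine (ENNReal.div_le_div_right (h (s / V)) _).trans_eq ?_
  rw [← ENNReal.ofReal_div_of_pos (Real.exp_pos _), ← Real.exp_sub]
  congr 2
  field_simp
  ring

/-! ### Adaptive environments: martingale bound for each deviation and union bound -/

namespace Game

variable {n : ℕ} {Act : Type} [DecidableEq Act] {G : Game n Act} {i : Fin n}

section Concentration

variable {ord : List (G.InfoSet i)}
  {oracle : ∀ j : G.InfoSet i, (Action j → Action j → ℝ) → Action j → ℝ} (fp : ℕ → ℕ)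

/-- The memory is updated through the mixed strategy and not through the sample, so for given past
utilities it does not depend on the random numbers. -/
theorem memAt_congr {u u' : ℕ → G.InfoSet i → unitInterval} {ℓ ℓ' : ℕ → G.Seq i → ℝ} {t : ℕ}
    (hℓ : ∀ s < t, ℓ s = ℓ' s) :
    memAt ord oracle fp u ℓ t = memAt ord oracle fp u' ℓ' t := by
  induction t with
  | zero => rfl
  | succ t ih =>
    simp only [memAt, val_nextElement]
    rw [ih fun s hs => hℓ s (hs.trans (Nat.lt_succ_self t)), hℓ t (Nat.lt_succ_self t)]

theorem mixedAt_congr {u u' : ℕ → G.InfoSet i → unitInterval} {ℓ ℓ' : ℕ → G.Seq i → ℝ} {t : ℕ}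
    (hℓ : ∀ s < t, ℓ s = ℓ' s) :
    mixedAt ord oracle fp u ℓ t = mixedAt ord oracle fp u' ℓ' t := by
  simp only [mixedAt, val_nextElement]
  rw [memAt_congr fp hℓ]

theorem playAt_congr {u u' : ℕ → G.InfoSet i → unitInterval} {ℓ ℓ' : ℕ → G.Seq i → ℝ} {t : ℕ}
    (hu : u t = u' t) (hℓ : ∀ s < t, ℓ s = ℓ' s) :
    playAt ord oracle fp u ℓ t = playAt ord oracle fp u' ℓ' t := by
  rw [playAt_eq, playAt_eq, hu, mixedAt_congr fp hℓ]

/-- The gain of a deviation as a linear functional. -/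
noncomputable def gain (τ : G.SeqStar i) (y ℓ : G.Seq i → ℝ) : G.Seq i → ℝ :=
  Matrix.vecMul ℓ (devMatrix τ y) - ℓ

theorem gain_dotProduct (τ : G.SeqStar i) (y ℓ x : G.Seq i → ℝ) :
    gain τ y ℓ ⬝ᵥ x = ℓ ⬝ᵥ (devMatrix τ y).mulVecLin x - ℓ ⬝ᵥ x := by
  rw [gain, sub_dotProduct, Matrix.mulVecLin_apply, Matrix.dotProduct_mulVec]

/-- A gain is a difference of `ℓ` between two points of `Q`, in either order, so its absolute value
is bounded by `D` and not by `2 * D`. -/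
theorem abs_gain_le (hPR : G.PerfectRecall) {τ : G.SeqStar i} {y ℓ : G.Seq i → ℝ}
    (hy : y ∈ QSub τ.1) {D : ℝ} (hℓ : ∀ q ∈ G.Q i, ∀ q' ∈ G.Q i, ℓ ⬝ᵥ q - ℓ ⬝ᵥ q' ≤ D)
    {x : G.Seq i → ℝ} (hx : x ∈ G.Q i) : |gain τ y ℓ ⬝ᵥ x| ≤ D := by
  rw [gain_dotProduct, abs_le]
  have := hℓ _ hx _ (dev_mem_Q hPR hy hx)
  exact ⟨by linarith, hℓ _ (dev_mem_Q hPR hy hx) _ hx⟩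

theorem measurable_gain {Ω : Type*} [MeasurableSpace Ω] (τ : G.SeqStar i) (y : G.Seq i → ℝ)
    {ℓ : Ω → G.Seq i → ℝ} (hℓ : ∀ σ, Measurable fun ω => ℓ ω σ) (σ : G.Seq i) :
    Measurable fun ω => gain τ y (ℓ ω) σ := by
  have h : Measurable fun ω => ℓ ω ⬝ᵥ fun r => devMatrix τ y r σ :=
    measurable_dotProduct (y := fun _ r => devMatrix τ y r σ) hℓ fun _ => measurable_const
  exact h.sub (hℓ σ)

/-- The error of sampling in the gain of a deviation in round `t`. -/
noncomputable def gainError (ord : List (G.InfoSet i))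
    (oracle : ∀ j : G.InfoSet i, (Action j → Action j → ℝ) → Action j → ℝ) (fp : ℕ → ℕ)
    (τ : G.SeqStar i) (y : G.Seq i → ℝ) (u : ℕ → G.InfoSet i → unitInterval)
    (ℓ : ℕ → G.Seq i → ℝ) (t : ℕ) : ℝ :=
  gain τ y (ℓ t) ⬝ᵥ playAt ord oracle fp u ℓ t - gain τ y (ℓ t) ⬝ᵥ mixedAt ord oracle fp u ℓ t

theorem gainError_congr (τ : G.SeqStar i) (y : G.Seq i → ℝ)
    {u u' : ℕ → G.InfoSet i → unitInterval} {ℓ ℓ' : ℕ → G.Seq i → ℝ} {t : ℕ}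
    (hu : u t = u' t) (hℓ : ∀ s ≤ t, ℓ s = ℓ' s) :
    gainError ord oracle fp τ y u ℓ t = gainError ord oracle fp τ y u' ℓ' t := by
  rw [gainError, gainError, playAt_congr fp hu fun s hs => hℓ s hs.le,
    mixedAt_congr fp (u' := u') fun s hs => hℓ s hs.le, hℓ t le_rfl]

theorem measurable_gainError {Ω : Type*} [MeasurableSpace Ω] (hPR : G.PerfectRecall)
    (hord : IsTopDown ord) (horacle : ∀ j, Measurable (oracle j)) (τ : G.SeqStar i)
    (y : G.Seq i → ℝ) {u : Ω → ℕ → G.InfoSet i → unitInterval}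
    (hu : ∀ t, Measurable fun ω => u ω t)
    {ℓ : Ω → ℕ → G.Seq i → ℝ} (hℓ : ∀ t σ, Measurable fun ω => ℓ ω t σ) (t : ℕ) :
    Measurable fun ω => gainError ord oracle fp τ y (u ω) (ℓ ω) t :=
  (measurable_dotProduct (measurable_gain τ y (hℓ t))
    (measurable_playAt fp hPR hord horacle hu hℓ t)).sub
  (measurable_dotProduct (measurable_gain τ y (hℓ t))
    (measurable_mixedAt fp hPR hord horacle u hℓ t))

/-- The random numbers before round `t` and the utilities up to round `t`. -/
abbrev History (G : Game n Act) (i : Fin n) (t : ℕ) : Type :=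
  (Fin t → G.InfoSet i → unitInterval) × (Fin (t + 1) → G.Seq i → ℝ)

/-- The random numbers of a history, followed by `v` forever. -/
def History.numbers {t : ℕ} (h : History G i t) (v : G.InfoSet i → unitInterval) (s : ℕ) :
    G.InfoSet i → unitInterval :=
  if hs : s < t then h.1 ⟨s, hs⟩ else v

/-- The utilities of a history, followed by zero. -/
def History.utilities {t : ℕ} (h : History G i t) (s : ℕ) : G.Seq i → ℝ :=
  if hs : s < t + 1 then h.2 ⟨s, hs⟩ else 0

theorem History.measurable_numbers {t : ℕ} (s : ℕ) :
    Measurable fun p : History G i t × (G.InfoSet i → unitInterval) => p.1.numbers p.2 s := by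
  unfold History.numbers
  split_ifs with hs
  · exact (measurable_pi_apply _).comp (measurable_fst.comp measurable_fst)
  · exact measurable_snd

theorem History.measurable_numbers_const {t : ℕ} (v : G.InfoSet i → unitInterval) (s : ℕ) :
    Measurable fun h : History G i t => h.numbers v s := by
  unfold History.numbers
  split_ifs with hs
  · exact (measurable_pi_apply _).comp measurable_fst
  · exact measurable_const

theorem History.measurable_utilities {t : ℕ} (s : ℕ) (σ : G.Seq i) :
    Measurable fun h : History G i t => h.utilities s σ := by
  unfold History.utilities
  split_ifs with hs
  · exact (measurable_pi_apply σ).comp ((measurable_pi_apply _).comp measurable_snd)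
  · exact measurable_const

/-- Past errors are functions of the history, and the error of round `t` is a function of the
history and the fresh numbers. Entries that a history does not contain are filled arbitrarily; by
`gainError_congr` they have no influence. -/
theorem measure_gainError_ge_le (hPR : G.PerfectRecall) (hord : IsTopDown ord)
    (hfix : ∀ j, IsFixedPointOracle (oracle j)) (horacle : ∀ j, Measurable (oracle j))
    {Ω : Type*} [MeasurableSpace Ω] {P : Measure Ω} [IsProbabilityMeasure P]
    {U : ℕ → Ω → G.InfoSet i → unitInterval} {ℓ : ℕ → Ω → G.Seq i → ℝ}
    (hU : ∀ t, Measurable (U t)) (hℓ : ∀ t, Measurable (ℓ t)) (hlaw : ∀ t, P.map (U t) = volume)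
    (hind : ∀ t, IndepFun (U t)
      (fun ω => ((fun s : Fin t => U s ω), (fun s : Fin (t + 1) => ℓ s ω))) P)
    {T : ℕ} (hT : 0 < T) {D : ℝ} (hD0 : 0 < D)
    (hD : ∀ t < T, ∀ᵐ ω ∂P, ∀ q ∈ G.Q i, ∀ q' ∈ G.Q i, ℓ t ω ⬝ᵥ q - ℓ t ω ⬝ᵥ q' ≤ D)
    {τ : G.SeqStar i} {y : G.Seq i → ℝ} (hy : y ∈ QSub τ.1) {s : ℝ} (hs : 0 ≤ s) :
    P {ω | s ≤ ∑ t ∈ Finset.range T,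
        gainError ord oracle fp τ y (fun s => U s ω) (fun s => ℓ s ω) t} ≤
      ENNReal.ofReal (Real.exp (-(s ^ 2 / (2 * (T * D ^ 2))))) := by
  have hℓ' : ∀ t σ, Measurable fun ω => ℓ t ω σ := fun t σ => (measurable_pi_apply σ).comp (hℓ t)
  set H : ∀ t, Ω → History G i t :=
    fun t ω => ((fun s : Fin t => U s ω), (fun s : Fin (t + 1) => ℓ s ω)) with hHdef
  have hH : ∀ t, Measurable (H t) := fun t =>
    Measurable.prodMk (measurable_pi_lambda _ fun s : Fin t => hU s)
      (measurable_pi_lambda _ fun s : Fin (t + 1) => hℓ s)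
  have hnum : ∀ t ω v s, s < t → (H t ω).numbers v s = U s ω := fun t ω v s hs => dif_pos hs
  have hnum' : ∀ t ω v, (H t ω).numbers v t = v := fun t ω v => dif_neg (lt_irrefl t)
  have hut : ∀ t ω s, s ≤ t → (H t ω).utilities s = ℓ s ω := fun t ω s hs =>
    dif_pos (Nat.lt_succ_of_le hs)
  have hZm : ∀ t s, Measurable fun p : History G i t × (G.InfoSet i → unitInterval) =>
      gainError ord oracle fp τ y (p.1.numbers p.2) p.1.utilities s := fun t s =>
    measurable_gainError fp hPR hord horacle τ y History.measurable_numbers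
      (fun s σ => (History.measurable_utilities s σ).comp measurable_fst) s
  have hX : Measurable fun ω => ∑ t ∈ Finset.range T,
      gainError ord oracle fp τ y (fun s => U s ω) (fun s => ℓ s ω) t :=
    Finset.measurable_sum _ fun t _ => measurable_gainError (u := fun ω s => U s ω)
      (ℓ := fun ω s => ℓ s ω) fp hPR hord horacle τ y hU hℓ' t
  have hF : ∀ t, Measurable fun h : History G i t =>
      ∑ s ∈ Finset.range t, gainError ord oracle fp τ y (h.numbers 0) h.utilities s := fun t =>
    Finset.measurable_sum _ fun s _ =>
      measurable_gainError (u := fun (h : History G i t) => h.numbers 0)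
        (ℓ := fun (h : History G i t) => h.utilities) fp hPR hord horacle τ y
        (History.measurable_numbers_const 0) History.measurable_utilities s
  have hSF : ∀ t ω, ∑ s ∈ Finset.range t,
      gainError ord oracle fp τ y (fun s => U s ω) (fun s => ℓ s ω) s =
      ∑ s ∈ Finset.range t,
        gainError ord oracle fp τ y ((H t ω).numbers 0) (H t ω).utilities s := by
    intro t ω
    refine Finset.sum_congr rfl fun s hs => ?_
    rw [Finset.mem_range] at hs
    exact gainError_congr fp τ y (hnum t ω 0 s hs).symm fun r hr =>
      (hut t ω r (hr.trans hs.le)).symm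
  have hS : ∀ t ω, ∑ s ∈ Finset.range (t + 1),
      gainError ord oracle fp τ y (fun s => U s ω) (fun s => ℓ s ω) s =
      ∑ s ∈ Finset.range t, gainError ord oracle fp τ y (fun s => U s ω) (fun s => ℓ s ω) s +
        gainError ord oracle fp τ y ((H t ω).numbers (U t ω)) (H t ω).utilities t := by
    intro t ω
    rw [Finset.sum_range_succ]
    congr 1
    exact gainError_congr fp τ y (hnum' t ω _).symm fun r hr => (hut t ω r hr).symm
  -- Once the history is frozen, the fresh numbers enter only through `sample`, and the bound for
  -- one sampling step applies.
  have hcond : ∀ c, ∀ t < T, ∀ᵐ ω ∂P, ∫⁻ v : G.InfoSet i → unitInterval,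
      ENNReal.ofReal (Real.exp (c *
        gainError ord oracle fp τ y ((H t ω).numbers v) (H t ω).utilities t)) ≤
      ENNReal.ofReal (Real.exp (D ^ 2 * c ^ 2 / 2)) := by
    intro c t ht
    filter_upwards [hD t ht] with ω hω
    have h1 : ∀ v, gainError ord oracle fp τ y ((H t ω).numbers v) (H t ω).utilities t =
        gain τ y (ℓ t ω) ⬝ᵥ
          (sample ord v (mixedAt ord oracle fp 0 (H t ω).utilities t)).val -
        gain τ y (ℓ t ω) ⬝ᵥ mixedAt ord oracle fp 0 (H t ω).utilities t := by
      intro v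
      rw [gainError, playAt_eq, hnum', hut t ω t le_rfl, mixedAt_congr fp (u' := 0) fun _ _ => rfl]
    simp only [h1]
    exact lintegral_exp_sample_le hPR hord
      (mixedAt_mem_Q oracle fp hPR hord hfix _ _ t) _ (fun π hπ => abs_gain_le hPR hy hω hπ) c
  refine measure_ge_le_of_lintegral_exp hX (by positivity) (fun c => ?_) hs
  have key := lintegral_exp_sum_le (D := D) (H := H) hU hH hlaw hind
    (S := fun T ω => ∑ t ∈ Finset.range T,
      gainError ord oracle fp τ y (fun s => U s ω) (fun s => ℓ s ω) t)
    (F := fun t h => ∑ s ∈ Finset.range t, gainError ord oracle fp τ y (h.numbers 0) h.utilities s)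
    (Z := fun t p => gainError ord oracle fp τ y (p.1.numbers p.2) p.1.utilities t)
    hF (fun t => hZm t t) (fun ω => Finset.sum_range_zero _) hSF hS c T (hcond c)
  rwa [show (T * (D ^ 2 * c ^ 2 / 2) : ℝ) = T * D ^ 2 * c ^ 2 / 2 by ring] at key

/-- The vector with entries one on a set of sequences and zero elsewhere. -/
def indicatorSeq (A : Finset (G.SeqStar i)) : G.Seq i → ℝ
  | none => 0
  | some σ => if σ ∈ A then 1 else 0

/-- Encodes pure continuations by finite sets of sequences; there are `2 ^ m` of these, which is the
count in the union bound. -/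
theorem exists_eq_indicatorSeq {j : G.InfoSet i} {y : G.Seq i → ℝ} (hy : y ∈ PureSub j) :
    ∃ A : Finset (G.SeqStar i), y = indicatorSeq A := by
  classical
  refine ⟨Finset.univ.filter fun σ => y (some σ) = 1, funext fun σ => ?_⟩
  rcases σ with _ | σ
  · exact QSub_none hy.1
  · rcases hy.2 (some σ) with h | h <;> simp [indicatorSeq, h]

/-- Since `m * 2 ^ m ≤ 4 ^ m`, an exponent of at least `m log 4 + L` is enough. The constant works
because `1.8² / 2 = 1.62` exceeds `log 4 < 1.39`. -/
theorem union_bound_arith (m : ℕ) {L δ : ℝ} (hδ : 0 < δ) (hL : L = Real.log (1 / δ)) (hL0 : 0 ≤ L)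
    {T : ℕ} (hT : 0 < T) {D : ℝ} (hD : 0 < D) :
    (m * 2 ^ m : ℝ) * Real.exp (-((D * √T * (1.8 * √m + √(2 * L))) ^ 2 / (2 * (T * D ^ 2)))) ≤
      δ := by
  have hT' : (0 : ℝ) < T := by exact_mod_cast hT
  have h1 : (D * √T * (1.8 * √m + √(2 * L))) ^ 2 / (2 * (T * D ^ 2)) =
      (1.8 * √m + √(2 * L)) ^ 2 / 2 := by
    rw [mul_pow, mul_pow, Real.sq_sqrt hT'.le]
    field_simp
  have h2 : m * Real.log 4 + L ≤ (1.8 * √m + √(2 * L)) ^ 2 / 2 := by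
    have h3 : Real.log 4 = 2 * Real.log 2 := by
      rw [show (4 : ℝ) = 2 ^ 2 by norm_num, Real.log_pow]
      norm_num
    have h4 := Real.log_two_lt_d9
    have h5 : (1.8 * √(m : ℝ) + √(2 * L)) ^ 2 =
        3.24 * m + 3.6 * (√(m : ℝ) * √(2 * L)) + 2 * L := by
      nth_rewrite 2 [← Real.sq_sqrt (Nat.cast_nonneg (α := ℝ) m)]
      nth_rewrite 3 [← Real.sq_sqrt (show 0 ≤ 2 * L by linarith)]
      ring
    have h6 : 0 ≤ √(m : ℝ) * √(2 * L) := by positivity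
    rw [h5, h3]
    nlinarith [Nat.cast_nonneg (α := ℝ) m]
  rw [h1]
  calc (m * 2 ^ m : ℝ) * Real.exp (-((1.8 * √m + √(2 * L)) ^ 2 / 2))
      ≤ (2 ^ m * 2 ^ m) * Real.exp (-(m * Real.log 4 + L)) := by
        gcongr
        exact_mod_cast Nat.lt_two_pow_self.le
    _ = δ := by
        rw [neg_add, Real.exp_add, hL, one_div, Real.log_inv, neg_neg, Real.exp_log hδ,
          ← mul_pow, Real.exp_neg, ← Real.log_pow, Real.exp_log (by positivity)]
        norm_num

/-- The `√m` terms of regret matching and of the union bound add up to `2.8 √m ≤ m + 2`, by `(√m -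
1.4)² ≥ 0` and `1.4² < 2`. With the `m` from counterfactual regret minimization this is `2 (m + 1)`.
-/
theorem final_arith (m : ℕ) {L : ℝ} (T : ℕ) {D : ℝ} (hD : 0 ≤ D) :
    D * √T * (√m + m) + D * √T * (1.8 * √m + √(2 * L)) ≤
      2 * D * (m + 1 : ℕ) * √T + D * √(8 * T * L) := by
  have h1 : √(8 * T * L) = 2 * (√T * √(2 * L)) := by
    rw [← Real.sqrt_mul (Nat.cast_nonneg _), show 8 * (T : ℝ) * L = 2 ^ 2 * (T * (2 * L)) by ring,
      Real.sqrt_mul (by norm_num), Real.sqrt_sq (by norm_num)]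
  have h2 : 2.8 * √(m : ℝ) ≤ m + 2 := by
    nlinarith [Real.sq_sqrt (Nat.cast_nonneg (α := ℝ) m), sq_nonneg (√(m : ℝ) - 1.4)]
  have h3 : 0 ≤ D * √(T : ℝ) := by positivity
  have h4 : 0 ≤ D * √(T : ℝ) * √(2 * L) := by positivity
  rw [h1]
  push_cast
  nlinarith [mul_le_mul_of_nonneg_left h2 h3]

/-- The regret bound against an adaptive environment. -/
theorem regret_with_high_probability (hPR : G.PerfectRecall) (hord : IsTopDown ord)
    (hfix : ∀ j, IsFixedPointOracle (oracle j)) (horacle : ∀ j, Measurable (oracle j))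
    {Ω : Type*} [MeasurableSpace Ω] {P : Measure Ω} [IsProbabilityMeasure P]
    {U : ℕ → Ω → G.InfoSet i → unitInterval} {ℓ : ℕ → Ω → G.Seq i → ℝ}
    (hU : ∀ t, Measurable (U t)) (hℓ : ∀ t, Measurable (ℓ t)) (hlaw : ∀ t, P.map (U t) = volume)
    (hind : ∀ t, IndepFun (U t)
      (fun ω => ((fun s : Fin t => U s ω), (fun s : Fin (t + 1) => ℓ s ω))) P)
    (T : ℕ) (D : ℝ)
    (hD : ∀ t < T, ∀ᵐ ω ∂P, ∀ q ∈ G.Q i, ∀ q' ∈ G.Q i, ℓ t ω ⬝ᵥ q - ℓ t ω ⬝ᵥ q' ≤ D)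
    {δ : ℝ} (hδ : 0 < δ) (hδ1 : δ < 1) :
    ENNReal.ofReal (1 - δ) ≤
      P {ω | phiRegret (G.Dev i) (fun t => ℓ t ω)
          (fun t => playAt ord oracle fp (fun s => U s ω) (fun s => ℓ s ω) t) T ≤
        2 * D * Fintype.card (G.Seq i) * √(T : ℝ) + D * √(8 * T * Real.log (1 / δ))} := by
  classical
  set L := Real.log (1 / δ) with hL
  have hL0 : 0 ≤ L := Real.log_nonneg (by rw [le_div_iff₀ hδ]; linarith)
  -- Nonnegativity of `B` covers the case without deviations, in which the supremum of the empty set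
  -- is zero.
  have hsub : ∀ ω B, 0 ≤ B → (∀ (τ : G.SeqStar i) (y : G.Seq i → ℝ), y ∈ PureSub τ.1 →
      ∑ t ∈ Finset.range T, gain τ y (ℓ t ω) ⬝ᵥ
        playAt ord oracle fp (fun s => U s ω) (fun s => ℓ s ω) t ≤ B) →
      phiRegret (G.Dev i) (fun t => ℓ t ω)
        (fun t => playAt ord oracle fp (fun s => U s ω) (fun s => ℓ s ω) t) T ≤ B := by
    intro ω B hB h
    refine Real.sSup_le ?_ hB
    rintro _ ⟨φ, ⟨τ, y, hy, rfl⟩, rfl⟩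
    refine le_trans (le_of_eq (Finset.sum_congr rfl fun t _ => ?_)) (h τ y hy)
    rw [gain_dotProduct]
  have hle1 : ENNReal.ofReal (1 - δ) ≤ 1 :=
    ENNReal.ofReal_le_one.2 (by linarith)
  -- With no rounds there is no constraint on the sign of `D`, but both sides of the regret bound
  -- are zero.
  rcases Nat.eq_zero_or_pos T with rfl | hT
  · refine hle1.trans_eq (Eq.symm ?_)
    refine (measure_congr (Filter.eventuallyEq_univ.2 (
      Filter.Eventually.of_forall fun ω => ?_))).trans measure_univ
    refine (hsub ω 0 le_rfl fun τ y hy => by simp).trans (by simp)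
  have hall : ∀ᵐ ω ∂P, ∀ t < T, ∀ q ∈ G.Q i, ∀ q' ∈ G.Q i, ℓ t ω ⬝ᵥ q - ℓ t ω ⬝ᵥ q' ≤ D :=
    ae_all_iff.2 fun t => ae_all_iff.2 fun ht => hD t ht
  have hplay : ∀ ω t, playAt ord oracle fp (fun s => U s ω) (fun s => ℓ s ω) t ∈ G.Q i :=
    fun ω t => (playAt_mem_Pure oracle fp hPR hord hfix _ _ t).1
  have hD0 : 0 ≤ D := by
    obtain ⟨ω, hω⟩ := hall.exists
    have := hω 0 hT _ (hplay ω 0) _ (hplay ω 0)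
    rwa [sub_self] at this
  -- For `D = 0` every gain is almost surely at most zero; the tail bound needs a positive variance
  -- proxy.
  rcases hD0.eq_or_lt with rfl | hDpos
  · refine hle1.trans_eq (Eq.symm ?_)
    refine (measure_congr (Filter.eventuallyEq_univ.2 ?_)).trans measure_univ
    filter_upwards [hall] with ω hω
    refine (hsub ω 0 le_rfl fun τ y hy => Finset.sum_nonpos fun t ht => ?_).trans (by simp)
    exact (abs_le.1 (abs_gain_le hPR hy.1 (hω t (Finset.mem_range.1 ht)) (hplay ω t))).2
  set m := Fintype.card (G.SeqStar i) with hm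
  set s := D * √(T : ℝ) * (1.8 * √(m : ℝ) + √(2 * L)) with hs
  have hs0 : 0 ≤ s := by positivity
  set good := {ω | phiRegret (G.Dev i) (fun t => ℓ t ω)
    (fun t => playAt ord oracle fp (fun s => U s ω) (fun s => ℓ s ω) t) T ≤
    2 * D * Fintype.card (G.Seq i) * √(T : ℝ) + D * √(8 * T * L)} with hgood
  set null := {ω | ¬ ∀ t < T, ∀ q ∈ G.Q i, ∀ q' ∈ G.Q i, ℓ t ω ⬝ᵥ q - ℓ t ω ⬝ᵥ q' ≤ D} with hnull
  -- Indexed by all pairs of a trigger and a set of sequences, with the empty event for sets that do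
  -- not encode a strategy, so that the union is over a finite type.
  set bad : G.SeqStar i × Finset (G.SeqStar i) → Set Ω := fun p =>
    if indicatorSeq p.2 ∈ PureSub p.1.1 then {ω | s ≤ ∑ t ∈ Finset.range T,
      gainError ord oracle fp p.1 (indicatorSeq p.2) (fun s => U s ω) (fun s => ℓ s ω) t}
    else ∅ with hbad
  have hbadP : ∀ p, P (bad p) ≤ ENNReal.ofReal (Real.exp (-(s ^ 2 / (2 * (T * D ^ 2))))) := by
    intro p
    simp only [hbad]
    split_ifs with hp
    · exact measure_gainError_ge_le fp hPR hord hfix horacle hU hℓ hlaw hind hT hDpos hD hp.1 hs0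
    · simp
  -- The regret of the samples is the regret of the mixed strategies plus the sampling errors. The
  -- first is bounded surely off the null set, the second by `s` off the bad events.
  have hcover : goodᶜ ⊆ null ∪ ⋃ p, bad p := by
    intro ω hω
    by_contra hn
    rw [Set.mem_union, not_or, Set.mem_iUnion, not_exists] at hn
    have hrange := not_not.1 hn.1
    refine hω (hsub ω _ (by positivity) fun τ y hy => ?_)
    obtain ⟨A, rfl⟩ := exists_eq_indicatorSeq hy
    have h1 := hn.2 (τ, A)
    simp only [hbad, if_pos hy, Set.mem_ofPred_eq, not_le, gainError, Finset.sum_sub_distrib] at h1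
    have h2 := mixed_regret_bound oracle fp hPR hord hfix (fun s => U s ω) (fun s => ℓ s ω) hD0 T
      hrange hy.1
    simp only [← gain_dotProduct] at h2
    have h3 := final_arith m (L := L) T hD0
    rw [Fintype.card_option, ← hm]
    linarith
  have hcompl : P goodᶜ ≤ ENNReal.ofReal δ := by
    refine (measure_mono hcover).trans ((measure_union_le _ _).trans ?_)
    rw [show P null = 0 from hall, zero_add]
    refine (measure_iUnion_fintype_le P bad).trans ((Finset.sum_le_sum fun p _ => hbadP p).trans ?_)
    rw [Finset.sum_const, Finset.card_univ, Fintype.card_prod, Fintype.card_finset, ← hm,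
      nsmul_eq_mul, ← ENNReal.ofReal_natCast, ← ENNReal.ofReal_mul (Nat.cast_nonneg _)]
    refine ENNReal.ofReal_le_ofReal ?_
    push_cast
    exact union_bound_arith m hδ hL hL0 hT hDpos
  -- Subadditivity takes the place of the complement rule, so measurability of the regret event does
  -- not have to be established.
  have h1 : 1 ≤ P good + ENNReal.ofReal δ := by
    calc (1 : ENNReal) = P (good ∪ goodᶜ) := by rw [Set.union_compl_self, measure_univ]
      _ ≤ P good + P goodᶜ := measure_union_le _ _
      _ ≤ _ := by gcongr
  rw [ENNReal.ofReal_sub _ hδ.le, ENNReal.ofReal_one]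
  exact tsub_le_iff_right.2 h1

end Concentration

end Game

/-! ### The main theorem -/

theorem mainTheorem6 :
    ∃ C : ℕ, ∀ (n : ℕ) (Act : Type) [DecidableEq Act] (G : Game n Act), G.PerfectRecall →
      ∀ (i : Fin n) (ord : List (G.InfoSet i)), Game.IsTopDown ord →
      ∀ oracle : ∀ j : G.InfoSet i, (Game.Action j → Game.Action j → ℝ) → Game.Action j → ℝ,
        (∀ j, Game.IsFixedPointOracle (oracle j)) →
      ∀ fp : ℕ → ℕ,
        -- running times
        (∀ (M : G.Mem i) (ℓ : G.Seq i → ℝ),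
          (Game.observeUtility ord M ℓ).cost ≤ C * Fintype.card (G.Seq i) ^ 2) ∧
        (∀ (M : G.Mem i) (u : G.InfoSet i → unitInterval),
          (Game.nextElement ord oracle fp M u).cost ≤
            C * (Fintype.card (G.Seq i) ^ 2 +
              ∑ j : G.InfoSet i, fp (Fintype.card (Game.Action j)))) ∧
        -- the mixed iterates and the outputs lie in the right sets
        (∀ (u : ℕ → G.InfoSet i → unitInterval) (ℓ : ℕ → G.Seq i → ℝ) (t : ℕ),
          Game.mixedAt ord oracle fp u ℓ t ∈ G.Q i ∧
          Game.playAt ord oracle fp u ℓ t ∈ G.Pure i) ∧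
        -- the sampling step is unbiased
        (∀ q ∈ G.Q i, ∀ σ : G.Seq i,
          Integrable (fun u : G.InfoSet i → unitInterval => (Game.sample ord u q).val σ) ∧
          ∫ u : G.InfoSet i → unitInterval, (Game.sample ord u q).val σ = q σ) ∧
        -- the regret bound against an adaptive, possibly randomized, environment
        ((∀ j, Measurable (oracle j)) →
          ∀ (Ω : Type*) [MeasurableSpace Ω] (P : Measure Ω) [IsProbabilityMeasure P]
            (U : ℕ → Ω → G.InfoSet i → unitInterval) (ℓ : ℕ → Ω → G.Seq i → ℝ),
            (∀ t, Measurable (U t)) → (∀ t, Measurable (ℓ t)) →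
            (∀ t, P.map (U t) = volume) →
            (∀ t, IndepFun (U t)
              (fun ω => ((fun s : Fin t => U s ω), (fun s : Fin (t + 1) => ℓ s ω))) P) →
            (∀ t, Measurable fun ω =>
              Game.playAt ord oracle fp (fun s => U s ω) (fun s => ℓ s ω) t) ∧
            ∀ (T : ℕ) (D : ℝ),
              (∀ t < T, ∀ᵐ ω ∂P, ∀ q ∈ G.Q i, ∀ q' ∈ G.Q i, ℓ t ω ⬝ᵥ q - ℓ t ω ⬝ᵥ q' ≤ D) →
              ∀ δ : ℝ, 0 < δ → δ < 1 →
                ENNReal.ofReal (1 - δ) ≤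
                  P {ω | Game.phiRegret (G.Dev i) (fun t => ℓ t ω)
                      (fun t => Game.playAt ord oracle fp (fun s => U s ω) (fun s => ℓ s ω) t) T ≤
                    2 * D * Fintype.card (G.Seq i) * √(T : ℝ) +
                      D * √(8 * T * Real.log (1 / δ))}) := by
  -- The constant is that of `cost_nextElement_le`; `cost_observeUtility_le` has the smaller one
  -- `100`.
  refine ⟨200, fun n Act _ G hPR i ord hord oracle hfix fp => ⟨fun M ℓ => ?_, fun M u => ?_,
    fun u ℓ t => ⟨Game.mixedAt_mem_Q oracle fp hPR hord hfix u ℓ t,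
      Game.playAt_mem_Pure oracle fp hPR hord hfix u ℓ t⟩,
    fun q hq σ => ⟨Game.integrable_sample hPR hord hq σ, Game.integral_sample hPR hord hq σ⟩,
    fun horacle Ω _ P _ U ℓ hU hℓ hlaw hind => ⟨fun t => ?_, fun T D hD δ hδ hδ1 =>
      Game.regret_with_high_probability fp hPR hord hfix horacle hU hℓ hlaw hind T D hD hδ hδ1⟩⟩⟩
  · rw [Fintype.card_option]
    exact (Game.cost_observeUtility_le hord M ℓ).trans (by omega)
  · rw [Fintype.card_option]
    exact (Game.cost_nextElement_le hord oracle fp M u).trans (by omega)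
  · exact measurable_pi_lambda _ fun σ => Game.measurable_playAt (u := fun ω s => U s ω)
      (ℓ := fun ω s => ℓ s ω) fp hPR hord horacle hU
      (fun t σ => (measurable_pi_apply σ).comp (hℓ t)) t σ
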